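/- Let $k$ be an arbitrary field, and let $J$, $K$ be Hopf algebras over $k$ whose antipodes are bijective. Let $R$ be a braided Hopf algebra in the category ${}^J_J\mathcal{YD}$ of (left-left) Yetter–Drinfeld modules over $J$, and $S$ a braided Hopf algebra in ${}^K_K\mathcal{YD}$. Write $\Delta(t)=t_{(1)}\otimes t_{(2)}$ for the (braided) coproducts of $R$ and $S$, $\Delta(x)=x_1\otimes x_2$ for the coproducts of ordinary Hopf algebras, $v\mapsto v_{-1}\otimes v_0$ for coactions, $\varepsilon$ for counits and $\mathcal S$ for antipodes. Let $R\# J$ and $S\# K$ be the bosonizations (Radford biproducts). They are Hopf algebras containing $R,J$ and $S,K$, respectively, as subalgebras. A skew pairing of Hopf algebras $B,H$ is a linear map $\tau:B\otimes H\to k$ such that $\tau(bc,h)=\tau(b,h_1)\tau(c,h_2)$, $\tau(b,hl)=\tau(b_1,l)\tau(b_2,h)$, $\tau(b,1)=\varepsilon(b)$ and $\tau(1,h)=\varepsilon(h)$ for all $b,c\in B$, $h,l\in H$. The associated generalized quantum double $B\bowtie_\tau H$ is $B\otimes H$ with the product $$(b\otimes h)(c\otimes l)=\tau(c_1,h_1)\,bc_2\otimes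 h_2l\;\tau(\mathcal S(c_3),h_3),$$ that is, the deformation of $B\otimes H$ by the $2$-cocycle $\sigma(b\otimes h,c\otimes l)=\varepsilon(b)\tau(c,h)\varepsilon(l)$; it contains $B$ and $H$ as subalgebras. A bilinear form $X\otimes Y\to k$ is called non-degenerate if no non-zero $x\in X$ is orthogonal to all of $Y$ and no non-zero $y\in Y$ is orthogonal to all of $X$. For a Yetter–Drinfeld module $V$, the tensor algebra $T(V)$ is the braided graded Hopf algebra in which the elements of $V$ are primitive, and the Nichols algebra $\mathfrak B(V)$ is the quotient of $T(V)$ by its largest homogeneous braided Hopf ideal $\mathfrak a$ with $\mathfrak a\cap V=0$. Let $\tau:(R\# J)\otimes(S\# K)\to k$ be a skew pairing and let $\mathcal D=(R\# J)\bowtie_\tau(S\# K)$. Let $V=P(R)\in{}^J_J\mathcal{YD}$ and $W=P(S)\in{}^K_K\mathcal{YD}$ be the spaces of primitive elements. (1) Assume that $$\tau(a,s)=\varepsilon(a)\varepsilon(s)\quad(a\in J,\ s\in S),\qquad \tau(r,x)=\varepsilon(r)\varepsilon(x)\quad(r\in R,\ x\in K).\qquad(*)$$ Then in $\mathcal D$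 one has $$x_1v\,\mathcal S(x_2)=\tau(v_{-1},x)\,v_0\quad(x\in K,\ v\in V),\qquad a_1w\,\mathcal S(a_2)=\tau(\mathcal S(a),w_{-1})\,w_0\quad(a\in J,\ w\in W),$$ where $\mathcal S(x_2)$ and $\mathcal S(a_2)$ are formed in $K$ and $J$, and $V$ and $W$ are stable under conjugation by $K$ and $J$, respectively. (2) Assume $(*)$. Then, for all $r\in R$ and $s,s'\in S$, $$\tau(r,ss')=\tau(r_{(1)},s')\,\tau(r_{(2)},s).$$ If $\bar{\mathcal S}$ is a composite-inverse of the antipode of $R\# J$, then, for all $r,r'\in R$, $s\in S$, $a\in J$, $x\in K$, $$\tau(\bar{\mathcal S}(r)\bar{\mathcal S}(r'),s)=\tau(\bar{\mathcal S}(r),s_{(1)})\,\tau(\bar{\mathcal S}(r'),s_{(2)}),\qquad \tau(\bar{\mathcal S}(r)a,sx)=\tau(\bar{\mathcal S}(r),s)\,\tau(a,x).$$ Moreover, $\tau$ is non-degenerate if and only if the restrictions $\tau|_{J\otimes K}$ and $\tau|_{R\otimes S}$ are both non-degenerate. (3) Assume that the algebras $R$, $S$ are generated by $V$, $W$, respectively,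 and that $\tau(a,w)=0=\tau(v,x)$ for all $a\in J$, $x\in K$, $v\in V$, $w\in W$. If $\tau|_{J\otimes K}$ is non-degenerate, then the antipode of $R\# J$ has a composite-inverse $\bar{\mathcal S}$, and the following are equivalent: (a) $\tau|_{R\otimes S}$ is non-degenerate; (b) $\tau|_{V\otimes W}$ is non-degenerate, and $R$, $S$ are both Nichols, that is, the inclusions $V\hookrightarrow R$ and $W\hookrightarrow S$ extend uniquely to isomorphisms $\mathfrak B(V)\cong R$ and $\mathfrak B(W)\cong S$ of braided Hopf algebras; (c) $\tau|_{\bar R\otimes S}$ is non-degenerate, where $\bar R=\bar{\mathcal S}(R)$; (e) $\tau$ is non-degenerate. -/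

import Mathlib

open scoped TensorProduct
open TensorProduct

namespace YDHopf


/-- `map_zero`, specialized for faster simplification. -/
lemma alg_zero {k A B : Type*} [CommSemiring k] [Semiring A] [Semiring B] [Algebra k A]
    [Algebra k B] (f : A →ₐ[k] B) : f 0 = 0 := map_zero f

/-- `map_add`, specialized for faster simplification. -/
lemma alg_add {k A B : Type*} [CommSemiring k] [Semiring A] [Semiring B] [Algebra k A]
    [Algebra k B] (f : A →ₐ[k] B) (x y : A) : f (x + y) = f x + f y := map_add f x y

attribute [-simp] map_zero map_add
attribute [local simp] LinearMap.map_zero LinearEquiv.map_zero alg_zero LinearMap.map_add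
  LinearEquiv.map_add alg_add

section Twist

variable {k A B C : Type*} [Field k]

/-- The map `B ⊗ A → A ⊗ B`, `b ⊗ a ↦ (b₋₁ ▷ a) ⊗ b₀`. -/
noncomputable def braid [AddCommGroup A] [Module k A] [AddCommGroup B] [Module k B]
    [AddCommGroup C] [Module k C]
    (act : C →ₗ[k] A →ₗ[k] A) (coact : B →ₗ[k] C ⊗[k] B) : B ⊗[k] A →ₗ[k] A ⊗[k] B :=
  (TensorProduct.lift act).rTensor B ∘ₗ (TensorProduct.rightComm k C B A).toLinearMap ∘ₗ
    coact.rTensor A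

variable [Ring A] [Algebra k A] [Ring B] [Algebra k B] [Ring C] [Algebra k C]

/-- The multiplication `(a ⊗ b) (a' ⊗ b') = a ψ(b ⊗ a') b'` on `A ⊗ B`. -/
noncomputable def twistMul (ψ : B ⊗[k] A →ₗ[k] A ⊗[k] B) :
    (A ⊗[k] B) ⊗[k] (A ⊗[k] B) →ₗ[k] A ⊗[k] B :=
  TensorProduct.map (LinearMap.mul' k A) (LinearMap.mul' k B) ∘ₗ
    (TensorProduct.tensorTensorTensorAssoc k A A B B).symm.toLinearMap ∘ₗ
    (ψ.lTensor A).rTensor B ∘ₗ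
    (TensorProduct.tensorTensorTensorAssoc k A B A B).toLinearMap

variable (k A B C) in
/-- Data for a twisted tensor product of the algebras `A` and `B`: a coalgebra structure on the
algebra `C` (coassociativity is only needed on the image of the coaction), a `C`-module algebra
structure on `A` and a `C`-comodule algebra structure `b ↦ ∑ b₋₁ ⊗ b₀` on `B`. -/
structure SmashData where
  act : C →ₐ[k] Module.End k A
  coact : B →ₐ[k] C ⊗[k] B
  comul : C →ₗ[k] C ⊗[k] C
  counit : C →ₗ[k] k
  act_one : ∀ c, act c 1 = algebraMap k A (counit c)
  act_mul : ∀ c x y, act c (x * y) =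
    LinearMap.mul' k A (TensorProduct.map₂ act.toLinearMap act.toLinearMap (comul c) (x ⊗ₜ y))
  counit_coact : ∀ b, TensorProduct.lid k B (counit.rTensor B (coact b)) = b
  coassoc : ∀ b, TensorProduct.assoc k C C B (comul.rTensor B (coact b)) =
    coact.toLinearMap.lTensor C (coact b)

/-- aux: `c ⊗ b₀ ↦ a (c ▷ a') ⊗ b₀ b'`. -/
noncomputable def SmashData.T (s : SmashData k A B C) (a a' : A) (b' : B) :
    C ⊗[k] B →ₗ[k] A ⊗[k] B :=
  TensorProduct.map (LinearMap.mulLeft k a ∘ₗ LinearMap.applyₗ a' ∘ₗ s.act.toLinearMap)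
    (LinearMap.mulRight k b')

lemma SmashData.T_tmul (s : SmashData k A B C) (a a' : A) (b' : B) (c : C) (b : B) :
    s.T a a' b' (c ⊗ₜ b) = (a * s.act c a') ⊗ₜ (b * b') := rfl

/-- The twisted tensor product: the vector space `A ⊗ B` with the product
`(a ⊗ b) (a' ⊗ b') = ∑ a (b₋₁ ▷ a') ⊗ b₀ b'`. -/
def TwistedTensor (_s : SmashData k A B C) : Type _ := A ⊗[k] B

namespace TwistedTensor

variable (s : SmashData k A B C)

/-- The multiplication of `TwistedTensor s`. -/
noncomputable def mulMap : (A ⊗[k] B) ⊗[k] (A ⊗[k] B) →ₗ[k] A ⊗[k] B :=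
  twistMul (braid s.act.toLinearMap s.coact.toLinearMap)

lemma mulMap_tmul (a a' : A) (b b' : B) :
    mulMap s ((a ⊗ₜ b) ⊗ₜ (a' ⊗ₜ b')) = s.T a a' b' (s.coact b) := by
  simp only [mulMap, twistMul, braid, LinearMap.comp_apply, LinearEquiv.coe_coe,
    tensorTensorTensorAssoc_tmul, LinearMap.rTensor_tmul, LinearMap.lTensor_tmul,
    AlgHom.toLinearMap_apply]
  induction s.coact b using TensorProduct.induction_on with
  | zero => simp
  | tmul x y => simp [SmashData.T_tmul]
  | add x y hx hy => simp only [TensorProduct.add_tmul, map_add, TensorProduct.tmul_add, hx, hy]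


/-- auxiliary map `a ⊗ (a' ⊗ b) ↦ a a' ⊗ b` -/
noncomputable def N (k A B : Type*) [Field k] [Ring A] [Algebra k A] [Ring B] [Algebra k B] :
    A ⊗[k] (A ⊗[k] B) →ₗ[k] A ⊗[k] B :=
  (LinearMap.mul' k A).rTensor B ∘ₗ (TensorProduct.assoc k A A B).symm.toLinearMap

lemma N_T (a a' a'' : A) (b : B) (Z : C ⊗[k] B) :
    N k A B (a ⊗ₜ s.T a' a'' b Z) = s.T (a * a') a'' b Z := by
  induction Z using TensorProduct.induction_on with
  | zero => simp
  | tmul x y => simp [SmashData.T_tmul, N, mul_assoc]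
  | add x y hx hy => simp only [LinearMap.map_add, TensorProduct.tmul_add, hx, hy]

/-- auxiliary map -/
noncomputable def G (a a' a'' : A) (b'' : B) (Y : C ⊗[k] B) :
    C ⊗[k] (C ⊗[k] B) →ₗ[k] A ⊗[k] B :=
  N k A B ∘ₗ TensorProduct.map (LinearMap.mulLeft k a ∘ₗ LinearMap.applyₗ a' ∘ₗ s.act.toLinearMap)
    (s.T 1 a'' b'' ∘ₗ LinearMap.mulRight k Y)

lemma G_tmul (a a' a'' : A) (b'' : B) (Y : C ⊗[k] B) (c : C) (Z : C ⊗[k] B) :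
    G s a a' a'' b'' Y (c ⊗ₜ Z) = s.T (a * s.act c a') a'' b'' (Z * Y) := by
  simp [G, N_T]

lemma G_add (a a' a'' : A) (b'' : B) (Y Y' : C ⊗[k] B) :
    G s a a' a'' b'' (Y + Y') = G s a a' a'' b'' Y + G s a a' a'' b'' Y' := by
  ext; simp [G_tmul, mul_add]

lemma G_zero (a a' a'' : A) (b'' : B) : G s a a' a'' b'' (0 : C ⊗[k] B) = 0 := by
  ext; simp [G_tmul]

lemma mulMap_L (a a' a'' : A) (b' b'' : B) (X : C ⊗[k] B) :
    mulMap s (s.T a a' b' X ⊗ₜ (a'' ⊗ₜ b'')) =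
      G s a a' a'' b'' (s.coact b') (s.coact.toLinearMap.lTensor C X) := by
  induction X using TensorProduct.induction_on with
  | zero => simp
  | tmul x y => simp [SmashData.T_tmul, mulMap_tmul, G_tmul]
  | add x y hx hy => simp only [LinearMap.map_add, TensorProduct.add_tmul, hx, hy]

lemma mulMap_R (a a' a'' : A) (b b'' : B) (Y : C ⊗[k] B) :
    mulMap s ((a ⊗ₜ b) ⊗ₜ (s.T a' a'' b'' Y)) =
      G s a a' a'' b'' Y (TensorProduct.assoc k C C B (s.comul.rTensor B (s.coact b))) := by
  induction Y using TensorProduct.induction_on with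
  | zero => simp [G_zero]
  | add x y hx hy => simp only [LinearMap.map_add, TensorProduct.tmul_add, hx, hy, G_add, LinearMap.add_apply]
  | tmul c' b' =>
    rw [SmashData.T_tmul, mulMap_tmul]
    induction s.coact b using TensorProduct.induction_on with
    | zero => simp
    | add x y hx hy => simp only [LinearMap.map_add, LinearEquiv.map_add, hx, hy]
    | tmul c b =>
      rw [SmashData.T_tmul, s.act_mul, LinearMap.rTensor_tmul]
      induction s.comul c using TensorProduct.induction_on with
      | zero => simp
      | add x y hx hy =>
        simp only [LinearMap.map_add, LinearEquiv.map_add, TensorProduct.add_tmul, LinearMap.add_apply, mul_add, hx, hy]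
      | tmul c₁ c₂ => simp [G_tmul, SmashData.T_tmul, mul_assoc]

lemma mulMap_assoc (x y z : A ⊗[k] B) :
    mulMap s (mulMap s (x ⊗ₜ y) ⊗ₜ z) = mulMap s (x ⊗ₜ mulMap s (y ⊗ₜ z)) := by
  induction x using TensorProduct.induction_on with
  | zero => simp
  | add x x' hx hy => simp only [TensorProduct.add_tmul, map_add, hx, hy]
  | tmul a b =>
  induction y using TensorProduct.induction_on with
  | zero => simp
  | add x x' hx hy => simp only [TensorProduct.add_tmul, TensorProduct.tmul_add, map_add, hx, hy]
  | tmul a' b' =>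
  induction z using TensorProduct.induction_on with
  | zero => simp
  | add x x' hx hy => simp only [TensorProduct.tmul_add, map_add, hx, hy]
  | tmul a'' b'' => rw [mulMap_tmul, mulMap_tmul, mulMap_L, mulMap_R, s.coassoc]

lemma one_mulMap (x : A ⊗[k] B) : mulMap s ((1 ⊗ₜ 1) ⊗ₜ x) = x := by
  induction x using TensorProduct.induction_on with
  | zero => simp
  | add x x' hx hy => simp only [TensorProduct.tmul_add, map_add, hx, hy]
  | tmul a b =>
    rw [mulMap_tmul, map_one, Algebra.TensorProduct.one_def, SmashData.T_tmul]; simp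

lemma T_one (a : A) (X : C ⊗[k] B) :
    s.T a 1 1 X = a ⊗ₜ TensorProduct.lid k B (s.counit.rTensor B X) := by
  induction X using TensorProduct.induction_on with
  | zero => simp
  | add x x' hx hy => simp only [TensorProduct.tmul_add, map_add, hx, hy]
  | tmul c b =>
    rw [SmashData.T_tmul, s.act_one, mul_one, ← Algebra.commutes, ← Algebra.smul_def]
    simp [TensorProduct.smul_tmul]

lemma mulMap_one (x : A ⊗[k] B) : mulMap s (x ⊗ₜ (1 ⊗ₜ 1)) = x := by
  induction x using TensorProduct.induction_on with
  | zero => simp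
  | add x x' hx hy => simp only [TensorProduct.add_tmul, map_add, hx, hy]
  | tmul a b => rw [mulMap_tmul, T_one, s.counit_coact]


lemma mulMap_add (x y z : A ⊗[k] B) :
    mulMap s (x ⊗ₜ (y + z)) = mulMap s (x ⊗ₜ y) + mulMap s (x ⊗ₜ z) := by
  rw [TensorProduct.tmul_add, map_add]

lemma add_mulMap (x y z : A ⊗[k] B) :
    mulMap s ((x + y) ⊗ₜ z) = mulMap s (x ⊗ₜ z) + mulMap s (y ⊗ₜ z) := by
  rw [TensorProduct.add_tmul, map_add]

lemma zero_mulMap (x : A ⊗[k] B) : mulMap s (0 ⊗ₜ x) = 0 := by simp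

lemma mulMap_zero (x : A ⊗[k] B) : mulMap s (x ⊗ₜ 0) = 0 := by simp

lemma smul_mulMap (r : k) (x y : A ⊗[k] B) :
    mulMap s ((r • x) ⊗ₜ y) = r • mulMap s (x ⊗ₜ y) := by
  rw [← TensorProduct.smul_tmul', map_smul]

lemma mulMap_smul (r : k) (x y : A ⊗[k] B) :
    mulMap s (x ⊗ₜ (r • y)) = r • mulMap s (x ⊗ₜ y) := by
  rw [TensorProduct.tmul_smul, map_smul]

/-- The additive group underlying the twisted tensor product. -/
noncomputable abbrev addCommGroup : AddCommGroup (TwistedTensor s) :=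
  inferInstanceAs (AddCommGroup (A ⊗[k] B))

noncomputable instance : Ring (TwistedTensor s) where
  __ := addCommGroup s
  mul x y := mulMap s (x ⊗ₜ y)
  one := (1 : A) ⊗ₜ[k] (1 : B)
  mul_assoc x y z := mulMap_assoc s x y z
  one_mul x := one_mulMap s x
  mul_one x := mulMap_one s x
  left_distrib x y z := mulMap_add s x y z
  right_distrib x y z := add_mulMap s x y z
  zero_mul x := zero_mulMap s x
  mul_zero x := mulMap_zero s x

/-- The vector space underlying the twisted tensor product. -/
noncomputable abbrev module : Module k (TwistedTensor s) :=
  inferInstanceAs (Module k (A ⊗[k] B))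

noncomputable instance : Algebra k (TwistedTensor s) :=
  letI : Module k (TwistedTensor s) := module s
  Algebra.ofModule (fun r x y => smul_mulMap s r x y) (fun r x y => mulMap_smul s r x y)

/-- The identity map from `A ⊗ B` to the twisted tensor product. -/
noncomputable def ofTensor : A ⊗[k] B ≃ₗ[k] TwistedTensor s := LinearEquiv.refl k (A ⊗[k] B)

lemma ofTensor_mul (x y : A ⊗[k] B) :
    ofTensor s x * ofTensor s y = ofTensor s (mulMap s (x ⊗ₜ y)) := rfl

lemma ofTensor_mul_tmul (a a' : A) (b b' : B) :
    ofTensor s (a ⊗ₜ b) * ofTensor s (a' ⊗ₜ b') = ofTensor s (s.T a a' b' (s.coact b)) := by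
  rw [ofTensor_mul, mulMap_tmul]

lemma one_def : (1 : TwistedTensor s) = ofTensor s (1 ⊗ₜ 1) := rfl

lemma one_T_one (y : B) (X : C ⊗[k] B) :
    s.T 1 1 y X = 1 ⊗ₜ (TensorProduct.lid k B (s.counit.rTensor B X) * y) := by
  induction X using TensorProduct.induction_on with
  | zero => simp
  | add x x' hx hy => simp only [TensorProduct.tmul_add, map_add, hx, hy, add_mul]
  | tmul c b =>
    rw [SmashData.T_tmul, s.act_one, one_mul, Algebra.algebraMap_eq_smul_one]
    simp [TensorProduct.smul_tmul]

/-- The inclusion `a ↦ a ⊗ 1`. -/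
noncomputable def inl : A →ₐ[k] TwistedTensor s :=
  AlgHom.ofLinearMap ((ofTensor s).toLinearMap ∘ₗ (TensorProduct.mk k A B).flip 1) rfl
    fun x y => by
      simp only [LinearMap.comp_apply, LinearMap.flip_apply, TensorProduct.mk_apply,
        LinearEquiv.coe_coe, ofTensor_mul_tmul, map_one, Algebra.TensorProduct.one_def,
        SmashData.T_tmul, Module.End.one_apply, mul_one]

/-- The inclusion `b ↦ 1 ⊗ b`. -/
noncomputable def inr : B →ₐ[k] TwistedTensor s :=
  AlgHom.ofLinearMap ((ofTensor s).toLinearMap ∘ₗ TensorProduct.mk k A B 1) rfl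
    fun x y => by
      simp only [LinearMap.comp_apply, TensorProduct.mk_apply, LinearEquiv.coe_coe,
        ofTensor_mul_tmul, one_T_one, s.counit_coact]

lemma inl_apply (a : A) : inl s a = ofTensor s (a ⊗ₜ 1) := rfl

lemma inr_apply (b : B) : inr s b = ofTensor s (1 ⊗ₜ b) := rfl


lemma inl_mul_inr (a : A) (b : B) : inl s a * inr s b = ofTensor s (a ⊗ₜ b) := by
  simp only [inl_apply, inr_apply, ofTensor_mul_tmul, map_one, Algebra.TensorProduct.one_def,
    SmashData.T_tmul, Module.End.one_apply, mul_one, one_mul]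

lemma braid_eq_T (a : A) (b : B) :
    braid s.act.toLinearMap s.coact.toLinearMap (b ⊗ₜ a) = s.T 1 a 1 (s.coact b) := by
  simp only [braid, LinearMap.comp_apply, LinearMap.rTensor_tmul, AlgHom.toLinearMap_apply,
    LinearEquiv.coe_coe]
  induction s.coact b using TensorProduct.induction_on with
  | zero => simp
  | tmul x y => simp [SmashData.T_tmul]
  | add x y hx hy => simp only [TensorProduct.add_tmul, map_add, hx, hy]

lemma inr_mul_inl (a : A) (b : B) : inr s b * inl s a =
    ofTensor s (braid s.act.toLinearMap s.coact.toLinearMap (b ⊗ₜ a)) := by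
  rw [inr_apply, inl_apply, ofTensor_mul_tmul, braid_eq_T]

/-- Two algebra maps `f : A → D`, `g : B → D` with `g b * f a = ∑ f (b₋₁ ▷ a) * g b₀` combine to
an algebra map `a ⊗ b ↦ f a * g b`. -/
noncomputable def lift {D : Type*} [Ring D] [Algebra k D] (f : A →ₐ[k] D) (g : B →ₐ[k] D)
    (h : ∀ a b, g b * f a = LinearMap.mul' k D (TensorProduct.map f.toLinearMap g.toLinearMap
      (braid s.act.toLinearMap s.coact.toLinearMap (b ⊗ₜ a)))) : TwistedTensor s →ₐ[k] D :=
  AlgHom.ofLinearMap ((LinearMap.mul' k D ∘ₗ TensorProduct.map f.toLinearMap g.toLinearMap) ∘ₗ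
      (ofTensor s).symm.toLinearMap) (by rw [one_def]; simp) fun x y => by
    have hT : ∀ (a a' : A) (b' : B) (X : C ⊗[k] B),
        LinearMap.mul' k D (TensorProduct.map f.toLinearMap g.toLinearMap (s.T a a' b' X)) =
        f a * LinearMap.mul' k D
          (TensorProduct.map f.toLinearMap g.toLinearMap (s.T 1 a' 1 X)) * g b' := by
      intro a a' b' X
      induction X using TensorProduct.induction_on with
      | zero => simp
      | tmul x y => simp [SmashData.T_tmul, mul_assoc]
      | add x y hx hy => simp only [LinearMap.map_add, hx, hy, mul_add, add_mul]
    obtain ⟨x, rfl⟩ := (ofTensor s).surjective x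
    obtain ⟨y, rfl⟩ := (ofTensor s).surjective y
    rw [ofTensor_mul]
    simp only [LinearMap.comp_apply, LinearEquiv.coe_coe, LinearEquiv.symm_apply_apply]
    induction x using TensorProduct.induction_on with
    | zero => simp
    | add x x' hx hy => simp only [TensorProduct.add_tmul, map_add, add_mul, hx, hy]
    | tmul a b =>
    induction y using TensorProduct.induction_on with
    | zero => simp
    | add x x' hx hy => simp only [TensorProduct.tmul_add, map_add, mul_add, hx, hy]
    | tmul a' b' =>
      rw [mulMap_tmul, hT, ← braid_eq_T, ← h]
      simp [mul_assoc]

lemma lift_ofTensor {D : Type*} [Ring D] [Algebra k D] (f : A →ₐ[k] D) (g : B →ₐ[k] D) (h) (a : A)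
    (b : B) : lift s f g h (ofTensor s (a ⊗ₜ b)) = f a * g b := rfl

lemma lift_inl {D : Type*} [Ring D] [Algebra k D] (f : A →ₐ[k] D) (g : B →ₐ[k] D) (h) (a : A) :
    lift s f g h (inl s a) = f a := by
  rw [inl_apply, lift_ofTensor, map_one, mul_one]

lemma lift_inr {D : Type*} [Ring D] [Algebra k D] (f : A →ₐ[k] D) (g : B →ₐ[k] D) (h) (b : B) :
    lift s f g h (inr s b) = g b := by
  rw [inr_apply, lift_ofTensor, map_one, one_mul]

lemma algHom_ext {D : Type*} [Semiring D] [Algebra k D] {f g : TwistedTensor s →ₐ[k] D}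
    (hl : ∀ a, f (inl s a) = g (inl s a)) (hr : ∀ b, f (inr s b) = g (inr s b)) : f = g := by
  ext x
  obtain ⟨x, rfl⟩ := (ofTensor s).surjective x
  induction x using TensorProduct.induction_on with
  | zero => simp
  | add x x' hx hy => simp only [LinearEquiv.map_add, alg_add, hx, hy]
  | tmul a b => rw [← inl_mul_inr, map_mul, map_mul, hl, hr]

end TwistedTensor
end Twist


section YD

variable {k J V : Type*} [Field k] [Ring J] [HopfAlgebra k J] [AddCommGroup V] [Module k V]

/-- The map `(a ⊗ (b ⊗ c), x ⊗ v) ↦ a x S(c) ⊗ (b ▷ v)`. -/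
noncomputable def ydMap (act : J →ₗ[k] V →ₗ[k] V) :
    J ⊗[k] (J ⊗[k] J) →ₗ[k] J ⊗[k] V →ₗ[k] J ⊗[k] V :=
  TensorProduct.map₂
      (TensorProduct.lift ((LinearMap.llcomp k J J J).compl₁₂ (LinearMap.mul k J)
        ((LinearMap.mul k J).flip ∘ₗ HopfAlgebra.antipode k))) act ∘ₗ
    (TensorProduct.assoc k J J J).symm.toLinearMap ∘ₗ
    (TensorProduct.comm k J J).toLinearMap.lTensor J

lemma ydMap_tmul (act : J →ₗ[k] V →ₗ[k] V) (a b c x : J) (v : V) :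
    ydMap act (a ⊗ₜ (b ⊗ₜ c)) (x ⊗ₜ v) = (a * (x * HopfAlgebra.antipode k c)) ⊗ₜ act b v := rfl

variable (k J V) in
/-- A left-left Yetter-Drinfeld module over the Hopf algebra `J`: a left module and left comodule
with `ρ(a ▷ v) = ∑ a₁ v₋₁ S(a₃) ⊗ (a₂ ▷ v₀)`. -/
structure YDModule where
  act : J →ₐ[k] Module.End k V
  coact : V →ₗ[k] J ⊗[k] V
  counit_coact : ∀ v, TensorProduct.lid k V (Coalgebra.counit.rTensor V (coact v)) = v
  coassoc : ∀ v, TensorProduct.assoc k J J V (Coalgebra.comul.rTensor V (coact v)) =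
    coact.lTensor J (coact v)
  coact_act : ∀ a v, coact (act a v) =
    ydMap act.toLinearMap (Coalgebra.comul.lTensor J (Coalgebra.comul a)) (coact v)


/-- aux -/
noncomputable def assoc₃ (k J : Type*) [Field k] [AddCommGroup J] [Module k J] :
    (J ⊗[k] (J ⊗[k] J)) ⊗[k] J ≃ₗ[k] J ⊗[k] (J ⊗[k] (J ⊗[k] J)) :=
  TensorProduct.assoc k J (J ⊗[k] J) J ≪≫ₗ
    LinearEquiv.lTensor J (TensorProduct.assoc k J J J)

lemma assoc₃_comul (k J : Type*) [Field k] [AddCommGroup J] [Module k J] [Coalgebra k J] (a : J) :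
    assoc₃ k J ((Coalgebra.comul.lTensor J ∘ₗ Coalgebra.comul).rTensor J (Coalgebra.comul a)) =
    (Coalgebra.comul.lTensor J ∘ₗ Coalgebra.comul).lTensor J (Coalgebra.comul (R := k) a) := by
  have : (assoc₃ k J).toLinearMap ∘ₗ
      (Coalgebra.comul.lTensor J ∘ₗ Coalgebra.comul).rTensor J ∘ₗ Coalgebra.comul =
      (Coalgebra.comul.lTensor J ∘ₗ Coalgebra.comul).lTensor J ∘ₗ Coalgebra.comul (R := k) := by
    simp only [assoc₃, coassoc_simps]
  exact LinearMap.congr_fun this a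

/-- aux: `p ⊗ s ↦ (ydMap p X) (s ⊗ 1)`. -/
noncomputable def ydK (act : J →ₗ[k] V →ₗ[k] V) (X : J ⊗[k] V) :
    (J ⊗[k] (J ⊗[k] J)) ⊗[k] J →ₗ[k] J ⊗[k] V :=
  TensorProduct.lift ((LinearMap.rTensorHom V ∘ₗ (LinearMap.mul k J).flip).compl₂
      (LinearMap.applyₗ X ∘ₗ ydMap act)).flip

lemma ydK_tmul (act : J →ₗ[k] V →ₗ[k] V) (X : J ⊗[k] V) (P : J ⊗[k] (J ⊗[k] J)) (s : J) :
    ydK act X (P ⊗ₜ s) = (LinearMap.mulRight k s).rTensor V (ydMap act P X) := rfl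

lemma ydK_symm (act : J →ₗ[k] V →ₗ[k] V) (X : J ⊗[k] V) (p q : J) (D : J ⊗[k] J) :
    ydK act X ((assoc₃ k J).symm (p ⊗ₜ (q ⊗ₜ D))) =
      TensorProduct.map (LinearMap.mulLeft k p ∘ₗ LinearMap.mulRight k
        (LinearMap.mul' k J ((HopfAlgebra.antipode k).rTensor J D))) (act q) X := by
  induction D using TensorProduct.induction_on with
  | zero => simp [TensorProduct.map_zero_left]
  | add x y hx hy =>
    simp only [TensorProduct.tmul_add, map_add, hx, hy]
    clear hx hy
    induction X using TensorProduct.induction_on with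
    | zero => simp
    | add u v hu hv => simp only [LinearMap.map_add, ← hu, ← hv]; abel
    | tmul u v => simp [mul_add, TensorProduct.add_tmul]
  | tmul r s =>
    simp only [assoc₃, LinearEquiv.trans_symm, LinearEquiv.trans_apply,
      LinearEquiv.symm_lTensor, LinearEquiv.lTensor_tmul, TensorProduct.assoc_symm_tmul, ydK_tmul]
    induction X using TensorProduct.induction_on with
    | zero => simp
    | add x y hx hy => simp only [LinearMap.map_add, hx, hy]
    | tmul x v => simp [ydMap_tmul, mul_assoc]

lemma ydK_comul (act : J →ₗ[k] V →ₗ[k] V) (X : J ⊗[k] V) (a : J) :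
    ydK act X ((Coalgebra.comul.lTensor J ∘ₗ Coalgebra.comul).rTensor J (Coalgebra.comul a)) =
    TensorProduct.map₂ (LinearMap.mul k J) act (Coalgebra.comul a) X := by
  have h : ∀ Z : J ⊗[k] (J ⊗[k] J),
      ydK act X ((assoc₃ k J).symm ((Coalgebra.comul.lTensor J).lTensor J Z)) =
      TensorProduct.map₂ (LinearMap.mul k J) act
        ((TensorProduct.rid k J).toLinearMap.lTensor J
          ((Coalgebra.counit.lTensor J).lTensor J Z)) X := by
    intro Z
    induction Z using TensorProduct.induction_on with
    | zero => simp
    | add x y hx hy => simp only [LinearMap.map_add, LinearEquiv.map_add, hx, hy, LinearMap.add_apply]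
    | tmul p Z =>
      induction Z using TensorProduct.induction_on with
      | zero => simp
      | add x y hx hy => simp only [LinearMap.map_add, LinearEquiv.map_add, hx, hy, LinearMap.add_apply, TensorProduct.tmul_add]
      | tmul q c =>
        simp only [LinearMap.lTensor_tmul, ydK_symm, HopfAlgebra.mul_antipode_rTensor_comul_apply]
        induction X using TensorProduct.induction_on with
        | zero => simp
        | add x y hx hy => simp only [LinearMap.map_add, hx, hy]
        | tmul x v =>
          simp [TensorProduct.map₂_apply_tmul, Algebra.algebraMap_eq_smul_one,
            TensorProduct.smul_tmul']
  rw [← LinearEquiv.symm_apply_apply (assoc₃ k J) (LinearMap.rTensor J _ _), assoc₃_comul,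
    LinearMap.lTensor_comp, LinearMap.comp_apply, h]
  congr 2
  rw [← LinearMap.comp_apply, ← LinearMap.lTensor_comp, ← LinearMap.comp_apply,
    ← LinearMap.lTensor_comp, LinearMap.comp_assoc, Coalgebra.lTensor_counit_comp_comul]
  have : (TensorProduct.rid k J).toLinearMap ∘ₗ (TensorProduct.mk k J k).flip 1 =
      LinearMap.id := by ext; simp
  rw [this, LinearMap.lTensor_id, LinearMap.id_apply]

/-- The form `∑ a₁ v₋₁ ⊗ (a₂ ▷ v₀) = ∑ (a₁ ▷ v)₋₁ a₂ ⊗ (a₁ ▷ v)₀` of the compatibility. -/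
lemma YDModule.coact_act' (M : YDModule k J V) (a : J) (v : V) :
    TensorProduct.lift (((LinearMap.rTensorHom V ∘ₗ (LinearMap.mul k J).flip).compl₂
      (M.coact ∘ₗ LinearMap.applyₗ v ∘ₗ M.act.toLinearMap)).flip) (Coalgebra.comul a) =
    TensorProduct.map₂ (LinearMap.mul k J) M.act.toLinearMap (Coalgebra.comul a) (M.coact v) := by
  rw [← ydK_comul]
  induction (Coalgebra.comul a : J ⊗[k] J) using TensorProduct.induction_on with
  | zero => simp
  | add x y hx hy => simp only [LinearMap.map_add, hx, hy]
  | tmul x y =>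
    rw [LinearMap.rTensor_tmul, ydK_tmul, LinearMap.comp_apply, ← M.coact_act]
    rfl
end YD

section Braided

variable (k J R : Type*) [Field k] [Ring J] [HopfAlgebra k J] [Ring R] [Algebra k R]
  [Coalgebra k R]

/-- A braided Hopf algebra `R` in the category of Yetter-Drinfeld modules over `J`: the unit, the
product, the counit and the coproduct are morphisms of Yetter-Drinfeld modules, the counit is
multiplicative, the coproduct is multiplicative for the braided product
`(r ⊗ s) (r' ⊗ s') = ∑ r (s₋₁ ▷ r') ⊗ s₀ s'` on `R ⊗ R`, and the identity map has a convolution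
inverse, the antipode (which is then automatically a morphism of Yetter-Drinfeld modules). -/
structure BraidedHopfAlgebra extends YDModule k J R where
  act_one : ∀ a, act a 1 = algebraMap k R (Coalgebra.counit a)
  act_mul : ∀ a r s, act a (r * s) = LinearMap.mul' k R
    (TensorProduct.map₂ act.toLinearMap act.toLinearMap (Coalgebra.comul a) (r ⊗ₜ s))
  counit_act : ∀ a r, Coalgebra.counit (R := k) (act a r) =
    Coalgebra.counit (R := k) a * Coalgebra.counit (R := k) r
  comul_act : ∀ a r, Coalgebra.comul (act a r) =
    TensorProduct.map₂ act.toLinearMap act.toLinearMap (Coalgebra.comul a) (Coalgebra.comul r)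
  coact_one : coact 1 = 1 ⊗ₜ 1
  coact_mul : ∀ r s, coact (r * s) = coact r * coact s
  coact_counit : ∀ r, TensorProduct.rid k J (Coalgebra.counit.lTensor J (coact r)) =
    algebraMap k J (Coalgebra.counit r)
  coact_comul : ∀ r, Coalgebra.comul.lTensor J (coact r) =
    (LinearMap.mul' k J).rTensor (R ⊗[k] R) (TensorProduct.tensorTensorTensorComm k J R J R
      (TensorProduct.map coact coact (Coalgebra.comul r)))
  counit_one : Coalgebra.counit (R := k) (1 : R) = 1
  counit_mul : ∀ r s : R, Coalgebra.counit (R := k) (r * s) =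
    Coalgebra.counit (R := k) r * Coalgebra.counit (R := k) s
  comul_one : Coalgebra.comul (R := k) (1 : R) = 1 ⊗ₜ 1
  comul_mul : ∀ r s : R, Coalgebra.comul (R := k) (r * s) =
    twistMul (braid act.toLinearMap coact) (Coalgebra.comul r ⊗ₜ Coalgebra.comul s)
  antipode : R →ₗ[k] R
  mul_antipode_rTensor_comul : ∀ r, LinearMap.mul' k R (antipode.rTensor R (Coalgebra.comul r)) =
    algebraMap k R (Coalgebra.counit r)
  mul_antipode_lTensor_comul : ∀ r, LinearMap.mul' k R (antipode.lTensor R (Coalgebra.comul r)) =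
    algebraMap k R (Coalgebra.counit r)

variable {k J R}

namespace BraidedHopfAlgebra

variable (H : BraidedHopfAlgebra k J R)

/-- The coaction of `R` as an algebra map. -/
noncomputable def coactAlgHom : R →ₐ[k] J ⊗[k] R :=
  AlgHom.ofLinearMap H.coact H.coact_one H.coact_mul

lemma coactAlgHom_apply (r : R) : H.coactAlgHom r = H.coact r := rfl

/-- The data of the braided tensor square of `R`. -/
noncomputable def braidedSquare : SmashData k R R J where
  act := H.act
  coact := H.coactAlgHom
  comul := Coalgebra.comul
  counit := Coalgebra.counit
  act_one := H.act_one
  act_mul := H.act_mul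
  counit_coact := H.counit_coact
  coassoc := H.coassoc

/-- The data of the smash product `R # J`. -/
noncomputable def smash : SmashData k R J J where
  act := H.act
  coact := Bialgebra.comulAlgHom k J
  comul := Coalgebra.comul
  counit := Coalgebra.counit
  act_one := H.act_one
  act_mul := H.act_mul
  counit_coact b := by simp
  coassoc b := by simp

/-- The bosonization `R # J`. Its product is `(r # a) (s # b) = ∑ r (a₁ ▷ s) # a₂ b`, its coproduct
is `bosComul` and its antipode is `bosAntipode`. -/
abbrev Bosonization : Type _ := TwistedTensor H.smash

/-- `R → R # J` -/
noncomputable abbrev inR : R →ₐ[k] H.Bosonization := TwistedTensor.inl H.smash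

/-- `J → R # J` -/
noncomputable abbrev inJ : J →ₐ[k] H.Bosonization := TwistedTensor.inr H.smash

lemma inJ_mul_inR (a : J) (r : R) : H.inJ a * H.inR r = LinearMap.mul' k _
    (TensorProduct.map (H.inR.toLinearMap ∘ₗ LinearMap.applyₗ r ∘ₗ H.act.toLinearMap)
      H.inJ.toLinearMap (Coalgebra.comul a)) := by
  rw [TwistedTensor.inr_mul_inl, TwistedTensor.braid_eq_T]
  change TwistedTensor.ofTensor H.smash (H.smash.T 1 r 1 (Coalgebra.comul a)) = _
  induction (Coalgebra.comul a : J ⊗[k] J) using TensorProduct.induction_on with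
  | zero => simp
  | tmul x y => simp [SmashData.T_tmul, TwistedTensor.inl_mul_inr, smash]
  | add x y hx hy => simp only [LinearMap.map_add, LinearEquiv.map_add, hx, hy]

/-- `r ↦ r₋₁ ⊗ r₀` as a map into the tensor square of the bosonization -/
noncomputable def rho : R →ₐ[k] H.Bosonization ⊗[k] H.Bosonization :=
  (Algebra.TensorProduct.map H.inJ H.inR).comp H.coactAlgHom

/-- `x ⊗ y ↦ x y₋₁ ⊗ y₀` -/
noncomputable def phi : TwistedTensor H.braidedSquare →ₐ[k] H.Bosonization ⊗[k] H.Bosonization :=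
  TwistedTensor.lift H.braidedSquare
    ((Algebra.TensorProduct.includeLeft : H.Bosonization →ₐ[k] _).comp H.inR) H.rho <| by
  intro a b
  rw [TwistedTensor.braid_eq_T]
  have hL : ∀ X : J ⊗[k] R, Algebra.TensorProduct.map H.inJ H.inR X * (H.inR a ⊗ₜ 1) =
      LinearMap.mul' k (H.Bosonization ⊗[k] H.Bosonization)
        (TensorProduct.map
          ((TensorProduct.mk k H.Bosonization H.Bosonization).flip 1 ∘ₗ
            H.inR.toLinearMap ∘ₗ LinearMap.applyₗ a ∘ₗ H.act.toLinearMap)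
          (Algebra.TensorProduct.map H.inJ H.inR).toLinearMap
          (TensorProduct.assoc k J J R (Coalgebra.comul.rTensor R X))) := by
    intro X
    induction X using TensorProduct.induction_on with
    | zero => simp
    | add x y hx hy => simp only [LinearMap.map_add, LinearEquiv.map_add, alg_add, add_mul, hx, hy]
    | tmul c r =>
      simp only [Algebra.TensorProduct.map_tmul, Algebra.TensorProduct.tmul_mul_tmul, inJ_mul_inR,
        LinearMap.rTensor_tmul, mul_one]
      induction (Coalgebra.comul c : J ⊗[k] J) using TensorProduct.induction_on with
      | zero => simp
      | add x y hx hy => simp only [LinearMap.map_add, LinearEquiv.map_add, TensorProduct.add_tmul, hx, hy]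
      | tmul x y => simp
  have hR : ∀ X : J ⊗[k] R, LinearMap.mul' k (H.Bosonization ⊗[k] H.Bosonization)
      (TensorProduct.map
        ((Algebra.TensorProduct.includeLeft : H.Bosonization →ₐ[k] _).comp H.inR).toLinearMap
        H.rho.toLinearMap (H.braidedSquare.T 1 a 1 X)) =
      LinearMap.mul' k (H.Bosonization ⊗[k] H.Bosonization)
        (TensorProduct.map
          ((TensorProduct.mk k H.Bosonization H.Bosonization).flip 1 ∘ₗ
            H.inR.toLinearMap ∘ₗ LinearMap.applyₗ a ∘ₗ H.act.toLinearMap)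
          (Algebra.TensorProduct.map H.inJ H.inR).toLinearMap
          (H.coact.lTensor J X)) := by
    intro X
    induction X using TensorProduct.induction_on with
    | zero => simp
    | add x y hx hy => simp only [LinearMap.map_add, hx, hy]
    | tmul c r =>
      simp [SmashData.T_tmul, rho, coactAlgHom_apply, braidedSquare]
  refine (hL (H.coact b)).trans ?_
  rw [H.coassoc]
  exact (hR _).symm

lemma phi_apply (X : R ⊗[k] R) : H.phi (TwistedTensor.ofTensor H.braidedSquare X) =
    LinearMap.mul' k (H.Bosonization ⊗[k] H.Bosonization) (TensorProduct.map
      ((TensorProduct.mk k H.Bosonization H.Bosonization).flip 1 ∘ₗ H.inR.toLinearMap)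
        H.rho.toLinearMap X) := rfl

/-- The coproduct of `R` as an algebra map into the braided tensor square. -/
noncomputable def comulAlgHom : R →ₐ[k] TwistedTensor H.braidedSquare :=
  AlgHom.ofLinearMap ((TwistedTensor.ofTensor H.braidedSquare).toLinearMap ∘ₗ Coalgebra.comul)
    (by simp only [LinearMap.comp_apply, H.comul_one]; rfl)
    (fun r s => by simp only [LinearMap.comp_apply, H.comul_mul]; rfl)

/-- restriction of coproduct of bosonization to `R` -/
noncomputable def comulR : R →ₐ[k] H.Bosonization ⊗[k] H.Bosonization :=
  H.phi.comp H.comulAlgHom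

lemma comulR_apply (r : R) : H.comulR r =
    LinearMap.mul' k (H.Bosonization ⊗[k] H.Bosonization) (TensorProduct.map
      ((TensorProduct.mk k H.Bosonization H.Bosonization).flip 1 ∘ₗ H.inR.toLinearMap)
        H.rho.toLinearMap (Coalgebra.comul r)) := rfl

/-- restriction of coproduct of bosonization to `J` -/
noncomputable def comulJ : J →ₐ[k] H.Bosonization ⊗[k] H.Bosonization :=
  (Algebra.TensorProduct.map H.inJ H.inJ).comp (Bialgebra.comulAlgHom k J)

lemma comulJ_apply (a : J) : H.comulJ a =
  (Algebra.TensorProduct.map H.inJ H.inJ) (Coalgebra.comul a) := rfl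


section conv

open WithConv

variable {E : Type*} [Ring E] [Algebra k E]

/-- aux: `f` followed by right multiplication by `e`. -/
noncomputable def mr (e : E) (f : WithConv (J →ₗ[k] E)) : WithConv (J →ₗ[k] E) :=
  toConv (LinearMap.mulRight k e ∘ₗ f.ofConv)

lemma mr_mul (e : E) (f g : WithConv (J →ₗ[k] E)) : mr e (f * g) = f * mr e g := by
  ext a
  simp only [mr, LinearMap.convMul_def, LinearMap.comp_apply, ofConv_toConv]
  induction (Coalgebra.comul a : J ⊗[k] J) using TensorProduct.induction_on with
  | zero => simp
  | tmul x y => simp [mul_assoc]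
  | add x y hx hy => simp only [LinearMap.map_add, hx, hy]

lemma mr_mul_mr (e e' : E) (f g : WithConv (J →ₗ[k] E)) (h : ∀ a, Commute (g.ofConv a) e) :
    mr (e * e') (f * g) = mr e f * mr e' g := by
  ext a
  simp only [mr, LinearMap.convMul_def, LinearMap.comp_apply, ofConv_toConv]
  induction (Coalgebra.comul a : J ⊗[k] J) using TensorProduct.induction_on with
  | zero => simp
  | tmul x y =>
    simp only [TensorProduct.map_tmul, LinearMap.mul'_apply, LinearMap.mulRight_apply,
      LinearMap.comp_apply]
    rw [← mul_assoc, mul_assoc _ _ e, (h y).eq]; simp only [mul_assoc]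
  | add x y hx hy => simp only [LinearMap.map_add, hx, hy]

end conv

open WithConv in
/-- aux -/
noncomputable def j₁ : WithConv (J →ₗ[k] H.Bosonization ⊗[k] H.Bosonization) :=
  toConv ((TensorProduct.mk k H.Bosonization H.Bosonization).flip 1 ∘ₗ H.inJ.toLinearMap)

open WithConv in
/-- aux -/
noncomputable def j₂ : WithConv (J →ₗ[k] H.Bosonization ⊗[k] H.Bosonization) :=
  toConv (TensorProduct.mk k H.Bosonization H.Bosonization 1 ∘ₗ H.inJ.toLinearMap)

open WithConv in
/-- aux -/
noncomputable def P₁ (x : R) : WithConv (J →ₗ[k] H.Bosonization ⊗[k] H.Bosonization) :=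
  toConv ((TensorProduct.mk k H.Bosonization H.Bosonization).flip 1 ∘ₗ H.inR.toLinearMap ∘ₗ
    LinearMap.applyₗ x ∘ₗ H.act.toLinearMap)

open WithConv in
/-- aux -/
noncomputable def P₂ (x : R) : WithConv (J →ₗ[k] H.Bosonization ⊗[k] H.Bosonization) :=
  toConv (TensorProduct.mk k H.Bosonization H.Bosonization 1 ∘ₗ H.inR.toLinearMap ∘ₗ
    LinearMap.applyₗ x ∘ₗ H.act.toLinearMap)

open WithConv in
/-- aux -/
noncomputable def Q (y : R) : WithConv (J →ₗ[k] H.Bosonization ⊗[k] H.Bosonization) :=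
  toConv (H.rho.toLinearMap ∘ₗ LinearMap.applyₗ y ∘ₗ H.act.toLinearMap)

open WithConv

lemma comulJ_conv : toConv H.comulJ.toLinearMap = H.j₁ * H.j₂ := by
  ext a
  simp only [j₁, j₂, LinearMap.convMul_def, LinearMap.comp_apply, ofConv_toConv,
    AlgHom.toLinearMap_apply, comulJ_apply]
  induction (Coalgebra.comul a : J ⊗[k] J) using TensorProduct.induction_on with
  | zero => simp
  | tmul x y => simp
  | add x y hx hy => simp only [LinearMap.map_add, alg_add, hx, hy]

lemma mr_j₁ (x : R) : mr (H.inR x ⊗ₜ 1) H.j₁ = H.P₁ x * H.j₁ := by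
  ext a
  simp only [mr, j₁, P₁, LinearMap.convMul_def, LinearMap.comp_apply, ofConv_toConv,
    AlgHom.toLinearMap_apply, LinearMap.flip_apply, TensorProduct.mk_apply,
    LinearMap.mulRight_apply, Algebra.TensorProduct.tmul_mul_tmul, inJ_mul_inR, mul_one]
  induction (Coalgebra.comul a : J ⊗[k] J) using TensorProduct.induction_on with
  | zero => simp
  | tmul x y => simp
  | add x y hx hy => simp only [LinearMap.map_add, TensorProduct.add_tmul, hx, hy]

lemma mr_j₂ (x : R) : mr (1 ⊗ₜ H.inR x) H.j₂ = H.P₂ x * H.j₂ := by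
  ext a
  simp only [mr, j₂, P₂, LinearMap.convMul_def, LinearMap.comp_apply, ofConv_toConv,
    AlgHom.toLinearMap_apply, TensorProduct.mk_apply,
    LinearMap.mulRight_apply, Algebra.TensorProduct.tmul_mul_tmul, inJ_mul_inR, mul_one]
  induction (Coalgebra.comul a : J ⊗[k] J) using TensorProduct.induction_on with
  | zero => simp
  | tmul x y => simp
  | add x y hx hy => simp only [LinearMap.map_add, TensorProduct.tmul_add, hx, hy]

lemma mr_comulJ_inR (x : R) : mr (H.inR x ⊗ₜ 1) (H.j₁ * H.j₂) = H.P₁ x * (H.j₁ * H.j₂) := by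
  have h := mr_mul_mr (H.inR x ⊗ₜ 1) 1 H.j₁ H.j₂ fun a => by
    simp [j₂, Commute, SemiconjBy]
  rw [mul_one, mr_j₁] at h
  rw [h, mul_assoc]
  congr 2
  ext; simp [mr]

/-- aux -/
noncomputable def U (Y : J ⊗[k] R) : WithConv (J →ₗ[k] H.Bosonization ⊗[k] H.Bosonization) :=
  toConv ((Algebra.TensorProduct.map H.inJ H.inR).toLinearMap ∘ₗ LinearMap.applyₗ Y ∘ₗ
    TensorProduct.map₂ (LinearMap.mul k J) H.act.toLinearMap ∘ₗ Coalgebra.comul)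

lemma mr_U (Y : J ⊗[k] R) : mr (Algebra.TensorProduct.map H.inJ H.inR Y) (H.j₁ * H.j₂) =
    H.U Y * H.j₂ := by
  induction Y using TensorProduct.induction_on with
  | zero => ext; simp [mr, U]
  | add x y hx hy =>
    have h1 : H.U (x + y) = H.U x + H.U y := by ext; simp [U]
    have h2 : ∀ e e' f, mr (e + e') f = mr e f +
      (mr e' f : WithConv (J →ₗ[k] H.Bosonization ⊗[k] H.Bosonization)) := by
      intros; ext; simp [mr, mul_add]
    rw [h1, add_mul, ← hx, ← hy, map_add, h2]
  | tmul p q =>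
    have h := mr_mul_mr (H.inJ p ⊗ₜ 1) (1 ⊗ₜ H.inR q) H.j₁ H.j₂ fun a => by
      simp [j₂, Commute, SemiconjBy]
    rw [Algebra.TensorProduct.tmul_mul_tmul, mul_one, one_mul, mr_j₂, ← mul_assoc] at h
    rw [Algebra.TensorProduct.map_tmul, h]
    congr 1
    ext a
    simp only [mr, j₁, P₂, U, LinearMap.convMul_def, LinearMap.comp_apply, ofConv_toConv,
      AlgHom.toLinearMap_apply]
    induction (Coalgebra.comul a : J ⊗[k] J) using TensorProduct.induction_on with
    | zero => simp
    | tmul x y => simp [TensorProduct.map₂_apply_tmul]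
    | add x y hx hy => simp only [LinearMap.map_add, alg_add, hx, hy]

lemma U_coact (y : R) : H.U (H.coact y) = H.Q y * H.j₁ := by
  ext a
  simp only [j₁, Q, U, LinearMap.convMul_def, LinearMap.comp_apply, ofConv_toConv,
      LinearMap.applyₗ_apply_apply, ← H.coact_act']
  induction (Coalgebra.comul a : J ⊗[k] J) using TensorProduct.induction_on with
  | zero => simp
  | add x y hx hy => simp only [LinearMap.map_add, hx, hy]
  | tmul x z =>
    simp only [TensorProduct.map_tmul, TensorProduct.lift.tmul, LinearMap.mul'_apply,
      LinearMap.comp_apply, LinearMap.flip_apply, LinearMap.compl₂_apply, AlgHom.toLinearMap_apply,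
      LinearMap.applyₗ_apply_apply, rho, AlgHom.comp_apply, coactAlgHom_apply,
      TensorProduct.mk_apply, LinearMap.coe_rTensorHom]
    induction H.coact (H.act x y) using TensorProduct.induction_on with
    | zero => simp
    | add x y hx hy => simp only [LinearMap.map_add, alg_add, hx, hy, add_mul]
    | tmul c r => simp

lemma mr_comulJ_rho (y : R) : mr (H.rho y) (H.j₁ * H.j₂) = H.Q y * (H.j₁ * H.j₂) := by
  rw [rho, AlgHom.comp_apply, coactAlgHom_apply, mr_U, U_coact, mul_assoc]

lemma comulJ_mul_phi (X : R ⊗[k] R) (a : J) :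
    H.comulJ a * H.phi (TwistedTensor.ofTensor H.braidedSquare X) =
    LinearMap.mul' k _ (TensorProduct.map
      (H.phi.toLinearMap ∘ₗ (TwistedTensor.ofTensor H.braidedSquare).toLinearMap ∘ₗ
        LinearMap.applyₗ X ∘ₗ
        TensorProduct.map₂ H.act.toLinearMap H.act.toLinearMap ∘ₗ Coalgebra.comul)
      H.comulJ.toLinearMap (Coalgebra.comul a)) := by
  suffices h : mr (H.phi (TwistedTensor.ofTensor H.braidedSquare X)) (H.j₁ * H.j₂) =
      toConv (H.phi.toLinearMap ∘ₗ (TwistedTensor.ofTensor H.braidedSquare).toLinearMap ∘ₗ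
        LinearMap.applyₗ X ∘ₗ
        TensorProduct.map₂ H.act.toLinearMap H.act.toLinearMap ∘ₗ Coalgebra.comul) *
        (H.j₁ * H.j₂) by
    rw [← comulJ_conv] at h
    exact LinearMap.congr_fun (congrArg WithConv.ofConv h) a
  induction X using TensorProduct.induction_on with
  | zero => ext; simp [mr]
  | add x y hx hy =>
    have h2 : ∀ e e' f, mr (e + e') f = mr e f +
      (mr e' f : WithConv (J →ₗ[k] H.Bosonization ⊗[k] H.Bosonization)) := by
      intros; ext; simp [mr, mul_add]
    rw [map_add, map_add, h2, hx, hy, ← add_mul]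
    congr 1
    ext; simp
  | tmul x y =>
    have h : H.phi (TwistedTensor.ofTensor H.braidedSquare (x ⊗ₜ y)) =
      (H.inR x ⊗ₜ 1) * H.rho y := rfl
    have h3 : ∀ e e' f, mr (e * e') f =
      (mr e' (mr e f) : WithConv (J →ₗ[k] H.Bosonization ⊗[k] H.Bosonization)) := by
      intros; ext; simp [mr, mul_assoc]
    rw [h, h3, mr_comulJ_inR, mr_mul, mr_comulJ_rho, ← mul_assoc]
    congr 1
    ext a
    simp only [P₁, Q, LinearMap.convMul_def, LinearMap.comp_apply, ofConv_toConv,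
      LinearEquiv.coe_coe, AlgHom.toLinearMap_apply, phi_apply]
    induction (Coalgebra.comul a : J ⊗[k] J) using TensorProduct.induction_on with
    | zero => simp
    | tmul x y => simp [TensorProduct.map₂_apply_tmul]
    | add x y hx hy => simp only [LinearMap.map_add, hx, hy]

lemma comul_compat (r : R) (a : J) : H.comulJ a * H.comulR r =
    LinearMap.mul' k _ (TensorProduct.map H.comulR.toLinearMap H.comulJ.toLinearMap
      (braid H.smash.act.toLinearMap H.smash.coact.toLinearMap (a ⊗ₜ r))) := by
  rw [TwistedTensor.braid_eq_T]
  change _ = LinearMap.mul' k _ (TensorProduct.map H.comulR.toLinearMap H.comulJ.toLinearMap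
    (H.smash.T 1 r 1 (Coalgebra.comul a)))
  have := H.comulJ_mul_phi (Coalgebra.comul r) a
  refine Eq.trans this ?_
  induction (Coalgebra.comul a : J ⊗[k] J) using TensorProduct.induction_on with
  | zero => simp
  | add x y hx hy => simp only [LinearMap.map_add, hx, hy]
  | tmul x y =>
    simp only [TensorProduct.map_tmul, SmashData.T_tmul, LinearMap.comp_apply,
      LinearMap.applyₗ_apply_apply, ← H.comul_act, one_mul, mul_one]
    rfl

/-- The coproduct of the bosonization, `r # a ↦ ∑ (r₍₁₎ # r₍₂₎₋₁ a₁) ⊗ (r₍₂₎₀ # a₂)`. -/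
noncomputable def bosComul : H.Bosonization →ₐ[k] H.Bosonization ⊗[k] H.Bosonization :=
  TwistedTensor.lift H.smash H.comulR H.comulJ H.comul_compat

/-- counit on R -/
noncomputable def counitR : R →ₐ[k] k := AlgHom.ofLinearMap Coalgebra.counit H.counit_one H.counit_mul

/-- The counit of the bosonization, `r # a ↦ ε(r) ε(a)`. -/
noncomputable def bosCounit : H.Bosonization →ₐ[k] k :=
  TwistedTensor.lift H.smash H.counitR (Bialgebra.counitAlgHom k J) <| by
    intro r a
    rw [TwistedTensor.braid_eq_T]
    change _ = LinearMap.mul' k _ (TensorProduct.map _ _ (H.smash.T 1 r 1 (Coalgebra.comul a)))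

    have h : ∀ X : J ⊗[k] J, Coalgebra.counit (R := k) (TensorProduct.rid k J
        (Coalgebra.counit.lTensor J X)) * Coalgebra.counit (R := k) r =
        LinearMap.mul' k k (TensorProduct.map H.counitR.toLinearMap
          (Bialgebra.counitAlgHom k J).toLinearMap (H.smash.T 1 r 1 X)) := by
      intro X
      induction X using TensorProduct.induction_on with
      | zero => simp
      | add x y hx hy => simp only [LinearMap.map_add, LinearEquiv.map_add, hx, hy, add_mul]
      | tmul x y =>
        have := H.counit_act x r
        simp [SmashData.T_tmul, counitR, smash, this]; ring
    rw [← h]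
    simp [counitR]

lemma bosComul_inR (r : R) : H.bosComul (H.inR r) = H.comulR r := TwistedTensor.lift_inl ..

lemma bosComul_inJ (a : J) : H.bosComul (H.inJ a) = H.comulJ a := TwistedTensor.lift_inr ..

lemma bosCounit_inR (r : R) : H.bosCounit (H.inR r) = Coalgebra.counit r :=
  TwistedTensor.lift_inl ..

lemma bosCounit_inJ (a : J) : H.bosCounit (H.inJ a) = Coalgebra.counit a :=
  TwistedTensor.lift_inr ..

end BraidedHopfAlgebra
end Braided

namespace BraidedHopfAlgebra
variable {k J R : Type*} [Field k] [Ring J] [HopfAlgebra k J] [Ring R] [Algebra k R]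
  [Coalgebra k R] (H : BraidedHopfAlgebra k J R)

lemma rho_apply (r : R) : H.rho r = Algebra.TensorProduct.map H.inJ H.inR (H.coact r) := rfl

/-- aux `c ⊗ (x ⊗ z) ↦ c ⊗ phi (x ⊗ z)` -/
noncomputable def cN : J ⊗[k] (R ⊗[k] R) →ₗ[k]
    H.Bosonization ⊗[k] (H.Bosonization ⊗[k] H.Bosonization) :=
  TensorProduct.map H.inJ.toLinearMap
    (H.phi.toLinearMap ∘ₗ (TwistedTensor.ofTensor H.braidedSquare).toLinearMap)

lemma phi_tmul (x y : R) : H.phi (TwistedTensor.ofTensor H.braidedSquare (x ⊗ₜ y)) =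
    (H.inR x ⊗ₜ 1) * H.rho y := rfl

lemma comulR_eq_phi (r : R) :
    H.comulR r = H.phi (TwistedTensor.ofTensor H.braidedSquare (Coalgebra.comul r)) := rfl

/-- aux -/
noncomputable def cL : H.Bosonization ⊗[k] H.Bosonization →ₐ[k]
    H.Bosonization ⊗[k] (H.Bosonization ⊗[k] H.Bosonization) :=
  (Algebra.TensorProduct.assoc k k k H.Bosonization H.Bosonization H.Bosonization).toAlgHom.comp
    (Algebra.TensorProduct.map H.bosComul (AlgHom.id k H.Bosonization))

/-- aux -/
noncomputable def cR : H.Bosonization ⊗[k] H.Bosonization →ₐ[k]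
    H.Bosonization ⊗[k] (H.Bosonization ⊗[k] H.Bosonization) :=
  Algebra.TensorProduct.map (AlgHom.id k H.Bosonization) H.bosComul

/-- aux: `X ↦ assoc (X ⊗ 1)` -/
noncomputable def cA : H.Bosonization ⊗[k] H.Bosonization →ₐ[k]
    H.Bosonization ⊗[k] (H.Bosonization ⊗[k] H.Bosonization) :=
  (Algebra.TensorProduct.assoc k k k H.Bosonization H.Bosonization H.Bosonization).toAlgHom.comp
    Algebra.TensorProduct.includeLeft

lemma cA_tmul (b c : H.Bosonization) : H.cA (b ⊗ₜ c) = b ⊗ₜ (c ⊗ₜ 1) := rfl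

lemma cL_rho (y : R) : H.cL (H.rho y) =
    Algebra.TensorProduct.map H.inJ H.rho (H.coact y) := by
  have h1 : ∀ X : J ⊗[k] R, H.cL (Algebra.TensorProduct.map H.inJ H.inR X) =
      TensorProduct.map H.inJ.toLinearMap (Algebra.TensorProduct.map H.inJ H.inR).toLinearMap
        (TensorProduct.assoc k J J R (Coalgebra.comul.rTensor R X)) := by
    intro X
    induction X using TensorProduct.induction_on with
    | zero => simp
    | add x y hx hy => simp only [LinearMap.map_add, LinearEquiv.map_add, alg_add, hx, hy]
    | tmul c r =>
      simp only [cL, Algebra.TensorProduct.map_tmul, AlgHom.comp_apply, bosComul_inJ,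
        comulJ_apply, LinearMap.rTensor_tmul]
      induction (Coalgebra.comul c : J ⊗[k] J) using TensorProduct.induction_on with
      | zero => simp
      | add x y hx hy => simp only [LinearMap.map_add, LinearEquiv.map_add, alg_add, TensorProduct.add_tmul, hx, hy]
      | tmul x y => simp
  have h2 : ∀ X : J ⊗[k] R,
      TensorProduct.map H.inJ.toLinearMap (Algebra.TensorProduct.map H.inJ H.inR).toLinearMap
        (H.coact.lTensor J X) = Algebra.TensorProduct.map H.inJ H.rho X := by
    intro X
    induction X using TensorProduct.induction_on with
    | zero => simp
    | add x y hx hy => simp only [LinearMap.map_add, alg_add, hx, hy]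
    | tmul c r => simp [rho_apply]; rfl
  rw [rho_apply, h1, H.coassoc, h2]

lemma cR_rho (y : R) : H.cR (H.rho y) = LinearMap.mul' k _ (TensorProduct.map
    (H.cA.comp H.rho).toLinearMap
    ((Algebra.TensorProduct.map H.inJ H.rho).comp H.coactAlgHom).toLinearMap
    (Coalgebra.comul y)) := by
  have h1 : ∀ X : J ⊗[k] R, H.cR (Algebra.TensorProduct.map H.inJ H.inR X) =
      H.cN (Coalgebra.comul.lTensor J X) := by
    intro X
    induction X using TensorProduct.induction_on with
    | zero => simp
    | add x y hx hy => simp only [LinearMap.map_add, alg_add, hx, hy]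
    | tmul c r => simp [cR, cN, bosComul_inR, comulR_eq_phi]
  rw [rho_apply, h1, H.coact_comul]
  induction (Coalgebra.comul y : R ⊗[k] R) using TensorProduct.induction_on with
  | zero => simp
  | add x y hx hy => simp only [LinearMap.map_add, LinearEquiv.map_add, hx, hy]
  | tmul x z =>
    simp only [TensorProduct.map_tmul, LinearMap.mul'_apply, AlgHom.toLinearMap_apply,
      AlgHom.comp_apply, coactAlgHom_apply, rho_apply]
    generalize H.coact x = X
    generalize H.coact z = Z
    induction X using TensorProduct.induction_on with
    | zero => simp
    | add x y hx hy => simp only [LinearMap.map_add, LinearEquiv.map_add, alg_add, TensorProduct.add_tmul, hx, hy, add_mul]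
    | tmul c x =>
      induction Z using TensorProduct.induction_on with
      | zero => simp
      | add x y hx hy => simp only [LinearMap.map_add, LinearEquiv.map_add, alg_add, TensorProduct.tmul_add, hx, hy, mul_add]
      | tmul d z => simp [cN, phi_tmul, cA_tmul]

lemma bosComul_coassoc : (Algebra.TensorProduct.assoc k k k H.Bosonization H.Bosonization
      H.Bosonization).toAlgHom.comp
      ((Algebra.TensorProduct.map H.bosComul (AlgHom.id k H.Bosonization)).comp H.bosComul) =
    (Algebra.TensorProduct.map (AlgHom.id k H.Bosonization) H.bosComul).comp H.bosComul := by
  change H.cL.comp H.bosComul = H.cR.comp H.bosComul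
  apply TwistedTensor.algHom_ext
  · intro r
    change H.cL (H.bosComul (H.inR r)) = H.cR (H.bosComul (H.inR r))
    rw [bosComul_inR, comulR_eq_phi]
    -- common form
    let W : R ⊗[k] (R ⊗[k] R) →ₗ[k]
        H.Bosonization ⊗[k] (H.Bosonization ⊗[k] H.Bosonization) :=
      LinearMap.mul' k _ ∘ₗ TensorProduct.map
        (H.cA.toLinearMap ∘ₗ (TensorProduct.mk k H.Bosonization H.Bosonization).flip 1 ∘ₗ
          H.inR.toLinearMap)
        (LinearMap.mul' k _ ∘ₗ TensorProduct.map (H.cA.comp H.rho).toLinearMap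
          ((Algebra.TensorProduct.map H.inJ H.rho).comp H.coactAlgHom).toLinearMap)
    have h1 : ∀ X : R ⊗[k] R, H.cL (H.phi (TwistedTensor.ofTensor H.braidedSquare X)) =
        W (TensorProduct.assoc k R R R (Coalgebra.comul.rTensor R X)) := by
      intro X
      induction X using TensorProduct.induction_on with
      | zero => simp
      | add x y hx hy => simp only [LinearMap.map_add, LinearEquiv.map_add, alg_add, hx, hy]
      | tmul x y =>
        have hx : H.cL (H.inR x ⊗ₜ 1) = H.cA (H.comulR x) := by
          simp [cL, cA, bosComul_inR]
        rw [phi_tmul, map_mul, cL_rho, hx, comulR_eq_phi, LinearMap.rTensor_tmul]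
        induction (Coalgebra.comul x : R ⊗[k] R) using TensorProduct.induction_on with
        | zero => simp
        | add x y hx hy => simp only [LinearMap.map_add, LinearEquiv.map_add, alg_add, TensorProduct.add_tmul, hx, hy, add_mul]
        | tmul u v => simp [W, phi_tmul, coactAlgHom_apply, mul_assoc]; rfl
    have h2 : ∀ X : R ⊗[k] R, H.cR (H.phi (TwistedTensor.ofTensor H.braidedSquare X)) =
        W (Coalgebra.comul.lTensor R X) := by
      intro X
      induction X using TensorProduct.induction_on with
      | zero => simp
      | add x y hx hy => simp only [LinearMap.map_add, LinearEquiv.map_add, alg_add, hx, hy]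
      | tmul x y =>
        have hx : H.cR (H.inR x ⊗ₜ 1) = H.cA (H.inR x ⊗ₜ 1) := by
          simp [cR, cA_tmul, Algebra.TensorProduct.one_def]
        rw [phi_tmul, map_mul, cR_rho, hx]
        simp [W]
    rw [h1, h2, Coalgebra.coassoc_apply]
  · intro a
    change H.cL (H.bosComul (H.inJ a)) = H.cR (H.bosComul (H.inJ a))
    rw [bosComul_inJ, comulJ_apply]
    have h1 : ∀ X : J ⊗[k] J, H.cL (Algebra.TensorProduct.map H.inJ H.inJ X) =
        TensorProduct.map H.inJ.toLinearMap (TensorProduct.map H.inJ.toLinearMap H.inJ.toLinearMap)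
          (TensorProduct.assoc k J J J (Coalgebra.comul.rTensor J X)) := by
      intro X
      induction X using TensorProduct.induction_on with
      | zero => simp
      | add x y hx hy => simp only [LinearMap.map_add, LinearEquiv.map_add, alg_add, hx, hy]
      | tmul c r =>
        simp only [cL, Algebra.TensorProduct.map_tmul, AlgHom.comp_apply, bosComul_inJ,
          comulJ_apply, LinearMap.rTensor_tmul]
        induction (Coalgebra.comul c : J ⊗[k] J) using TensorProduct.induction_on with
        | zero => simp
        | add x y hx hy => simp only [LinearMap.map_add, LinearEquiv.map_add, alg_add, TensorProduct.add_tmul, hx, hy]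
        | tmul x y => simp
    have h2 : ∀ X : J ⊗[k] J, H.cR (Algebra.TensorProduct.map H.inJ H.inJ X) =
        TensorProduct.map H.inJ.toLinearMap (TensorProduct.map H.inJ.toLinearMap H.inJ.toLinearMap)
          (Coalgebra.comul.lTensor J X) := by
      intro X
      induction X using TensorProduct.induction_on with
      | zero => simp
      | add x y hx hy => simp only [LinearMap.map_add, alg_add, hx, hy]
      | tmul c r =>
        simp only [cR, Algebra.TensorProduct.map_tmul, bosComul_inJ,
          comulJ_apply, LinearMap.lTensor_tmul]
        rfl
    rw [h1, h2, Coalgebra.coassoc_apply]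

lemma bosComul_rTensor : (Algebra.TensorProduct.map H.bosCounit (AlgHom.id k H.Bosonization)).comp
    H.bosComul = (Algebra.TensorProduct.lid k H.Bosonization).symm := by
  apply TwistedTensor.algHom_ext
  · intro r
    change Algebra.TensorProduct.map H.bosCounit (AlgHom.id k H.Bosonization)
      (H.bosComul (H.inR r)) = 1 ⊗ₜ (H.inR r)
    rw [bosComul_inR, comulR_eq_phi]
    have h0 : ∀ y, Algebra.TensorProduct.map H.bosCounit (AlgHom.id k H.Bosonization)
        (H.rho y) = 1 ⊗ₜ H.inR y := by
      intro y
      have h : ∀ X : J ⊗[k] R, Algebra.TensorProduct.map H.bosCounit (AlgHom.id k H.Bosonization)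
          (Algebra.TensorProduct.map H.inJ H.inR X) =
          1 ⊗ₜ H.inR (TensorProduct.lid k R (Coalgebra.counit.rTensor R X)) := by
        intro X
        induction X using TensorProduct.induction_on with
        | zero => simp
        | add x y hx hy => simp only [LinearMap.map_add, LinearEquiv.map_add, alg_add, hx, hy, TensorProduct.tmul_add]
        | tmul c r => simp [bosCounit_inJ, TensorProduct.smul_tmul']
      rw [rho_apply, h, H.counit_coact]
    have h : ∀ X : R ⊗[k] R, Algebra.TensorProduct.map H.bosCounit (AlgHom.id k H.Bosonization)
        (H.phi (TwistedTensor.ofTensor H.braidedSquare X)) =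
        1 ⊗ₜ H.inR (TensorProduct.lid k R (Coalgebra.counit.rTensor R X)) := by
      intro X
      induction X using TensorProduct.induction_on with
      | zero => simp
      | add x y hx hy => simp only [LinearMap.map_add, LinearEquiv.map_add, alg_add, hx, hy, TensorProduct.tmul_add]
      | tmul c r =>
        rw [phi_tmul, map_mul, h0]
        simp [bosCounit_inR, TensorProduct.smul_tmul']
    rw [h]; simp
  · intro a
    change Algebra.TensorProduct.map H.bosCounit (AlgHom.id k H.Bosonization)
      (H.bosComul (H.inJ a)) = 1 ⊗ₜ (H.inJ a)
    rw [bosComul_inJ, comulJ_apply]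
    have h : ∀ X : J ⊗[k] J, Algebra.TensorProduct.map H.bosCounit (AlgHom.id k H.Bosonization)
        (Algebra.TensorProduct.map H.inJ H.inJ X) =
        1 ⊗ₜ H.inJ (TensorProduct.lid k J (Coalgebra.counit.rTensor J X)) := by
      intro X
      induction X using TensorProduct.induction_on with
      | zero => simp
      | add x y hx hy => simp only [LinearMap.map_add, LinearEquiv.map_add, alg_add, hx, hy, TensorProduct.tmul_add]
      | tmul c r => simp [bosCounit_inJ, TensorProduct.smul_tmul']
    rw [h]; simp

lemma bosComul_lTensor : (Algebra.TensorProduct.map (AlgHom.id k H.Bosonization) H.bosCounit).comp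
    H.bosComul = (Algebra.TensorProduct.rid k k H.Bosonization).symm := by
  apply TwistedTensor.algHom_ext
  · intro r
    change Algebra.TensorProduct.map (AlgHom.id k H.Bosonization) H.bosCounit
      (H.bosComul (H.inR r)) = (H.inR r) ⊗ₜ 1
    rw [bosComul_inR, comulR_eq_phi]
    have h0 : ∀ y, Algebra.TensorProduct.map (AlgHom.id k H.Bosonization) H.bosCounit
        (H.rho y) = Coalgebra.counit (R := k) y • 1 := by
      intro y
      have h : ∀ X : J ⊗[k] R, Algebra.TensorProduct.map (AlgHom.id k H.Bosonization) H.bosCounit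
          (Algebra.TensorProduct.map H.inJ H.inR X) =
          H.inJ (TensorProduct.rid k J (Coalgebra.counit.lTensor J X)) ⊗ₜ 1 := by
        intro X
        induction X using TensorProduct.induction_on with
        | zero => simp
        | add x y hx hy => simp only [LinearMap.map_add, LinearEquiv.map_add, alg_add, hx, hy, TensorProduct.add_tmul]
        | tmul c r => simp [bosCounit_inR, TensorProduct.smul_tmul]
      rw [rho_apply, h, H.coact_counit]
      simp [Algebra.algebraMap_eq_smul_one, Algebra.TensorProduct.one_def,
        TensorProduct.smul_tmul']
    have h : ∀ X : R ⊗[k] R, Algebra.TensorProduct.map (AlgHom.id k H.Bosonization) H.bosCounit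
        (H.phi (TwistedTensor.ofTensor H.braidedSquare X)) =
        H.inR (TensorProduct.rid k R (Coalgebra.counit.lTensor R X)) ⊗ₜ 1 := by
      intro X
      induction X using TensorProduct.induction_on with
      | zero => simp
      | add x y hx hy => simp only [LinearMap.map_add, LinearEquiv.map_add, alg_add, hx, hy, TensorProduct.add_tmul]
      | tmul c r =>
        rw [phi_tmul, map_mul, h0]
        simp [TensorProduct.smul_tmul']
    rw [h]; simp
  · intro a
    change Algebra.TensorProduct.map (AlgHom.id k H.Bosonization) H.bosCounit
      (H.bosComul (H.inJ a)) = (H.inJ a) ⊗ₜ 1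
    rw [bosComul_inJ, comulJ_apply]
    have h : ∀ X : J ⊗[k] J, Algebra.TensorProduct.map (AlgHom.id k H.Bosonization) H.bosCounit
        (Algebra.TensorProduct.map H.inJ H.inJ X) =
        H.inJ (TensorProduct.rid k J (Coalgebra.counit.lTensor J X)) ⊗ₜ 1 := by
      intro X
      induction X using TensorProduct.induction_on with
      | zero => simp
      | add x y hx hy => simp only [LinearMap.map_add, LinearEquiv.map_add, alg_add, hx, hy, TensorProduct.add_tmul]
      | tmul c r => simp [bosCounit_inJ, TensorProduct.smul_tmul]
    rw [h]; simp

/-- The bosonization is a bialgebra. -/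
noncomputable instance : Bialgebra k H.Bosonization :=
  Bialgebra.ofAlgHom H.bosComul H.bosCounit H.bosComul_coassoc H.bosComul_rTensor H.bosComul_lTensor

lemma comul_inR (r : R) : Coalgebra.comul (R := k) (H.inR r) = H.comulR r := H.bosComul_inR r

lemma comul_inJ (a : J) : Coalgebra.comul (R := k) (H.inJ a) = H.comulJ a := H.bosComul_inJ a

lemma counit_inR (r : R) : Coalgebra.counit (R := k) (H.inR r) = Coalgebra.counit (R := k) r :=
  H.bosCounit_inR r

lemma counit_inJ (a : J) : Coalgebra.counit (R := k) (H.inJ a) = Coalgebra.counit (R := k) a :=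
  H.bosCounit_inJ a

/-- restriction of the antipode of the bosonization to `R`, `r ↦ S(r₋₁) S_R(r₀)` -/
noncomputable def antipodeR : R →ₗ[k] H.Bosonization :=
  LinearMap.mul' k H.Bosonization ∘ₗ TensorProduct.map (H.inJ.toLinearMap ∘ₗ
    HopfAlgebra.antipode k) (H.inR.toLinearMap ∘ₗ H.antipode) ∘ₗ H.coact

/-- The antipode of the bosonization, `r # a ↦ S(r₋₁ a) S_R(r₀)`. -/
noncomputable def bosAntipode : H.Bosonization →ₗ[k] H.Bosonization :=
  LinearMap.mul' k H.Bosonization ∘ₗ TensorProduct.map (H.inJ.toLinearMap ∘ₗ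
    HopfAlgebra.antipode k) H.antipodeR ∘ₗ (TensorProduct.comm k R J).toLinearMap ∘ₗ
    (TwistedTensor.ofTensor H.smash).symm.toLinearMap

lemma bosAntipode_ofTensor (r : R) (a : J) :
    H.bosAntipode (TwistedTensor.ofTensor H.smash (r ⊗ₜ a)) =
      H.inJ (HopfAlgebra.antipode k a) * H.antipodeR r := rfl

lemma bosAntipode_mul_inJ (b : H.Bosonization) (a : J) :
    H.bosAntipode (b * H.inJ a) = H.inJ (HopfAlgebra.antipode k a) * H.bosAntipode b := by
  obtain ⟨b, rfl⟩ := (TwistedTensor.ofTensor H.smash).surjective b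
  induction b using TensorProduct.induction_on with
  | zero => simp
  | add x y hx hy => simp only [LinearMap.map_add, LinearEquiv.map_add, add_mul, mul_add, hx, hy]
  | tmul r c =>
    rw [← TwistedTensor.inl_mul_inr, mul_assoc, ← map_mul, TwistedTensor.inl_mul_inr,
      TwistedTensor.inl_mul_inr, bosAntipode_ofTensor, bosAntipode_ofTensor,
      HopfAlgebra.antipode_mul_antidistrib, map_mul, mul_assoc]

lemma bosAntipode_inR (r : R) : H.bosAntipode (H.inR r) = H.antipodeR r := by
  rw [TwistedTensor.inl_apply, bosAntipode_ofTensor, HopfAlgebra.antipode_one, map_one, one_mul]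

lemma inJ_mul_antipodeR (y : R) : LinearMap.mul' k H.Bosonization
    (TensorProduct.map H.inJ.toLinearMap H.antipodeR (H.coact y)) = H.inR (H.antipode y) := by
  have h1 : ∀ X : J ⊗[k] R, LinearMap.mul' k H.Bosonization
      (TensorProduct.map H.inJ.toLinearMap H.antipodeR X) =
      LinearMap.mul' k H.Bosonization (TensorProduct.map H.inJ.toLinearMap
        (LinearMap.mul' k H.Bosonization ∘ₗ TensorProduct.map (H.inJ.toLinearMap ∘ₗ
          HopfAlgebra.antipode k) (H.inR.toLinearMap ∘ₗ H.antipode)) (H.coact.lTensor J X)) := by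
    intro X
    induction X using TensorProduct.induction_on with
    | zero => simp
    | add x y hx hy => simp only [LinearMap.map_add, hx, hy]
    | tmul c r => simp [antipodeR]
  have h2 : ∀ X : J ⊗[k] R, LinearMap.mul' k H.Bosonization (TensorProduct.map H.inJ.toLinearMap
        (LinearMap.mul' k H.Bosonization ∘ₗ TensorProduct.map (H.inJ.toLinearMap ∘ₗ
          HopfAlgebra.antipode k) (H.inR.toLinearMap ∘ₗ H.antipode))
        (TensorProduct.assoc k J J R (Coalgebra.comul.rTensor R X))) =
      H.inR (H.antipode (TensorProduct.lid k R (Coalgebra.counit.rTensor R X))) := by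
    intro X
    induction X using TensorProduct.induction_on with
    | zero => simp
    | add x y hx hy => simp only [LinearMap.map_add, LinearEquiv.map_add, alg_add, hx, hy]
    | tmul c r =>
      rw [LinearMap.rTensor_tmul]
      have h3 : ∀ D : J ⊗[k] J,
        LinearMap.mul' k H.Bosonization (TensorProduct.map H.inJ.toLinearMap
          (LinearMap.mul' k H.Bosonization ∘ₗ TensorProduct.map (H.inJ.toLinearMap ∘ₗ
          HopfAlgebra.antipode k) (H.inR.toLinearMap ∘ₗ H.antipode))
          (TensorProduct.assoc k J J R (D ⊗ₜ r))) =
        H.inJ (LinearMap.mul' k J ((HopfAlgebra.antipode k).lTensor J D)) *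
          H.inR (H.antipode r) := by
        intro D
        induction D using TensorProduct.induction_on with
        | zero => simp
        | add x y hx hy => simp only [LinearMap.map_add, LinearEquiv.map_add, alg_add, TensorProduct.add_tmul, add_mul, hx, hy]
        | tmul x y => simp [mul_assoc]
      rw [h3]
      simp [Algebra.algebraMap_eq_smul_one]
  rw [h1, ← H.coassoc, h2, H.counit_coact]

lemma bosAntipode_left_inR (r : R) : LinearMap.mul' k H.Bosonization
    (H.bosAntipode.rTensor _ (H.comulR r)) =
    algebraMap k H.Bosonization (Coalgebra.counit r) := by
  have h0 : ∀ (x : R) (X : J ⊗[k] R), LinearMap.mul' k H.Bosonization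
      (H.bosAntipode.rTensor _ ((H.inR x ⊗ₜ 1) * Algebra.TensorProduct.map H.inJ H.inR X)) =
      LinearMap.mul' k H.Bosonization (TensorProduct.map
        (LinearMap.mulRight k (H.antipodeR x) ∘ₗ H.inJ.toLinearMap ∘ₗ HopfAlgebra.antipode k)
        H.inR.toLinearMap X) := by
    intro x X
    induction X using TensorProduct.induction_on with
    | zero => simp
    | add x y hx hy => simp only [LinearMap.map_add, alg_add, mul_add, hx, hy]
    | tmul c r => simp [bosAntipode_mul_inJ, bosAntipode_inR]
  let W : J ⊗[k] (R ⊗[k] R) →ₗ[k] H.Bosonization :=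
    LinearMap.mul' k H.Bosonization ∘ₗ TensorProduct.map
      (H.inJ.toLinearMap ∘ₗ HopfAlgebra.antipode k)
      (H.inR.toLinearMap ∘ₗ LinearMap.mul' k R ∘ₗ H.antipode.rTensor R)
  have h1 : ∀ X : R ⊗[k] R, LinearMap.mul' k H.Bosonization (H.bosAntipode.rTensor _
      (H.phi (TwistedTensor.ofTensor H.braidedSquare X))) =
      W ((LinearMap.mul' k J).rTensor (R ⊗[k] R) (TensorProduct.tensorTensorTensorComm k J R J R
      (TensorProduct.map H.coact H.coact X))) := by
    intro X
    induction X using TensorProduct.induction_on with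
    | zero => simp
    | add x y hx hy => simp only [LinearMap.map_add, LinearEquiv.map_add, alg_add, hx, hy]
    | tmul x z =>
      rw [phi_tmul, rho_apply, h0, TensorProduct.map_tmul, antipodeR, LinearMap.comp_apply,
        LinearMap.comp_apply]
      generalize H.coact x = X
      generalize H.coact z = Z
      induction Z using TensorProduct.induction_on with
      | zero => simp
      | add x y hx hy => simp only [LinearMap.map_add, LinearEquiv.map_add, TensorProduct.tmul_add, hx, hy]
      | tmul d z =>
        induction X using TensorProduct.induction_on with
        | zero => simp
        | add x y hx hy =>
          simp only [TensorProduct.add_tmul, map_add] at hx hy ⊢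
          rw [← hx, ← hy]
          simp [mul_add, add_mul]
        | tmul c x =>
          simp [W, mul_assoc, HopfAlgebra.antipode_mul_antidistrib]
  have h2 : ∀ X : J ⊗[k] R, W (Coalgebra.comul.lTensor J X) =
      H.inJ (HopfAlgebra.antipode k (TensorProduct.rid k J (Coalgebra.counit.lTensor J X))) := by
    intro X
    induction X using TensorProduct.induction_on with
    | zero => simp
    | add x y hx hy => simp only [LinearMap.map_add, LinearEquiv.map_add, alg_add, hx, hy]
    | tmul c x =>
      simp [W, H.mul_antipode_rTensor_comul, Algebra.algebraMap_eq_smul_one]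
  rw [comulR_eq_phi, h1, ← H.coact_comul, h2, H.coact_counit]
  simp [Algebra.algebraMap_eq_smul_one]

lemma bosAntipode_right_inR (r : R) : LinearMap.mul' k H.Bosonization
    (H.bosAntipode.lTensor _ (H.comulR r)) =
    algebraMap k H.Bosonization (Coalgebra.counit r) := by
  have h0 : ∀ (x : R) (X : J ⊗[k] R), LinearMap.mul' k H.Bosonization
      (H.bosAntipode.lTensor _ ((H.inR x ⊗ₜ 1) * Algebra.TensorProduct.map H.inJ H.inR X)) =
      H.inR x * LinearMap.mul' k H.Bosonization (TensorProduct.map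
        H.inJ.toLinearMap H.antipodeR X) := by
    intro x X
    induction X using TensorProduct.induction_on with
    | zero => simp
    | add x y hx hy => simp only [LinearMap.map_add, alg_add, mul_add, hx, hy]
    | tmul c r => simp [bosAntipode_inR, mul_assoc]
  have h1 : ∀ X : R ⊗[k] R, LinearMap.mul' k H.Bosonization (H.bosAntipode.lTensor _
      (H.phi (TwistedTensor.ofTensor H.braidedSquare X))) =
      H.inR (LinearMap.mul' k R (H.antipode.lTensor R X)) := by
    intro X
    induction X using TensorProduct.induction_on with
    | zero => simp
    | add x y hx hy => simp only [LinearMap.map_add, LinearEquiv.map_add, alg_add, hx, hy]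
    | tmul x z =>
      rw [phi_tmul, rho_apply, h0, inJ_mul_antipodeR]
      simp
  rw [comulR_eq_phi, h1, H.mul_antipode_lTensor_comul]
  simp

lemma bosAntipode_left (b : H.Bosonization) : LinearMap.mul' k H.Bosonization
    (H.bosAntipode.rTensor _ (H.bosComul b)) =
    algebraMap k H.Bosonization (H.bosCounit b) := by
  obtain ⟨b, rfl⟩ := (TwistedTensor.ofTensor H.smash).surjective b
  induction b using TensorProduct.induction_on with
  | zero => simp [map_zero]
  | add x y hx hy => simp only [map_add, hx, hy]
  | tmul r a =>
    rw [← TwistedTensor.inl_mul_inr, map_mul H.bosComul, map_mul H.bosCounit, bosComul_inR,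
      bosComul_inJ, bosCounit_inR,
      bosCounit_inJ, comulJ_apply, map_mul (algebraMap k _), ← bosAntipode_left_inR]
    have h : ∀ (X : H.Bosonization ⊗[k] H.Bosonization) (D : J ⊗[k] J),
        LinearMap.mul' k H.Bosonization
          (H.bosAntipode.rTensor _ (X * Algebra.TensorProduct.map H.inJ H.inJ D)) =
        LinearMap.mul' k H.Bosonization (TensorProduct.map
          (LinearMap.mulRight k (LinearMap.mul' k H.Bosonization (H.bosAntipode.rTensor _ X)) ∘ₗ
            H.inJ.toLinearMap ∘ₗ HopfAlgebra.antipode k) H.inJ.toLinearMap D) := by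
      intro X D
      induction D using TensorProduct.induction_on with
      | zero => simp
      | add x y hx hy => simp only [LinearMap.map_add, alg_add, mul_add, hx, hy]
      | tmul c d =>
        induction X using TensorProduct.induction_on with
        | zero => simp
        | add x y hx hy =>
          rw [add_mul, map_add, map_add, hx, hy]
          simp [mul_add, add_mul]
        | tmul x z => simp [bosAntipode_mul_inJ, mul_assoc]
    rw [h, bosAntipode_left_inR]
    have h2 : ∀ (t : k) (D : J ⊗[k] J), LinearMap.mul' k H.Bosonization (TensorProduct.map
          (LinearMap.mulRight k (algebraMap k H.Bosonization t) ∘ₗ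
            H.inJ.toLinearMap ∘ₗ HopfAlgebra.antipode k) H.inJ.toLinearMap D) =
        algebraMap k H.Bosonization t *
          H.inJ (LinearMap.mul' k J ((HopfAlgebra.antipode k).rTensor J D)) := by
      intro t D
      induction D using TensorProduct.induction_on with
      | zero => simp
      | add x y hx hy => simp only [LinearMap.map_add, alg_add, mul_add, hx, hy]
      | tmul c d =>
        simp only [TensorProduct.map_tmul, LinearMap.comp_apply, LinearMap.mulRight_apply,
          LinearMap.mul'_apply, LinearMap.rTensor_tmul, AlgHom.toLinearMap_apply, map_mul,
          ← Algebra.commutes t, mul_assoc]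
    rw [h2]
    simp

lemma bosAntipode_right (b : H.Bosonization) : LinearMap.mul' k H.Bosonization
    (H.bosAntipode.lTensor _ (H.bosComul b)) =
    algebraMap k H.Bosonization (H.bosCounit b) := by
  obtain ⟨b, rfl⟩ := (TwistedTensor.ofTensor H.smash).surjective b
  induction b using TensorProduct.induction_on with
  | zero => simp [map_zero]
  | add x y hx hy => simp only [map_add, hx, hy]
  | tmul r a =>
    rw [← TwistedTensor.inl_mul_inr, map_mul H.bosComul, map_mul H.bosCounit, bosComul_inR,
      bosComul_inJ, bosCounit_inR,
      bosCounit_inJ, comulJ_apply, map_mul (algebraMap k _), ← bosAntipode_right_inR]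
    generalize H.comulR r = X
    induction X using TensorProduct.induction_on with
    | zero => simp
    | add x y hx hy => rw [add_mul, map_add, map_add, hx, hy, map_add, map_add, add_mul]
    | tmul x z =>
      have h : ∀ (D : J ⊗[k] J), LinearMap.mul' k H.Bosonization
          (H.bosAntipode.lTensor _ ((x ⊗ₜ z) * Algebra.TensorProduct.map H.inJ H.inJ D)) =
        x * H.inJ (LinearMap.mul' k J ((HopfAlgebra.antipode k).lTensor J D)) *
          H.bosAntipode z := by
        intro D
        induction D using TensorProduct.induction_on with
        | zero => simp
        | add x y hx hy => simp only [LinearMap.map_add, alg_add, mul_add, add_mul, hx, hy]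
        | tmul c d => simp [bosAntipode_mul_inJ, mul_assoc]
      rw [h]
      simp [Algebra.algebraMap_eq_smul_one]

/-- The bosonization is a Hopf algebra. -/
noncomputable instance : HopfAlgebra k H.Bosonization where
  antipode := H.bosAntipode
  mul_antipode_rTensor_comul := LinearMap.ext H.bosAntipode_left
  mul_antipode_lTensor_comul := LinearMap.ext H.bosAntipode_right

end BraidedHopfAlgebra


section Conv

variable {k B : Type*} [Field k] [AddCommGroup B] [Module k B] [Coalgebra k B]

/-- The convolution product `c ↦ ∑ f(c₁) g(c₂)` of two linear functionals. -/
noncomputable def conv (f g : B →ₗ[k] k) : B →ₗ[k] k :=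
  LinearMap.mul' k k ∘ₗ TensorProduct.map f g ∘ₗ Coalgebra.comul

/-- The operator `c ↦ ∑ f(c₁) c₂`. -/
noncomputable def transL : (B →ₗ[k] k) →ₗ[k] Module.End k B where
  toFun f := (TensorProduct.lid k B).toLinearMap ∘ₗ f.rTensor B ∘ₗ Coalgebra.comul
  map_add' f g := by ext; simp [LinearMap.rTensor_add]
  map_smul' r f := by ext; simp [LinearMap.rTensor_smul]

/-- The operator `c ↦ ∑ c₁ f(c₂)`. -/
noncomputable def transR : (B →ₗ[k] k) →ₗ[k] Module.End k B where
  toFun f := (TensorProduct.rid k B).toLinearMap ∘ₗ f.lTensor B ∘ₗ Coalgebra.comul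
  map_add' f g := by ext; simp [LinearMap.lTensor_add]
  map_smul' r f := by ext; simp [LinearMap.lTensor_smul]

lemma transL_apply (f : B →ₗ[k] k) (c : B) :
    transL f c = TensorProduct.lid k B (f.rTensor B (Coalgebra.comul c)) := rfl

lemma transR_apply (f : B →ₗ[k] k) (c : B) :
    transR f c = TensorProduct.rid k B (f.lTensor B (Coalgebra.comul c)) := rfl

lemma transL_counit : transL (Coalgebra.counit (R := k) (A := B)) = 1 := by
  ext c; simp [transL_apply]

lemma transR_counit : transR (Coalgebra.counit (R := k) (A := B)) = 1 := by
  ext c; simp [transR_apply]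

lemma transL_conv (f g : B →ₗ[k] k) : transL (conv g f) = transL f * transL g := by
  ext c
  have h1 : ∀ X : B ⊗[k] B, transL f (TensorProduct.lid k B (g.rTensor B X)) =
      TensorProduct.lid k B ((TensorProduct.lid k B).toLinearMap.lTensor k
        ((f.rTensor B).lTensor k (g.rTensor (B ⊗[k] B) (Coalgebra.comul.lTensor B X)))) := by
    intro X
    induction X using TensorProduct.induction_on with
    | zero => simp
    | tmul x y => simp [transL_apply]
    | add x y hx hy => simp only [LinearMap.map_add, LinearEquiv.map_add, hx, hy]
  have h2 : ∀ X : B ⊗[k] B, TensorProduct.lid k B ((TensorProduct.lid k B).toLinearMap.lTensor k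
        ((f.rTensor B).lTensor k (g.rTensor (B ⊗[k] B) (TensorProduct.assoc k B B B
          (Coalgebra.comul.rTensor B X))))) =
      TensorProduct.lid k B ((conv g f).rTensor B X) := by
    intro X
    induction X using TensorProduct.induction_on with
    | zero => simp
    | add x y hx hy => simp only [LinearMap.map_add, LinearEquiv.map_add, hx, hy]
    | tmul x y =>
      simp only [LinearMap.rTensor_tmul, TensorProduct.lid_tmul, conv, LinearMap.comp_apply]
      induction (Coalgebra.comul x : B ⊗[k] B) using TensorProduct.induction_on with
      | zero => simp
      | add x y hx hy => simp only [LinearMap.map_add, LinearEquiv.map_add, TensorProduct.add_tmul, add_smul, hx, hy]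
      | tmul u v => simp [mul_smul, smul_comm (g u)]
  change _ = transL f (transL g c)
  rw [transL_apply g c, h1, ← Coalgebra.coassoc_apply, h2, transL_apply]

lemma transR_conv (f g : B →ₗ[k] k) : transR (conv f g) = transR f * transR g := by
  ext c
  have h1 : ∀ X : B ⊗[k] B, transR f (TensorProduct.rid k B (g.lTensor B X)) =
      TensorProduct.rid k B ((TensorProduct.rid k B).toLinearMap.rTensor k
        ((f.lTensor B).rTensor k (g.lTensor (B ⊗[k] B) (Coalgebra.comul.rTensor B X)))) := by
    intro X
    induction X using TensorProduct.induction_on with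
    | zero => simp
    | tmul x y => simp [transR_apply]
    | add x y hx hy => simp only [LinearMap.map_add, LinearEquiv.map_add, hx, hy]
  have h2 : ∀ X : B ⊗[k] B, TensorProduct.rid k B ((TensorProduct.rid k B).toLinearMap.rTensor k
        ((f.lTensor B).rTensor k (g.lTensor (B ⊗[k] B) ((TensorProduct.assoc k B B B).symm
          (Coalgebra.comul.lTensor B X))))) =
      TensorProduct.rid k B ((conv f g).lTensor B X) := by
    intro X
    induction X using TensorProduct.induction_on with
    | zero => simp
    | add x y hx hy => simp only [LinearMap.map_add, LinearEquiv.map_add, hx, hy]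
    | tmul x y =>
      simp only [LinearMap.lTensor_tmul, TensorProduct.rid_tmul, conv, LinearMap.comp_apply]
      induction (Coalgebra.comul y : B ⊗[k] B) using TensorProduct.induction_on with
      | zero => simp
      | add x y hx hy => simp only [LinearMap.map_add, LinearEquiv.map_add, TensorProduct.tmul_add, add_smul, hx, hy]
      | tmul u v => simp [mul_smul, smul_comm (g v)]
  change _ = transR f (transR g c)
  rw [transR_apply g c, h1, ← Coalgebra.coassoc_symm_apply, h2, transR_apply]

lemma transL_transR (f g : B →ₗ[k] k) : Commute (transL f) (transR g) := by
  ext c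
  have h1 : ∀ X : B ⊗[k] B, transL f (TensorProduct.rid k B (g.lTensor B X)) =
      TensorProduct.lid k B (f.rTensor B ((TensorProduct.rid k B).toLinearMap.lTensor B
        ((g.lTensor B).lTensor B (TensorProduct.assoc k B B B (Coalgebra.comul.rTensor B X))))) := by
    intro X
    induction X using TensorProduct.induction_on with
    | zero => simp
    | add x y hx hy => simp only [LinearMap.map_add, LinearEquiv.map_add, hx, hy]
    | tmul x y =>
      simp only [LinearMap.lTensor_tmul, TensorProduct.rid_tmul, map_smul, transL_apply,
        LinearMap.rTensor_tmul]
      induction (Coalgebra.comul x : B ⊗[k] B) using TensorProduct.induction_on with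
      | zero => simp
      | add x y hx hy => simp only [LinearMap.map_add, LinearEquiv.map_add, TensorProduct.add_tmul, smul_add, hx, hy]
      | tmul u v => simp
  have h2 : ∀ X : B ⊗[k] B, transR g (TensorProduct.lid k B (f.rTensor B X)) =
      TensorProduct.lid k B (f.rTensor B ((TensorProduct.rid k B).toLinearMap.lTensor B
        ((g.lTensor B).lTensor B (Coalgebra.comul.lTensor B X)))) := by
    intro X
    induction X using TensorProduct.induction_on with
    | zero => simp
    | add x y hx hy => simp only [LinearMap.map_add, LinearEquiv.map_add, hx, hy]
    | tmul x y => simp [transR_apply]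
  change transL f (transR g c) = transR g (transL f c)
  rw [transL_apply f c, transR_apply g c, h1, h2, Coalgebra.coassoc_apply]

end Conv

section Antipode

variable {k B : Type*} [Field k] [Ring B] [HopfAlgebra k B]

open WithConv in
/-- The antipode reverses the coproduct. -/
lemma comul_antipode (b : B) : Coalgebra.comul (R := k) (HopfAlgebra.antipode k b) =
    TensorProduct.map (HopfAlgebra.antipode k) (HopfAlgebra.antipode k)
      (TensorProduct.comm k B B (Coalgebra.comul (R := k) b)) := by
  have h1 := LinearMap.comul_right_inv (R := k) (C := B)
  let F : B →ₗ[k] B ⊗[k] B := TensorProduct.map (HopfAlgebra.antipode k) (HopfAlgebra.antipode k) ∘ₗ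
    (TensorProduct.comm k B B).toLinearMap ∘ₗ Coalgebra.comul
  have h2 : toConv F * toConv (Coalgebra.comul (R := k) (A := B)) = 1 := by
    let Φ : (B ⊗[k] B) ⊗[k] (B ⊗[k] B) →ₗ[k] B ⊗[k] B :=
      LinearMap.mul' k (B ⊗[k] B) ∘ₗ (TensorProduct.map (HopfAlgebra.antipode k)
        (HopfAlgebra.antipode k) ∘ₗ (TensorProduct.comm k B B).toLinearMap).rTensor (B ⊗[k] B)
    let ρ : B ⊗[k] ((B ⊗[k] B) ⊗[k] B) →ₗ[k] (B ⊗[k] B) ⊗[k] (B ⊗[k] B) :=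
      (TensorProduct.assoc k B B (B ⊗[k] B)).symm.toLinearMap ∘ₗ
        (TensorProduct.assoc k B B B).toLinearMap.lTensor B
    have hρ : TensorProduct.map Coalgebra.comul Coalgebra.comul ∘ₗ
        Coalgebra.comul (R := k) (A := B) = ρ ∘ₗ (Coalgebra.comul.rTensor B).lTensor B ∘ₗ
          Coalgebra.comul.lTensor B ∘ₗ Coalgebra.comul := by
      simp only [ρ, coassoc_simps]
    have hΦ : ∀ (p s : B) (D : B ⊗[k] B), Φ (ρ (p ⊗ₜ (D ⊗ₜ s))) =
        LinearMap.mul' k B ((HopfAlgebra.antipode k).rTensor B D) ⊗ₜ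
          (HopfAlgebra.antipode k p * s) := by
      intro p s D
      induction D using TensorProduct.induction_on with
      | zero => simp
      | add x y hx hy => simp only [LinearMap.map_add, TensorProduct.add_tmul, TensorProduct.tmul_add, hx, hy]
      | tmul u v => simp [Φ, ρ]
    have h : ∀ X : B ⊗[k] B,
        Φ (ρ ((Coalgebra.comul.rTensor B).lTensor B (Coalgebra.comul.lTensor B X))) =
        1 ⊗ₜ LinearMap.mul' k B ((HopfAlgebra.antipode k).rTensor B X) := by
      have h' : ∀ (p : B) (Y : B ⊗[k] B), Φ (ρ (p ⊗ₜ (Coalgebra.comul.rTensor B Y))) =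
          1 ⊗ₜ (HopfAlgebra.antipode k p *
            TensorProduct.lid k B (Coalgebra.counit.rTensor B Y)) := by
        intro p Y
        induction Y using TensorProduct.induction_on with
        | zero => simp
        | add x y hx hy => simp only [LinearMap.map_add, LinearEquiv.map_add, TensorProduct.tmul_add, mul_add, hx, hy]
        | tmul u v => simp [hΦ, Algebra.algebraMap_eq_smul_one, TensorProduct.smul_tmul']
      intro X
      induction X using TensorProduct.induction_on with
      | zero => simp
      | add x y hx hy => simp only [LinearMap.map_add, TensorProduct.tmul_add, hx, hy]
      | tmul u v => simp [h']
    ext b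
    have h4 := LinearMap.congr_fun hρ b
    have h5 : (toConv F * toConv (Coalgebra.comul (R := k) (A := B))).ofConv b =
        Φ (TensorProduct.map Coalgebra.comul Coalgebra.comul (Coalgebra.comul b)) := by
      simp only [LinearMap.convMul_def, LinearMap.comp_apply, ofConv_toConv]
      induction (Coalgebra.comul b : B ⊗[k] B) using TensorProduct.induction_on with
      | zero => simp
      | add x y hx hy => simp only [LinearMap.map_add, hx, hy]
      | tmul u v => rfl
    refine h5.trans ?_
    rw [LinearMap.comp_apply] at h4
    rw [h4]
    simp only [LinearMap.comp_apply, h]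
    simp [Algebra.algebraMap_eq_smul_one, Algebra.TensorProduct.one_def]
  have h3 := left_inv_eq_right_inv h2 h1
  exact (LinearMap.congr_fun (congrArg WithConv.ofConv h3) b).symm

end Antipode

section SkewPairing

variable {k B H : Type*} [Field k] [Ring B] [HopfAlgebra k B] [Ring H] [HopfAlgebra k H]

/-- Skew pairings `τ : B ⊗ H → k` of Hopf algebras, as bilinear maps:
`τ(bc, h) = ∑ τ(b, h₁) τ(c, h₂)`, `τ(b, hl) = ∑ τ(b₁, l) τ(b₂, h)`,
`τ(b, 1) = ε(b)`, `τ(1, h) = ε(h)`. -/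
structure IsSkewPairing (τ : B →ₗ[k] H →ₗ[k] k) : Prop where
  mul_left : ∀ b c h, τ (b * c) h =
    LinearMap.mul' k k (TensorProduct.map (τ b) (τ c) (Coalgebra.comul h))
  mul_right : ∀ b h l, τ b (h * l) =
    LinearMap.mul' k k (TensorProduct.map (τ.flip l) (τ.flip h) (Coalgebra.comul b))
  one_right : ∀ b, τ b 1 = Coalgebra.counit b
  one_left : ∀ h, τ 1 h = Coalgebra.counit h

/-- The operators `U_h : c ↦ ∑ τ(c₁, h) c₂`. -/
noncomputable def opU (τ : B →ₗ[k] H →ₗ[k] k) : H →ₗ[k] Module.End k B := transL ∘ₗ τ.flip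

/-- The operators `V_h : c ↦ ∑ c₁ τ(S(c₂), h)`. -/
noncomputable def opV (τ : B →ₗ[k] H →ₗ[k] k) : H →ₗ[k] Module.End k B :=
  transR ∘ₗ (τ ∘ₗ HopfAlgebra.antipode k).flip

namespace IsSkewPairing

variable {τ : B →ₗ[k] H →ₗ[k] k}

lemma flip_one (hτ : IsSkewPairing τ) : τ.flip 1 = Coalgebra.counit := LinearMap.ext hτ.one_right

lemma flip_antipode_one (hτ : IsSkewPairing τ) : (τ ∘ₗ HopfAlgebra.antipode k).flip 1 =
    Coalgebra.counit := by
  ext b; simp [hτ.one_right]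

lemma flip_mul (hτ : IsSkewPairing τ) (h l : H) :
    τ.flip (h * l) = conv (τ.flip l) (τ.flip h) :=
  LinearMap.ext fun b => hτ.mul_right b h l

lemma flip_antipode_mul (hτ : IsSkewPairing τ) (h l : H) :
    (τ ∘ₗ HopfAlgebra.antipode k).flip (h * l) =
    conv ((τ ∘ₗ HopfAlgebra.antipode k).flip h) ((τ ∘ₗ HopfAlgebra.antipode k).flip l) := by
  ext b
  rw [LinearMap.flip_apply, LinearMap.comp_apply, hτ.mul_right, comul_antipode, conv,
    LinearMap.comp_apply, LinearMap.comp_apply]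
  induction (Coalgebra.comul b : B ⊗[k] B) using TensorProduct.induction_on with
  | zero => simp
  | add x y hx hy => simp only [LinearMap.map_add, LinearEquiv.map_add, hx, hy]
  | tmul x y => simp [mul_comm]

/-- `U` as an algebra map. -/
noncomputable def algU (hτ : IsSkewPairing τ) : H →ₐ[k] Module.End k B :=
  AlgHom.ofLinearMap (opU τ)
    (by rw [opU, LinearMap.comp_apply, hτ.flip_one, transL_counit])
    (fun h l => by simp only [opU, LinearMap.comp_apply, hτ.flip_mul, transL_conv])

/-- `V` as an algebra map. -/
noncomputable def algV (hτ : IsSkewPairing τ) : H →ₐ[k] Module.End k B :=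
  AlgHom.ofLinearMap (opV τ)
    (by rw [opV, LinearMap.comp_apply, hτ.flip_antipode_one, transR_counit])
    (fun h l => by simp only [opV, LinearMap.comp_apply, hτ.flip_antipode_mul, transR_conv])

/-- `∑ b ⊗ b' ↦ (h ↦ ∑ τ(b, h) b')`. -/
noncomputable def evalL (τ : B →ₗ[k] H →ₗ[k] k) : B ⊗[k] B →ₗ[k] H →ₗ[k] B :=
  TensorProduct.lift (LinearMap.smulRightₗ ∘ₗ τ)

lemma evalL_tmul (τ : B →ₗ[k] H →ₗ[k] k) (b b' : B) (h : H) :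
    evalL τ (b ⊗ₜ b') h = τ b h • b' := rfl

lemma algU_apply (hτ : IsSkewPairing τ) (h : H) (c : B) : hτ.algU h c =
    evalL τ (Coalgebra.comul c) h := by
  change TensorProduct.lid k B ((τ.flip h).rTensor B (Coalgebra.comul c)) = _
  induction (Coalgebra.comul c : B ⊗[k] B) using TensorProduct.induction_on with
  | zero => simp
  | add x y hx hy => simp only [LinearMap.map_add, LinearEquiv.map_add, LinearMap.add_apply, hx, hy]
  | tmul x y => simp [evalL_tmul]

lemma algV_apply (hτ : IsSkewPairing τ) (h : H) (c : B) : hτ.algV h c =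
    evalL (τ ∘ₗ HopfAlgebra.antipode k) (TensorProduct.comm k B B (Coalgebra.comul c)) h := by
  change TensorProduct.rid k B (((τ ∘ₗ HopfAlgebra.antipode k).flip h).lTensor B
      (Coalgebra.comul c)) = _
  induction (Coalgebra.comul c : B ⊗[k] B) using TensorProduct.induction_on with
  | zero => simp
  | add x y hx hy => simp only [LinearMap.map_add, LinearEquiv.map_add, LinearMap.add_apply, hx, hy]
  | tmul x y => simp [evalL_tmul]

lemma commute_algU_algV (hτ : IsSkewPairing τ) (p q : H) : Commute (hτ.algU p) (hτ.algV q) :=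
  transL_transR _ _

/-- The action `(p ⊗ q) ▷ c = ∑ τ(c₁, p) c₂ τ(S(c₃), q)` of `H ⊗ H` on `B`. -/
noncomputable def doubleAct (hτ : IsSkewPairing τ) : H ⊗[k] H →ₐ[k] Module.End k B :=
  Algebra.TensorProduct.lift hτ.algU hτ.algV hτ.commute_algU_algV

lemma doubleAct_tmul (hτ : IsSkewPairing τ) (p q : H) (c : B) :
    hτ.doubleAct (p ⊗ₜ q) c = hτ.algU p (hτ.algV q c) := by
  rw [doubleAct, Algebra.TensorProduct.lift_tmul]; rfl

lemma evalL_mul (hτ : IsSkewPairing τ) (X Y : B ⊗[k] B) (h : H) : evalL τ (X * Y) h =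
    LinearMap.mul' k B (TensorProduct.map (evalL τ X) (evalL τ Y) (Coalgebra.comul h)) := by
  induction X using TensorProduct.induction_on with
  | zero => simp
  | add x y hx hy => simp only [LinearMap.map_add, LinearMap.add_apply, add_mul, hx, hy,
      TensorProduct.map_add_left]
  | tmul x x' =>
  induction Y using TensorProduct.induction_on with
  | zero => simp
  | add x y hx hy => simp only [LinearMap.map_add, LinearMap.add_apply, mul_add, hx, hy,
      TensorProduct.map_add_right]
  | tmul y y' =>
    rw [Algebra.TensorProduct.tmul_mul_tmul, evalL_tmul, hτ.mul_left]
    induction (Coalgebra.comul h : H ⊗[k] H) using TensorProduct.induction_on with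
    | zero => simp
    | add x y hx hy => simp only [LinearMap.map_add, add_smul, hx, hy]
    | tmul p q => simp [evalL_tmul, mul_smul, smul_comm (τ x p)]

lemma evalL_antipode_mul (hτ : IsSkewPairing τ) (X Y : B ⊗[k] B) (h : H) :
    evalL (τ ∘ₗ HopfAlgebra.antipode k) (X * Y) h =
    LinearMap.mul' k B (TensorProduct.map (evalL (τ ∘ₗ HopfAlgebra.antipode k) X)
      (evalL (τ ∘ₗ HopfAlgebra.antipode k) Y)
      (TensorProduct.comm k H H (Coalgebra.comul h))) := by
  induction X using TensorProduct.induction_on with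
  | zero => simp
  | add x y hx hy => simp only [LinearMap.map_add, LinearMap.add_apply, add_mul, hx, hy,
      TensorProduct.map_add_left]
  | tmul x x' =>
  induction Y using TensorProduct.induction_on with
  | zero => simp
  | add x y hx hy => simp only [LinearMap.map_add, LinearMap.add_apply, mul_add, hx, hy,
      TensorProduct.map_add_right]
  | tmul y y' =>
    rw [Algebra.TensorProduct.tmul_mul_tmul, evalL_tmul, LinearMap.comp_apply,
      HopfAlgebra.antipode_mul_antidistrib, hτ.mul_left]
    induction (Coalgebra.comul h : H ⊗[k] H) using TensorProduct.induction_on with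
    | zero => simp
    | add x y hx hy => simp only [LinearMap.map_add, LinearEquiv.map_add, add_smul, hx, hy]
    | tmul p q => simp [evalL_tmul, mul_smul]

lemma algU_mul (hτ : IsSkewPairing τ) (h : H) (c d : B) : hτ.algU h (c * d) =
    LinearMap.mul' k B (TensorProduct.map (hτ.algU.toLinearMap.flip c)
      (hτ.algU.toLinearMap.flip d) (Coalgebra.comul h)) := by
  have h1 : ∀ c, hτ.algU.toLinearMap.flip c = evalL τ (Coalgebra.comul c) := fun c =>
    LinearMap.ext fun h => hτ.algU_apply h c
  rw [algU_apply, Bialgebra.comul_mul, hτ.evalL_mul, h1, h1]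

lemma algV_mul (hτ : IsSkewPairing τ) (h : H) (c d : B) : hτ.algV h (c * d) =
    LinearMap.mul' k B (TensorProduct.map (hτ.algV.toLinearMap.flip c)
      (hτ.algV.toLinearMap.flip d) (TensorProduct.comm k H H (Coalgebra.comul h))) := by
  have h1 : ∀ c, hτ.algV.toLinearMap.flip c =
    evalL (τ ∘ₗ HopfAlgebra.antipode k) (TensorProduct.comm k B B (Coalgebra.comul c)) := fun c =>
    LinearMap.ext fun h => hτ.algV_apply h c
  have h2 : ∀ X Y : B ⊗[k] B, TensorProduct.comm k B B (X * Y) =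
      TensorProduct.comm k B B X * TensorProduct.comm k B B Y :=
    map_mul (Algebra.TensorProduct.comm k B B)
  rw [algV_apply, Bialgebra.comul_mul, h2, hτ.evalL_antipode_mul, h1, h1]

lemma algU_one (hτ : IsSkewPairing τ) (h : H) :
    hτ.algU h 1 = algebraMap k B (Coalgebra.counit h) := by
  rw [algU_apply, Bialgebra.comul_one, Algebra.TensorProduct.one_def, evalL_tmul, hτ.one_left,
    Algebra.algebraMap_eq_smul_one]

lemma algV_one (hτ : IsSkewPairing τ) (h : H) :
    hτ.algV h 1 = algebraMap k B (Coalgebra.counit h) := by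
  rw [algV_apply, Bialgebra.comul_one, Algebra.TensorProduct.one_def, TensorProduct.comm_tmul,
    evalL_tmul, LinearMap.comp_apply, HopfAlgebra.antipode_one, hτ.one_left,
    Algebra.algebraMap_eq_smul_one]

/-- The algebra map `(x ⊗ y) ⊗ z ↦ (x ⊗ z) ⊗ y`. -/
noncomputable def rightCommAlg (k H : Type*) [Field k] [Ring H] [Algebra k H] :
    (H ⊗[k] H) ⊗[k] H →ₐ[k] (H ⊗[k] H) ⊗[k] H :=
  AlgHom.ofLinearMap (TensorProduct.rightComm k H H H).toLinearMap rfl fun X Y => by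
    induction X using TensorProduct.induction_on with
    | zero => simp
    | add x y hx hy => simp only [LinearMap.map_add, add_mul, hx, hy]
    | tmul X x =>
    induction X using TensorProduct.induction_on with
    | zero => simp
    | add x y hx hy => simp only [LinearMap.map_add, add_mul, TensorProduct.add_tmul, hx, hy]
    | tmul x x' =>
    induction Y using TensorProduct.induction_on with
    | zero => simp
    | add x y hx hy => simp only [LinearMap.map_add, mul_add, hx, hy]
    | tmul Y y =>
    induction Y using TensorProduct.induction_on with
    | zero => simp
    | add x y hx hy => simp only [LinearMap.map_add, mul_add, TensorProduct.add_tmul, hx, hy]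
    | tmul y y' => simp

/-- `h ↦ ∑ (h₁ ⊗ h₃) ⊗ h₂`. -/
noncomputable def doubleCoact (k H : Type*) [Field k] [Ring H] [HopfAlgebra k H] :
    H →ₐ[k] (H ⊗[k] H) ⊗[k] H :=
  (rightCommAlg k H).comp
    ((Algebra.TensorProduct.map (Bialgebra.comulAlgHom k H) (AlgHom.id k H)).comp
      (Bialgebra.comulAlgHom k H))

/-- The coproduct `p ⊗ q ↦ ∑ (p₁ ⊗ q₂) ⊗ (p₂ ⊗ q₁)` of the coalgebra `H ⊗ H^cop`. -/
noncomputable def doubleComul (k H : Type*) [Field k] [AddCommGroup H] [Module k H]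
    [Coalgebra k H] : H ⊗[k] H →ₗ[k] (H ⊗[k] H) ⊗[k] (H ⊗[k] H) :=
  (TensorProduct.tensorTensorTensorComm k H H H H).toLinearMap ∘ₗ
    TensorProduct.map Coalgebra.comul
      ((TensorProduct.comm k H H).toLinearMap ∘ₗ Coalgebra.comul)

/-- The data defining the generalized quantum double of `τ`. -/
noncomputable def doubleData (hτ : IsSkewPairing τ) : SmashData k B H (H ⊗[k] H) where
  act := hτ.doubleAct
  coact := doubleCoact k H
  comul := doubleComul k H
  counit := LinearMap.mul' k k ∘ₗ TensorProduct.map Coalgebra.counit Coalgebra.counit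
  act_one c := by
    induction c using TensorProduct.induction_on with
    | zero => simp [map_zero]
    | add x y hx hy => simp only [map_add, LinearMap.add_apply, hx, hy]
    | tmul p q =>
      rw [doubleAct_tmul, algV_one, Algebra.algebraMap_eq_smul_one, map_smul, algU_one]
      simp [Algebra.algebraMap_eq_smul_one, mul_smul, smul_comm (Coalgebra.counit (R := k) p)]
  act_mul c x y := by
    induction c using TensorProduct.induction_on with
    | zero => simp
    | add x y hx hy => simp only [LinearMap.map_add, alg_add, LinearMap.add_apply, hx, hy]
    | tmul p q =>
      rw [doubleAct_tmul, algV_mul, doubleComul, LinearMap.comp_apply, TensorProduct.map_tmul,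
        LinearMap.comp_apply]
      induction (Coalgebra.comul q : H ⊗[k] H) using TensorProduct.induction_on with
      | zero => simp
      | add x y hx hy =>
        simp only [LinearMap.map_add, LinearEquiv.map_add, LinearMap.add_apply, TensorProduct.tmul_add, hx, hy]
      | tmul q₁ q₂ =>
        simp only [LinearEquiv.coe_coe, TensorProduct.comm_tmul, TensorProduct.map_tmul,
          LinearMap.mul'_apply, algU_mul]
        induction (Coalgebra.comul p : H ⊗[k] H) using TensorProduct.induction_on with
        | zero => simp
        | add x y hx hy =>
          simp only [LinearMap.map_add, LinearEquiv.map_add, LinearMap.add_apply, TensorProduct.add_tmul, hx, hy]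
        | tmul p₁ p₂ => simp [TensorProduct.map₂_apply_tmul, doubleAct_tmul]
  counit_coact h := by
    have h1 : ∀ X : H ⊗[k] H, TensorProduct.lid k H
        ((LinearMap.mul' k k ∘ₗ TensorProduct.map Coalgebra.counit Coalgebra.counit).rTensor H
          (TensorProduct.rightComm k H H H
            ((Algebra.TensorProduct.map (Bialgebra.comulAlgHom k H) (AlgHom.id k H)) X))) =
        TensorProduct.rid k H (Coalgebra.counit.lTensor H X) := by
      intro X
      induction X using TensorProduct.induction_on with
      | zero => simp
      | add x y hx hy => simp only [LinearMap.map_add, LinearEquiv.map_add, alg_add, hx, hy]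
      | tmul x y =>
        have h2 : ∀ D : H ⊗[k] H, TensorProduct.lid k H
          ((LinearMap.mul' k k ∘ₗ TensorProduct.map Coalgebra.counit Coalgebra.counit).rTensor H
          (TensorProduct.rightComm k H H H (D ⊗ₜ y))) =
          Coalgebra.counit (R := k) y • TensorProduct.lid k H (Coalgebra.counit.rTensor H D) := by
          intro D
          induction D using TensorProduct.induction_on with
          | zero => simp
          | add x y hx hy => simp only [LinearMap.map_add, LinearEquiv.map_add, smul_add, TensorProduct.add_tmul, hx, hy]
          | tmul u v => simp [mul_smul, smul_comm (Coalgebra.counit (R := k) u)]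
        simp [h2]
    exact (h1 (Coalgebra.comul h)).trans (by simp)
  coassoc h := by
    have h1 : (doubleCoact k H).toLinearMap =
        (TensorProduct.rightComm k H H H).toLinearMap ∘ₗ
          (Coalgebra.comul.rTensor H) ∘ₗ Coalgebra.comul := by
      rfl
    have : (TensorProduct.assoc k (H ⊗[k] H) (H ⊗[k] H) H).toLinearMap ∘ₗ
        (doubleComul k H).rTensor H ∘ₗ (doubleCoact k H).toLinearMap =
        (doubleCoact k H).toLinearMap.lTensor (H ⊗[k] H) ∘ₗ (doubleCoact k H).toLinearMap := by
      let pL : ((H ⊗[k] H) ⊗[k] H) ⊗[k] (H ⊗[k] H) →ₗ[k]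
          (H ⊗[k] H) ⊗[k] ((H ⊗[k] H) ⊗[k] H) :=
        (TensorProduct.assoc k (H ⊗[k] H) (H ⊗[k] H) H).toLinearMap ∘ₗ
          ((TensorProduct.tensorTensorTensorComm k H H H H).toLinearMap ∘ₗ
            (TensorProduct.comm k H H).toLinearMap.lTensor (H ⊗[k] H)).rTensor H ∘ₗ
          (TensorProduct.rightComm k (H ⊗[k] H) H (H ⊗[k] H)).toLinearMap
      let pR : (H ⊗[k] ((H ⊗[k] H) ⊗[k] H)) ⊗[k] H →ₗ[k]
          (H ⊗[k] H) ⊗[k] ((H ⊗[k] H) ⊗[k] H) :=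
        (TensorProduct.rightComm k H H H).toLinearMap.lTensor (H ⊗[k] H) ∘ₗ
          (TensorProduct.rightComm k H ((H ⊗[k] H) ⊗[k] H) H).toLinearMap
      let ρ : ((H ⊗[k] H) ⊗[k] H) ⊗[k] (H ⊗[k] H) →ₗ[k]
          (H ⊗[k] ((H ⊗[k] H) ⊗[k] H)) ⊗[k] H :=
        ((TensorProduct.assoc k H (H ⊗[k] H) H).toLinearMap ∘ₗ
          (TensorProduct.assoc k H H H).toLinearMap.rTensor H).rTensor H ∘ₗ
          (TensorProduct.assoc k ((H ⊗[k] H) ⊗[k] H) H H).symm.toLinearMap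
      have hp : pL = pR ∘ₗ ρ := by
        apply TensorProduct.ext_fourfold'
        intro X m c d
        induction X using TensorProduct.induction_on with
        | zero => simp
        | add x y hx hy => simp only [LinearMap.map_add, TensorProduct.add_tmul, hx, hy]
        | tmul a b => simp [pL, pR, ρ]
      have hc : ρ ∘ₗ TensorProduct.map (Coalgebra.comul.rTensor H ∘ₗ Coalgebra.comul)
            Coalgebra.comul ∘ₗ Coalgebra.comul (R := k) =
          ((Coalgebra.comul.rTensor H ∘ₗ Coalgebra.comul).lTensor H ∘ₗ
            Coalgebra.comul).rTensor H ∘ₗ Coalgebra.comul := by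
        simp only [ρ, coassoc_simps]
      have hL : (TensorProduct.assoc k (H ⊗[k] H) (H ⊗[k] H) H).toLinearMap ∘ₗ
          (doubleComul k H).rTensor H ∘ₗ (TensorProduct.rightComm k H H H).toLinearMap ∘ₗ
          Coalgebra.comul.rTensor H = pL ∘ₗ TensorProduct.map
            (Coalgebra.comul.rTensor H ∘ₗ Coalgebra.comul) Coalgebra.comul := by
        apply TensorProduct.ext'
        intro x z
        simp only [LinearMap.comp_apply, LinearMap.rTensor_tmul, TensorProduct.map_tmul]
        induction (Coalgebra.comul x : H ⊗[k] H) using TensorProduct.induction_on with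
        | zero => simp
        | add x y hx hy => simp only [LinearMap.map_add, TensorProduct.add_tmul, hx, hy]
        | tmul a b =>
          simp [pL, doubleComul]
      have hR : (doubleCoact k H).toLinearMap.lTensor (H ⊗[k] H) ∘ₗ
          (TensorProduct.rightComm k H H H).toLinearMap ∘ₗ Coalgebra.comul.rTensor H =
          pR ∘ₗ ((Coalgebra.comul.rTensor H ∘ₗ Coalgebra.comul).lTensor H ∘ₗ
            Coalgebra.comul).rTensor H := by
        apply TensorProduct.ext'
        intro x z
        simp only [LinearMap.comp_apply, LinearMap.rTensor_tmul]
        induction (Coalgebra.comul x : H ⊗[k] H) using TensorProduct.induction_on with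
        | zero => simp
        | add x y hx hy => simp only [LinearMap.map_add, TensorProduct.add_tmul, hx, hy]
        | tmul a b => simp [pR, h1]
      have hL' := congrArg (fun f => f ∘ₗ Coalgebra.comul (R := k) (A := H)) hL
      have hR' := congrArg (fun f => f ∘ₗ Coalgebra.comul (R := k) (A := H)) hR
      simp only [LinearMap.comp_assoc] at hL' hR'
      rw [h1]
      rw [hL', hp, LinearMap.comp_assoc, hc, ← hR', h1]
    exact LinearMap.congr_fun this h

end IsSkewPairing
end SkewPairing


section Double

variable {k B H : Type*} [Field k] [Ring B] [HopfAlgebra k B] [Ring H] [HopfAlgebra k H]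
  {τ : B →ₗ[k] H →ₗ[k] k}

/-- The linear form `σ((b ⊗ h) ⊗ (c ⊗ l)) = ε(b) τ(c, h) ε(l)`. -/
noncomputable def cocycle (τ : B →ₗ[k] H →ₗ[k] k) : (B ⊗[k] H) ⊗[k] (B ⊗[k] H) →ₗ[k] k :=
  TensorProduct.lift τ ∘ₗ (TensorProduct.comm k H B).toLinearMap ∘ₗ TensorProduct.map
    ((TensorProduct.lid k H).toLinearMap ∘ₗ Coalgebra.counit.rTensor H)
    ((TensorProduct.rid k B).toLinearMap ∘ₗ Coalgebra.counit.lTensor B)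

lemma cocycle_tmul (τ : B →ₗ[k] H →ₗ[k] k) (b c : B) (h l : H) :
    cocycle τ ((b ⊗ₜ h) ⊗ₜ (c ⊗ₜ l)) =
      Coalgebra.counit (R := k) b * τ c h * Coalgebra.counit (R := k) l := by
  simp [cocycle]; ring

open WithConv

/-- `cocycle τ` as an element of the convolution algebra of linear maps to `B ⊗ H`. -/
noncomputable def cocycleConv (τ : B →ₗ[k] H →ₗ[k] k) :
    WithConv ((B ⊗[k] H) ⊗[k] (B ⊗[k] H) →ₗ[k] B ⊗[k] H) :=
  toConv (Algebra.linearMap k (B ⊗[k] H) ∘ₗ cocycle τ)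

/-- aux -/
noncomputable def tt (k B H : Type*) [Field k] [Ring B] [HopfAlgebra k B] [Ring H]
    [HopfAlgebra k H] : ((B ⊗[k] B) ⊗[k] (H ⊗[k] H)) ⊗[k] ((B ⊗[k] B) ⊗[k] (H ⊗[k] H)) →ₗ[k]
    ((B ⊗[k] H) ⊗[k] (B ⊗[k] H)) ⊗[k] ((B ⊗[k] H) ⊗[k] (B ⊗[k] H)) :=
  (TensorProduct.tensorTensorTensorComm k (B ⊗[k] H) (B ⊗[k] H) (B ⊗[k] H)
      (B ⊗[k] H)).toLinearMap ∘ₗ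
    TensorProduct.map (TensorProduct.tensorTensorTensorComm k B B H H).toLinearMap
      (TensorProduct.tensorTensorTensorComm k B B H H).toLinearMap

lemma comul_four (b c : B) (h l : H) :
    Coalgebra.comul (R := k) ((b ⊗ₜ[k] h) ⊗ₜ[k] (c ⊗ₜ[k] l)) =
    tt k B H ((Coalgebra.comul b ⊗ₜ Coalgebra.comul h) ⊗ₜ (Coalgebra.comul c ⊗ₜ Coalgebra.comul l)) := by
  rfl

lemma cocycle_mul (hτ : IsSkewPairing τ) (b c : B) (h l : H) :
    (cocycleConv τ * toConv (LinearMap.mul' k (B ⊗[k] H))).ofConv ((b ⊗ₜ[k] h) ⊗ₜ[k] (c ⊗ₜ[k] l)) =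
    TensorProduct.map (LinearMap.mulLeft k b ∘ₗ hτ.algU.toLinearMap.flip c)
      (LinearMap.mulRight k l) (Coalgebra.comul h) := by
  have key : ∀ (X Z : B ⊗[k] B) (Y W : H ⊗[k] H), LinearMap.mul' k (B ⊗[k] H)
      (TensorProduct.map (cocycleConv τ).ofConv (LinearMap.mul' k (B ⊗[k] H))
        (tt k B H ((X ⊗ₜ Y) ⊗ₜ (Z ⊗ₜ W)))) =
      TensorProduct.map (LinearMap.mulLeft k (TensorProduct.lid k B (Coalgebra.counit.rTensor B X))
          ∘ₗ IsSkewPairing.evalL τ Z)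
        (LinearMap.mulRight k (TensorProduct.lid k H (Coalgebra.counit.rTensor H W))) Y := by
    intro X Z Y W
    induction Y using TensorProduct.induction_on with
    | zero => simp
    | add x y hx hy => simp only [LinearMap.map_add, TensorProduct.add_tmul, TensorProduct.tmul_add, hx, hy]
    | tmul p q =>
    rw [TensorProduct.map_tmul, LinearMap.comp_apply, LinearMap.mulLeft_apply,
      LinearMap.mulRight_apply]
    induction X using TensorProduct.induction_on with
    | zero => simp
    | add x y hx hy => simp only [LinearMap.map_add, LinearEquiv.map_add, TensorProduct.add_tmul, add_mul, hx, hy]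
    | tmul a b =>
    induction Z using TensorProduct.induction_on with
    | zero => simp
    | add x y hx hy => simp only [LinearMap.map_add, TensorProduct.add_tmul, TensorProduct.tmul_add,
        LinearMap.add_apply, mul_add, hx, hy]
    | tmul c d =>
    induction W using TensorProduct.induction_on with
    | zero => simp
    | add x y hx hy => simp only [LinearMap.map_add, LinearEquiv.map_add, TensorProduct.tmul_add, mul_add, hx, hy]
    | tmul r s =>
      simp [tt, cocycleConv, cocycle_tmul, Algebra.algebraMap_eq_smul_one,
        IsSkewPairing.evalL_tmul, TensorProduct.smul_tmul', TensorProduct.tmul_smul,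
        smul_smul, mul_comm, mul_left_comm]
  have h1 : hτ.algU.toLinearMap.flip c = IsSkewPairing.evalL τ (Coalgebra.comul c) :=
    LinearMap.ext fun h => hτ.algU_apply h c
  rw [h1]
  refine (key (Coalgebra.comul b) (Coalgebra.comul c) (Coalgebra.comul h)
    (Coalgebra.comul l)).trans ?_
  simp

lemma cocycle_conv (τ τ' : B →ₗ[k] H →ₗ[k] k) (b c : B) (h l : H) :
    (cocycleConv τ * cocycleConv τ').ofConv ((b ⊗ₜ[k] h) ⊗ₜ[k] (c ⊗ₜ[k] l)) =
    (Coalgebra.counit (R := k) b * LinearMap.mul' k k (TensorProduct.map₂ τ τ'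
      (Coalgebra.comul c) (Coalgebra.comul h)) * Coalgebra.counit (R := k) l) • 1 := by
  have key : ∀ (X Z : B ⊗[k] B) (Y W : H ⊗[k] H), LinearMap.mul' k (B ⊗[k] H)
      (TensorProduct.map (cocycleConv τ).ofConv (cocycleConv τ').ofConv
        (tt k B H ((X ⊗ₜ Y) ⊗ₜ (Z ⊗ₜ W)))) =
      (Coalgebra.counit (R := k) (TensorProduct.lid k B (Coalgebra.counit.rTensor B X)) *
        LinearMap.mul' k k (TensorProduct.map₂ τ τ' Z Y) *
        Coalgebra.counit (R := k) (TensorProduct.lid k H (Coalgebra.counit.rTensor H W))) • 1 := by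
    intro X Z Y W
    induction X using TensorProduct.induction_on with
    | zero => simp
    | add x y hx hy => simp only [LinearMap.map_add, LinearEquiv.map_add, TensorProduct.add_tmul, add_mul, add_smul, hx, hy]
    | tmul a b =>
    induction W using TensorProduct.induction_on with
    | zero => simp
    | add x y hx hy => simp only [LinearMap.map_add, LinearEquiv.map_add, TensorProduct.tmul_add, mul_add, add_smul, hx, hy]
    | tmul r s =>
    induction Y using TensorProduct.induction_on with
    | zero => simp
    | add x y hx hy => simp only [LinearMap.map_add, TensorProduct.add_tmul, TensorProduct.tmul_add,
        mul_add, add_mul, add_smul, hx, hy]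
    | tmul p q =>
    induction Z using TensorProduct.induction_on with
    | zero => simp
    | add x y hx hy => simp only [LinearMap.map_add, TensorProduct.add_tmul, TensorProduct.tmul_add,
        LinearMap.add_apply, mul_add, add_mul, add_smul, hx, hy]
    | tmul c d =>
      simp [tt, cocycleConv, cocycle_tmul, Algebra.algebraMap_eq_smul_one,
        TensorProduct.map₂_apply_tmul, smul_smul, mul_comm, mul_left_comm, mul_assoc]
  refine (key (Coalgebra.comul b) (Coalgebra.comul c) (Coalgebra.comul h)
    (Coalgebra.comul l)).trans ?_
  simp

/-- The two forms `σ` for `τ(·, ·)` and for `τ(S(·), ·)` are inverse to each other. -/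
lemma cocycleConv_inv (hτ : IsSkewPairing τ) :
    cocycleConv τ * cocycleConv (τ ∘ₗ HopfAlgebra.antipode k) = 1 ∧
    cocycleConv (τ ∘ₗ HopfAlgebra.antipode k) * cocycleConv τ = 1 := by
  have h1 : ∀ (f g : B →ₗ[k] B) (Z : B ⊗[k] B) (h : H),
      LinearMap.mul' k k (TensorProduct.map₂ (τ ∘ₗ f) (τ ∘ₗ g) Z (Coalgebra.comul h)) =
      τ (LinearMap.mul' k B (TensorProduct.map f g Z)) h := by
    intro f g Z h
    induction Z using TensorProduct.induction_on with
    | zero => simp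
    | add x y hx hy => simp only [LinearMap.map_add, LinearMap.add_apply, hx, hy]
    | tmul c d => simp [hτ.mul_left, TensorProduct.map₂_apply_tmul]
  constructor
  · apply WithConv.ofConv_injective
    apply TensorProduct.ext_fourfold'
    intro b h c l
    rw [cocycle_conv]
    have := h1 LinearMap.id (HopfAlgebra.antipode k) (Coalgebra.comul c) h
    rw [LinearMap.comp_id] at this
    rw [this, ← LinearMap.lTensor_def, HopfAlgebra.mul_antipode_lTensor_comul_apply]
    simp [Algebra.algebraMap_eq_smul_one, hτ.one_left, mul_comm, mul_left_comm]
  · apply WithConv.ofConv_injective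
    apply TensorProduct.ext_fourfold'
    intro b h c l
    rw [cocycle_conv]
    have := h1 (HopfAlgebra.antipode k) LinearMap.id (Coalgebra.comul c) h
    rw [LinearMap.comp_id] at this
    rw [this, ← LinearMap.rTensor_def, HopfAlgebra.mul_antipode_rTensor_comul_apply]
    simp [Algebra.algebraMap_eq_smul_one, hτ.one_left, mul_comm, mul_left_comm]

/-- The product of the generalized quantum double is the product of `B ⊗ H` deformed by the
cocycle `σ`, i.e. the convolution product `σ * m * σ⁻¹`. -/
lemma mulMap_doubleData (hτ : IsSkewPairing τ) :
    toConv (TwistedTensor.mulMap hτ.doubleData) = cocycleConv τ *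
      toConv (LinearMap.mul' k (B ⊗[k] H)) * cocycleConv (τ ∘ₗ HopfAlgebra.antipode k) := by
  apply WithConv.ofConv_injective
  apply TensorProduct.ext_fourfold'
  intro b h c l
  have mla : ∀ x y : B, LinearMap.mulLeft k (x + y) =
      LinearMap.mulLeft k x + LinearMap.mulLeft k y := (LinearMap.mul k B).map_add
  have mra : ∀ x y : H, LinearMap.mulRight k (x + y) =
      LinearMap.mulRight k x + LinearMap.mulRight k y := (LinearMap.mul k H).flip.map_add
  set F := cocycleConv τ * toConv (LinearMap.mul' k (B ⊗[k] H)) with hF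
  have key : ∀ (X Z : B ⊗[k] B) (p q : H) (W : H ⊗[k] H), LinearMap.mul' k (B ⊗[k] H)
      (TensorProduct.map F.ofConv (cocycleConv (τ ∘ₗ HopfAlgebra.antipode k)).ofConv
        (tt k B H ((X ⊗ₜ (p ⊗ₜ q)) ⊗ₜ (Z ⊗ₜ W)))) =
      TensorProduct.map (LinearMap.mulLeft k (TensorProduct.rid k B (Coalgebra.counit.lTensor B X))
          ∘ₗ hτ.algU.toLinearMap.flip (IsSkewPairing.evalL (τ ∘ₗ HopfAlgebra.antipode k)
            (TensorProduct.comm k B B Z) q))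
        (LinearMap.mulRight k (TensorProduct.rid k H (Coalgebra.counit.lTensor H W)))
        (Coalgebra.comul p) := by
    intro X Z p q W
    induction X using TensorProduct.induction_on with
    | zero => simp
    | add x y hx hy =>
      simp only [LinearMap.map_add, LinearEquiv.map_add, TensorProduct.add_tmul, hx, hy, mla,
        LinearMap.add_comp, TensorProduct.map_add_left, LinearMap.add_apply]
    | tmul a b =>
    induction Z using TensorProduct.induction_on with
    | zero => simp
    | add x y hx hy =>
      simp only [LinearMap.map_add, LinearEquiv.map_add, TensorProduct.add_tmul, TensorProduct.tmul_add, hx, hy,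
        LinearMap.comp_add, TensorProduct.map_add_left, LinearMap.add_apply]
    | tmul c d =>
    induction W using TensorProduct.induction_on with
    | zero => simp
    | add x y hx hy =>
      simp only [LinearMap.map_add, LinearEquiv.map_add, TensorProduct.tmul_add, hx, hy, mra,
        TensorProduct.map_add_right, LinearMap.add_apply]
    | tmul r s =>
      have h1 := cocycle_mul hτ a c p r
      rw [← hF] at h1
      have h2 : tt k B H (((a ⊗ₜ b) ⊗ₜ (p ⊗ₜ q)) ⊗ₜ ((c ⊗ₜ d) ⊗ₜ (r ⊗ₜ s))) =
        ((a ⊗ₜ p) ⊗ₜ (c ⊗ₜ r)) ⊗ₜ ((b ⊗ₜ q) ⊗ₜ (d ⊗ₜ s)) := by simp [tt]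
      rw [h2, TensorProduct.map_tmul, h1, LinearMap.mul'_apply]
      induction (Coalgebra.comul p : H ⊗[k] H) using TensorProduct.induction_on with
      | zero => simp
      | add x y hx hy => simp only [LinearMap.map_add, add_mul, hx, hy]
      | tmul u v =>
        simp [cocycleConv, cocycle_tmul, Algebra.algebraMap_eq_smul_one,
          IsSkewPairing.evalL_tmul, TensorProduct.smul_tmul', TensorProduct.tmul_smul,
          smul_smul, mul_comm, mul_left_comm]
  have key2 : ∀ Y : H ⊗[k] H, LinearMap.mul' k (B ⊗[k] H)
      (TensorProduct.map F.ofConv (cocycleConv (τ ∘ₗ HopfAlgebra.antipode k)).ofConv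
        (tt k B H ((Coalgebra.comul b ⊗ₜ Y) ⊗ₜ (Coalgebra.comul c ⊗ₜ Coalgebra.comul l)))) =
      hτ.doubleData.T b c l (TensorProduct.rightComm k H H H (Coalgebra.comul.rTensor H Y)) := by
    intro Y
    induction Y using TensorProduct.induction_on with
    | zero => simp
    | add x y hx hy => simp only [LinearMap.map_add, LinearEquiv.map_add, TensorProduct.add_tmul, TensorProduct.tmul_add, hx, hy]
    | tmul p q =>
      rw [key, LinearMap.rTensor_tmul, ← IsSkewPairing.algV_apply hτ]
      simp only [Coalgebra.lTensor_counit_comul, TensorProduct.rid_tmul, one_smul]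
      induction (Coalgebra.comul p : H ⊗[k] H) using TensorProduct.induction_on with
      | zero => simp
      | add x y hx hy => simp only [LinearMap.map_add, LinearEquiv.map_add, TensorProduct.add_tmul, hx, hy]
      | tmul u v =>
        simp [SmashData.T_tmul, IsSkewPairing.doubleData, IsSkewPairing.doubleAct_tmul]
  refine Eq.trans ?_ (key2 (Coalgebra.comul h)).symm
  change TwistedTensor.mulMap hτ.doubleData ((b ⊗ₜ h) ⊗ₜ (c ⊗ₜ l)) = _
  rw [TwistedTensor.mulMap_tmul]
  rfl
end Double


section Restrict

variable {k J V : Type*} [Field k] [Ring J] [HopfAlgebra k J] [AddCommGroup V] [Module k V]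

lemma lTensor_subtype_injective (P : Submodule k V) :
    Function.Injective (P.subtype.lTensor J) :=
  Module.Flat.lTensor_preserves_injective_linearMap _ P.injective_subtype

/-- The Yetter-Drinfeld module structure on a subspace `P` which is stable under the action and
satisfies `ρ(P) ⊆ J ⊗ P`. -/
noncomputable def YDModule.restrict (M : YDModule k J V) (P : Submodule k V)
    (hact : ∀ a, ∀ v ∈ P, M.act a v ∈ P)
    (hcoact : ∀ v ∈ P, M.coact v ∈ LinearMap.range (P.subtype.lTensor J)) : YDModule k J P :=
  let act' : J →ₐ[k] Module.End k P := AlgHom.ofLinearMap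
    { toFun := fun a => (M.act a).restrict (hact a)
      map_add' := fun a b => by ext; simp [LinearMap.restrict_apply]
      map_smul' := fun r a => by ext; simp [LinearMap.restrict_apply] }
    (by ext; simp [LinearMap.restrict_apply])
    (fun a b => by ext; simp [LinearMap.restrict_apply])
  let coact' : P →ₗ[k] J ⊗[k] P :=
    (LinearEquiv.ofInjective (P.subtype.lTensor J) (lTensor_subtype_injective P)).symm.toLinearMap ∘ₗ
      (M.coact ∘ₗ P.subtype).codRestrict _ (fun v => hcoact v v.2)
  have hc : ∀ v, P.subtype.lTensor J (coact' v) = M.coact v := fun v => by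
    have := LinearEquiv.apply_symm_apply
      (LinearEquiv.ofInjective (P.subtype.lTensor J) (lTensor_subtype_injective P))
      ((M.coact ∘ₗ P.subtype).codRestrict _ (fun v => hcoact v v.2) v)
    exact congrArg Subtype.val this
  { act := act'
    coact := coact'
    counit_coact := fun v => by
      apply P.injective_subtype
      have h : ∀ X : J ⊗[k] P, P.subtype (TensorProduct.lid k P (Coalgebra.counit.rTensor P X)) =
          TensorProduct.lid k V (Coalgebra.counit.rTensor V (P.subtype.lTensor J X)) := by
        intro X
        induction X using TensorProduct.induction_on with
        | zero => simp
        | add x y hx hy => simp only [LinearMap.map_add, LinearEquiv.map_add, hx, hy]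
        | tmul x y => simp
      rw [h, hc, M.counit_coact]; rfl
    coassoc := fun v => by
      have hinj : Function.Injective ((P.subtype.lTensor J).lTensor J) :=
        Module.Flat.lTensor_preserves_injective_linearMap _ (lTensor_subtype_injective P)
      apply hinj
      have h1 : ∀ X : J ⊗[k] P, (P.subtype.lTensor J).lTensor J
          (TensorProduct.assoc k J J P (Coalgebra.comul.rTensor P X)) =
          TensorProduct.assoc k J J V (Coalgebra.comul.rTensor V (P.subtype.lTensor J X)) := by
        intro X
        induction X using TensorProduct.induction_on with
        | zero => simp
        | add x y hx hy => simp only [LinearMap.map_add, LinearEquiv.map_add, hx, hy]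
        | tmul x y =>
          simp only [LinearMap.rTensor_tmul, LinearMap.lTensor_tmul]
          induction (Coalgebra.comul x : J ⊗[k] J) using TensorProduct.induction_on with
          | zero => simp
          | add x y hx hy => simp only [LinearMap.map_add, LinearEquiv.map_add, TensorProduct.add_tmul, hx, hy]
          | tmul u v => simp
      have h2 : ∀ X : J ⊗[k] P, (P.subtype.lTensor J).lTensor J (coact'.lTensor J X) =
          M.coact.lTensor J (P.subtype.lTensor J X) := by
        intro X
        induction X using TensorProduct.induction_on with
        | zero => simp
        | add x y hx hy => simp only [LinearMap.map_add, hx, hy]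
        | tmul x y => simp [hc]
      rw [h1, h2, hc, M.coassoc]
    coact_act := fun a v => by
      apply lTensor_subtype_injective P
      have h : ∀ (C : J ⊗[k] (J ⊗[k] J)) (X : J ⊗[k] P),
          P.subtype.lTensor J (ydMap act'.toLinearMap C X) =
          ydMap M.act.toLinearMap C (P.subtype.lTensor J X) := by
        intro C X
        induction X using TensorProduct.induction_on with
        | zero => simp
        | add x y hx hy => simp only [LinearMap.map_add, hx, hy]
        | tmul x y =>
        induction C using TensorProduct.induction_on with
        | zero => simp
        | add x y hx hy => simp only [LinearMap.map_add, LinearMap.add_apply, hx, hy]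
        | tmul c C =>
        induction C using TensorProduct.induction_on with
        | zero => simp
        | add x y hx hy =>
          simp only [LinearMap.map_add, TensorProduct.tmul_add, LinearMap.add_apply, hx, hy]
        | tmul d e =>
          rw [ydMap_tmul, LinearMap.lTensor_tmul, LinearMap.lTensor_tmul, ydMap_tmul]
          rfl
      rw [h, hc, hc, ← M.coact_act]
      rfl }

lemma YDModule.restrict_act (M : YDModule k J V) (P : Submodule k V) (hact) (hcoact) (a : J)
    (v : P) : ((M.restrict P hact hcoact).act a v : V) = M.act a v := rfl

lemma YDModule.restrict_coact (M : YDModule k J V) (P : Submodule k V) (hact) (hcoact) (v : P) :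
    P.subtype.lTensor J ((M.restrict P hact hcoact).coact v) = M.coact v := by
  have := LinearEquiv.apply_symm_apply
    (LinearEquiv.ofInjective (P.subtype.lTensor J) (lTensor_subtype_injective P))
    ((M.coact ∘ₗ P.subtype).codRestrict _ (fun v => hcoact v v.2) v)
  exact congrArg Subtype.val this

end Restrict

section Primitives

variable {k J R : Type*} [Field k] [Ring J] [HopfAlgebra k J] [Ring R] [Algebra k R]
  [Coalgebra k R]

variable (k R) in
/-- The space `P(R)` of primitive elements, `Δ(v) = v ⊗ 1 + 1 ⊗ v`. -/
noncomputable def primitives : Submodule k R :=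
  LinearMap.eqLocus (Coalgebra.comul (R := k) (A := R))
    ((TensorProduct.mk k R R).flip 1 + TensorProduct.mk k R R 1)

lemma mem_primitives {v : R} :
    v ∈ primitives k R ↔ Coalgebra.comul (R := k) v = v ⊗ₜ 1 + 1 ⊗ₜ v := Iff.rfl

namespace BraidedHopfAlgebra

variable (H : BraidedHopfAlgebra k J R)

lemma act_mem_primitives (a : J) (v : R) (hv : v ∈ primitives k R) :
    H.act a v ∈ primitives k R := by
  rw [mem_primitives] at hv ⊢
  rw [H.comul_act, hv]
  have h : ∀ X : J ⊗[k] J, TensorProduct.map₂ H.act.toLinearMap H.act.toLinearMap X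
      (v ⊗ₜ[k] (1 : R) + (1 : R) ⊗ₜ[k] v) =
      H.act (TensorProduct.rid k J (Coalgebra.counit.lTensor J X)) v ⊗ₜ 1 +
      1 ⊗ₜ H.act (TensorProduct.lid k J (Coalgebra.counit.rTensor J X)) v := by
    intro X
    induction X using TensorProduct.induction_on with
    | zero => simp
    | add x y hx hy =>
      rw [(TensorProduct.map₂ H.act.toLinearMap H.act.toLinearMap).map_add, LinearMap.add_apply,
        hx, hy]
      simp only [LinearMap.map_add, LinearEquiv.map_add, alg_add, LinearMap.add_apply, TensorProduct.add_tmul, TensorProduct.tmul_add]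
      abel
    | tmul x y =>
      simp [TensorProduct.map₂_apply_tmul, H.act_one, Algebra.algebraMap_eq_smul_one,
        TensorProduct.smul_tmul', TensorProduct.tmul_smul]
  rw [h]
  simp

lemma coact_mem_primitives (v : R) (hv : v ∈ primitives k R) :
    H.coact v ∈ LinearMap.range ((primitives k R).subtype.lTensor J) := by
  let D : R →ₗ[k] R ⊗[k] R := Coalgebra.comul (R := k) (A := R) -
    ((TensorProduct.mk k R R).flip 1 + TensorProduct.mk k R R 1)
  have hex : Function.Exact (primitives k R).subtype D := by
    intro w
    simp [D, sub_eq_zero, mem_primitives]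
  have hex' := Module.Flat.lTensor_exact J hex
  refine (hex' _).1 ?_
  have h := H.coact_comul v
  rw [mem_primitives.1 hv] at h
  simp only [D, LinearMap.lTensor_sub, LinearMap.lTensor_add, LinearMap.sub_apply,
    LinearMap.add_apply, h, map_add, TensorProduct.map_tmul, H.coact_one]
  rw [sub_eq_zero]
  congr 1
  · induction H.coact v using TensorProduct.induction_on with
    | zero => simp
    | add x y hx hy => simp only [LinearMap.map_add, LinearEquiv.map_add, TensorProduct.add_tmul, hx, hy]
    | tmul x y => simp
  · induction H.coact v using TensorProduct.induction_on with
    | zero => simp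
    | add x y hx hy => simp only [LinearMap.map_add, LinearEquiv.map_add, TensorProduct.tmul_add, hx, hy]
    | tmul x y => simp

/-- The Yetter-Drinfeld module `P(R)`, a subobject of `R`. -/
noncomputable def ydPrimitives : YDModule k J (primitives k R) :=
  H.toYDModule.restrict (primitives k R) H.act_mem_primitives H.coact_mem_primitives

end BraidedHopfAlgebra
end Primitives


namespace YDModule

variable {k J V : Type*} [Field k] [Ring J] [HopfAlgebra k J] [AddCommGroup V] [Module k V]
  (M : YDModule k J V)

open WithConv in
/-- The algebra map `t ↦ (a ↦ a ▷ t)` from `T(V)` to the convolution algebra of linear maps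
`J → T(V)`, determined by `v ↦ (a ↦ a ▷ v)`. -/
noncomputable def tensorActConv :
    TensorAlgebra k V →ₐ[k] WithConv (J →ₗ[k] TensorAlgebra k V) :=
  TensorAlgebra.lift k
    { toFun := fun v => toConv (TensorAlgebra.ι k ∘ₗ LinearMap.applyₗ v ∘ₗ M.act.toLinearMap)
      map_add' := fun v w => by ext; simp
      map_smul' := fun r v => by ext; simp }

/-- The action on the tensor algebra as a bilinear map. -/
noncomputable def tensorActLin : J →ₗ[k] Module.End k (TensorAlgebra k V) :=
  LinearMap.flip
    { toFun := fun t => (M.tensorActConv t).ofConv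
      map_add' := fun v w => by simp
      map_smul' := fun r v => by simp }

lemma tensorActLin_ι (a : J) (v : V) :
    M.tensorActLin a (TensorAlgebra.ι k v) = TensorAlgebra.ι k (M.act a v) := by
  change (M.tensorActConv (TensorAlgebra.ι k v)).ofConv a = _
  rw [tensorActConv, TensorAlgebra.lift_ι_apply]
  rfl

lemma tensorActLin_one (a : J) :
    M.tensorActLin a 1 = algebraMap k (TensorAlgebra k V) (Coalgebra.counit a) := by
  change (M.tensorActConv 1).ofConv a = _
  rw [map_one]
  rfl

lemma tensorActLin_mul (a : J) (s t : TensorAlgebra k V) :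
    M.tensorActLin a (s * t) = LinearMap.mul' k (TensorAlgebra k V)
      (TensorProduct.map₂ M.tensorActLin M.tensorActLin (Coalgebra.comul a) (s ⊗ₜ t)) := by
  change (M.tensorActConv (s * t)).ofConv a = _
  rw [map_mul, LinearMap.convMul_def]
  simp only [LinearMap.comp_apply]
  induction (Coalgebra.comul a : J ⊗[k] J) using TensorProduct.induction_on with
  | zero => simp
  | add x y hx hy => simp only [LinearMap.map_add, LinearMap.add_apply, hx, hy]
  | tmul x y => rfl

/-- The action of `J` on `T(V)`, the extension of the action on `V` making `T(V)` a module
algebra. -/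
noncomputable def tensorAct : J →ₐ[k] Module.End k (TensorAlgebra k V) :=
  AlgHom.ofLinearMap M.tensorActLin
    (by
      ext t
      induction t using TensorAlgebra.induction with
      | algebraMap r =>
        rw [Algebra.algebraMap_eq_smul_one, map_smul, tensorActLin_one]; simp
      | ι v => rw [tensorActLin_ι]; simp
      | mul s t hs ht =>
        rw [tensorActLin_mul, Bialgebra.comul_one, Algebra.TensorProduct.one_def,
          TensorProduct.map₂_apply_tmul, TensorProduct.map_tmul, hs, ht]; rfl
      | add s t hs ht => rw [map_add, hs, ht, map_add])
    (by
      intro a b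
      ext t
      induction t using TensorAlgebra.induction generalizing a b with
      | algebraMap r =>
        rw [Algebra.algebraMap_eq_smul_one, map_smul, tensorActLin_one, map_smul,
          Module.End.mul_apply, tensorActLin_one, Algebra.algebraMap_eq_smul_one (Coalgebra.counit b),
          map_smul, tensorActLin_one]
        simp [Algebra.algebraMap_eq_smul_one, mul_smul, smul_comm (Coalgebra.counit (R := k) a)]
      | ι v => simp [tensorActLin_ι]
      | mul s t hs ht =>
        rw [tensorActLin_mul, Bialgebra.comul_mul, Module.End.mul_apply, tensorActLin_mul]
        generalize (Coalgebra.comul b : J ⊗[k] J) = Y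
        induction Y using TensorProduct.induction_on with
        | zero => simp
        | add x y hx hy => simp only [LinearMap.map_add, LinearMap.add_apply, mul_add, hx, hy]
        | tmul x y =>
          rw [TensorProduct.map₂_apply_tmul, TensorProduct.map_tmul, LinearMap.mul'_apply,
            tensorActLin_mul]
          induction (Coalgebra.comul a : J ⊗[k] J) using TensorProduct.induction_on with
          | zero => simp
          | add x y hx hy => simp only [LinearMap.map_add, LinearMap.add_apply, add_mul, hx, hy]
          | tmul u v => simp [TensorProduct.map₂_apply_tmul, hs, ht]
      | add s t hs ht => rw [map_add, hs, ht, map_add])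

lemma tensorAct_ι (a : J) (v : V) :
    M.tensorAct a (TensorAlgebra.ι k v) = TensorAlgebra.ι k (M.act a v) :=
  M.tensorActLin_ι a v

/-- The coaction of `J` on `T(V)`, the algebra map extending the coaction on `V`. -/
noncomputable def tensorCoact : TensorAlgebra k V →ₐ[k] J ⊗[k] TensorAlgebra k V :=
  TensorAlgebra.lift k ((TensorAlgebra.ι k).lTensor J ∘ₗ M.coact)

lemma tensorCoact_ι (v : V) : M.tensorCoact (TensorAlgebra.ι k v) =
    (TensorAlgebra.ι k).lTensor J (M.coact v) := by
  rw [tensorCoact, TensorAlgebra.lift_ι_apply]; rfl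

/-- The data defining the braided tensor square of `T(V)`. -/
noncomputable def tensorSquare :
    SmashData k (TensorAlgebra k V) (TensorAlgebra k V) J where
  act := M.tensorAct
  coact := M.tensorCoact
  comul := Coalgebra.comul
  counit := Coalgebra.counit
  act_one := M.tensorActLin_one
  act_mul := M.tensorActLin_mul
  counit_coact t := by
    have h : ((Algebra.TensorProduct.lid k (TensorAlgebra k V)).toAlgHom.comp
        (Algebra.TensorProduct.map (Bialgebra.counitAlgHom k J)
          (AlgHom.id k (TensorAlgebra k V)))).comp M.tensorCoact = AlgHom.id k _ := by
      apply TensorAlgebra.hom_ext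
      ext v
      change TensorProduct.lid k (TensorAlgebra k V) (Coalgebra.counit.rTensor _
        (M.tensorCoact (TensorAlgebra.ι k v))) = TensorAlgebra.ι k v
      rw [tensorCoact_ι]
      conv_rhs => rw [← M.counit_coact v]
      induction M.coact v using TensorProduct.induction_on with
      | zero => simp
      | add x y hx hy => simp only [LinearMap.map_add, LinearEquiv.map_add, hx, hy]
      | tmul x y => simp
    exact AlgHom.congr_fun h t
  coassoc t := by
    have h : ((Algebra.TensorProduct.assoc k k k J J (TensorAlgebra k V)).toAlgHom.comp
        (Algebra.TensorProduct.map (Bialgebra.comulAlgHom k J)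
          (AlgHom.id k (TensorAlgebra k V)))).comp M.tensorCoact =
        (Algebra.TensorProduct.map (AlgHom.id k J) M.tensorCoact).comp M.tensorCoact := by
      apply TensorAlgebra.hom_ext
      ext v
      change TensorProduct.assoc k J J (TensorAlgebra k V) (Coalgebra.comul.rTensor _
        (M.tensorCoact (TensorAlgebra.ι k v))) =
        M.tensorCoact.toLinearMap.lTensor J (M.tensorCoact (TensorAlgebra.ι k v))
      rw [tensorCoact_ι]
      have h1 : ∀ X : J ⊗[k] V, TensorProduct.assoc k J J (TensorAlgebra k V)
          (Coalgebra.comul.rTensor _ ((TensorAlgebra.ι k).lTensor J X)) =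
          ((TensorAlgebra.ι k).lTensor J).lTensor J
            (TensorProduct.assoc k J J V (Coalgebra.comul.rTensor V X)) := by
        intro X
        induction X using TensorProduct.induction_on with
        | zero => simp
        | add x y hx hy => simp only [LinearMap.map_add, LinearEquiv.map_add, hx, hy]
        | tmul x y =>
          simp only [LinearMap.rTensor_tmul, LinearMap.lTensor_tmul]
          induction (Coalgebra.comul x : J ⊗[k] J) using TensorProduct.induction_on with
          | zero => simp
          | add x y hx hy => simp only [LinearMap.map_add, LinearEquiv.map_add, TensorProduct.add_tmul, hx, hy]
          | tmul u v => simp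
      rw [h1, M.coassoc]
      induction M.coact v using TensorProduct.induction_on with
      | zero => simp
      | add x y hx hy => simp only [LinearMap.map_add, hx, hy]
      | tmul x y => simp [tensorCoact_ι]
    exact AlgHom.congr_fun h t

/-- The coproduct of the braided Hopf algebra `T(V)`: the algebra map to the braided tensor
square with `v ↦ v ⊗ 1 + 1 ⊗ v`. -/
noncomputable def tensorComul : TensorAlgebra k V →ₐ[k] TwistedTensor M.tensorSquare :=
  TensorAlgebra.lift k ((TwistedTensor.inl M.tensorSquare).toLinearMap ∘ₗ TensorAlgebra.ι k +
    (TwistedTensor.inr M.tensorSquare).toLinearMap ∘ₗ TensorAlgebra.ι k)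

/-- The same coproduct with values in `T(V) ⊗ T(V)`. -/
noncomputable def tensorComulLin :
    TensorAlgebra k V →ₗ[k] TensorAlgebra k V ⊗[k] TensorAlgebra k V :=
  (TwistedTensor.ofTensor M.tensorSquare).symm.toLinearMap ∘ₗ M.tensorComul.toLinearMap

lemma tensorComulLin_ι (v : V) : M.tensorComulLin (TensorAlgebra.ι k v) =
    TensorAlgebra.ι k v ⊗ₜ 1 + 1 ⊗ₜ TensorAlgebra.ι k v := by
  rw [tensorComulLin, LinearMap.comp_apply, AlgHom.toLinearMap_apply, tensorComul,
    TensorAlgebra.lift_ι_apply]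
  rfl

/-- The subspace of `T(V)` underlying a two-sided ideal. -/
def idealSubmodule (I : TwoSidedIdeal (TensorAlgebra k V)) : Submodule k (TensorAlgebra k V) :=
  LinearMap.ker (I.ringCon.mkₐ k).toLinearMap

/-- Homogeneous braided bi-ideals `I` of `T(V)` with `I ∩ V = 0`. -/
structure IsNicholsIdeal (I : TwoSidedIdeal (TensorAlgebra k V)) : Prop where
  homogeneous : ∀ t ∈ I, ∀ n : ℕ, (DirectSum.decompose
    (fun n : ℕ => LinearMap.range (TensorAlgebra.ι k : V →ₗ[k] TensorAlgebra k V) ^ n) t n :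
      TensorAlgebra k V) ∈ I
  act_mem : ∀ a, ∀ t ∈ I, M.tensorAct a t ∈ I
  coact_mem : ∀ t ∈ I,
    M.tensorCoact t ∈ LinearMap.range ((idealSubmodule I).subtype.lTensor J)
  comul_mem : ∀ t ∈ I, M.tensorComulLin t ∈
    LinearMap.range ((idealSubmodule I).subtype.rTensor (TensorAlgebra k V)) ⊔
    LinearMap.range ((idealSubmodule I).subtype.lTensor (TensorAlgebra k V))
  counit_eq_zero : ∀ t ∈ I, TensorAlgebra.algebraMapInv t = 0
  inter_eq_zero : ∀ v : V, TensorAlgebra.ι k v ∈ I → v = 0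

/-- The largest homogeneous braided bi-ideal of `T(V)` with zero intersection with `V`. -/
noncomputable def nicholsIdeal : TwoSidedIdeal (TensorAlgebra k V) :=
  sSup {I | M.IsNicholsIdeal I}

/-- The Nichols algebra `𝔅(V)`. -/
abbrev NicholsAlgebra : Type _ := M.nicholsIdeal.ringCon.Quotient

/-- The projection `T(V) → 𝔅(V)`. -/
noncomputable def nicholsMk : TensorAlgebra k V →ₐ[k] M.NicholsAlgebra :=
  M.nicholsIdeal.ringCon.mkₐ k

end YDModule

namespace BraidedHopfAlgebra

variable {k J R : Type*} [Field k] [Ring J] [HopfAlgebra k J] [Ring R] [Algebra k R]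
  [Coalgebra k R] (H : BraidedHopfAlgebra k J R)

/-- The inclusion of `V = P(R)` extends to an isomorphism `𝔅(V) ≃ R` of algebras, it does so
uniquely, and the isomorphism is one of braided Hopf algebras, i.e. it respects the action, the
coaction, the coproduct and the counit (which `𝔅(V)` inherits from `T(V)`). -/
def IsNichols : Prop :=
  ∃ e : H.ydPrimitives.NicholsAlgebra ≃ₐ[k] R,
    (∀ v : primitives k R, e (H.ydPrimitives.nicholsMk (TensorAlgebra.ι k v)) = v) ∧
    (∀ f : H.ydPrimitives.NicholsAlgebra →ₐ[k] R,
      (∀ v : primitives k R, f (H.ydPrimitives.nicholsMk (TensorAlgebra.ι k v)) = v) →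
      f = e.toAlgHom) ∧
    (∀ a t, e (H.ydPrimitives.nicholsMk (H.ydPrimitives.tensorAct a t)) =
      H.act a (e (H.ydPrimitives.nicholsMk t))) ∧
    (∀ t, H.coact (e (H.ydPrimitives.nicholsMk t)) =
      (e.toLinearMap ∘ₗ H.ydPrimitives.nicholsMk.toLinearMap).lTensor J
        (H.ydPrimitives.tensorCoact t)) ∧
    (∀ t, Coalgebra.comul (R := k) (e (H.ydPrimitives.nicholsMk t)) =
      TensorProduct.map (e.toLinearMap ∘ₗ H.ydPrimitives.nicholsMk.toLinearMap)
        (e.toLinearMap ∘ₗ H.ydPrimitives.nicholsMk.toLinearMap)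
        (H.ydPrimitives.tensorComulLin t)) ∧
    (∀ t, Coalgebra.counit (R := k) (e (H.ydPrimitives.nicholsMk t)) =
      TensorAlgebra.algebraMapInv t)

end BraidedHopfAlgebra

section Conjugation

variable {k A D : Type*} [Field k] [Ring A] [HopfAlgebra k A] [Ring D] [Algebra k D]

/-- The conjugation `d ↦ ∑ a₁ d S(a₂)` by `a ∈ A` in an algebra `D` containing `A` via `φ`. -/
noncomputable def conjugate (φ : A →ₐ[k] D) (a : A) (d : D) : D :=
  LinearMap.mul' k D (TensorProduct.map (LinearMap.mulRight k d ∘ₗ φ.toLinearMap)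
    (φ.toLinearMap ∘ₗ HopfAlgebra.antipode k) (Coalgebra.comul a))

end Conjugation

/-- The generalized quantum double `B ⋈_τ H` of a skew pairing `τ : B ⊗ H → k`: the algebra on
`B ⊗ H` with the product `(b ⊗ h) (c ⊗ l) = ∑ τ(c₁, h₁) b c₂ ⊗ h₂ l τ(S(c₃), h₃)`, which is the
deformation of the tensor product algebra by the cocycle `(b ⊗ h) ⊗ (c ⊗ l) ↦ ε(b) τ(c, h) ε(l)`
(see `mulMap_doubleData`). -/
abbrev GeneralizedDouble {k B H : Type*} [Field k] [Ring B] [HopfAlgebra k B] [Ring H]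
    [HopfAlgebra k H] {τ : B →ₗ[k] H →ₗ[k] k} (hτ : IsSkewPairing τ) : Type _ :=
  TwistedTensor hτ.doubleData

namespace GeneralizedDouble

variable {k B H : Type*} [Field k] [Ring B] [HopfAlgebra k B] [Ring H] [HopfAlgebra k H]
  {τ : B →ₗ[k] H →ₗ[k] k} (hτ : IsSkewPairing τ)

/-- The embedding `b ↦ b ⊗ 1`. -/
noncomputable abbrev inLeft : B →ₐ[k] GeneralizedDouble hτ := TwistedTensor.inl hτ.doubleData

/-- The embedding `h ↦ 1 ⊗ h`. -/
noncomputable abbrev inRight : H →ₐ[k] GeneralizedDouble hτ := TwistedTensor.inr hτ.doubleData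

end GeneralizedDouble

end YDHopf

open YDHopf

/-!
Write `B = R # J`, `H = S # K`, and let `π` denote the projections `B → J` and `H → K`.

*Conjugation and bilinear identities.* The coproduct of `r ∈ R` in `B` satisfies
`∑ r₁ ⊗ π(r₂) = r ⊗ 1` and `∑ π(r₁) ⊗ r₂ = ∑ r₋₁ ⊗ r₀`. If `τ` is trivial on `J ⊗ S` and on `R ⊗ K`,
then `τ(b, x) = τ(π(b), x)` and `τ(a, y) = τ(a, π(y))` for `x ∈ K` and `a ∈ J`. Everything about
`τ` follows from these facts: the commutation rules `x r = ∑ τ(r₋₁, x₁) r₀ x₂` and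
`s a = ∑ τ(a₁, s₋₁) a₂ s₀` in the double, which give the conjugation formulas
(`IsSkewPairing.conjugate_inR`, `IsSkewPairing.conjugate_inJ`); the formulas for `τ(r, s s')`,
`τ(r r', s)`, `τ(a ▷ r, s)` and `τ(r, x ▷ s)`; and the factorizations
`τ(r a, x s) = τ(r, s) τ(a, x)` and `τ(S⁻¹(r) a, s x) = τ(S⁻¹(r), s) τ(a, x)`. As `R ⊗ J → B` and
`S ⊗ K → H` are bijective in either order of the factors, the non-degeneracy statements follow,
because a tensor product of non-zero forms is non-degenerate if and only if both factors are.

*The antipode.* If `R` is generated by `V = P(R)`, then the subspaces `J V J ⋯ V J` form an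
exhaustive coalgebra filtration of `B` with bottom step `J`. By Takeuchi's argument the identity
`B → Bᵒᵖ` has a convolution inverse, because it has one on `J`; this is the inverse of the antipode.

*Nichols algebras.* Powers `Vᵐ` and `Wⁿ` of the spaces of primitive elements are orthogonal for
`m ≠ n`. Therefore, if no primitive element lies in the radical, the preimage in `T(V)` of the
radical of `τ` in `R` is a homogeneous braided bi-ideal `I` with `I ∩ V = 0`; here the
non-degeneracy on `J ⊗ K` turns the adjunction between actions and coactions into stability under
the coaction. Conversely, every such ideal maps into the radical, since its orthogonal complement is
a subalgebra containing the generators. So the preimage of the radical is the ideal defining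
`𝔅(V)`, and `R` is Nichols if and only if the radical vanishes
(`BraidedHopfAlgebra.HasHopfRadical.isNichols_iff`). The same holds for `S`.
-/

namespace YDHopf

attribute [-simp] map_zero map_add
attribute [local simp] LinearMap.map_zero LinearEquiv.map_zero alg_zero LinearMap.map_add
  LinearEquiv.map_add alg_add

/-! ### Bilinear forms on tensor products -/

section Bilinear

variable {k M N X Y : Type*} [Field k] [AddCommGroup M] [Module k M] [AddCommGroup N] [Module k N]
  [AddCommGroup X] [Module k X] [AddCommGroup Y] [Module k Y]

/-- The tensor product of two forms with zero left radical has zero left radical. -/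
lemma eq_zero_of_forall_pairing_eq_zero {α : M →ₗ[k] X →ₗ[k] k} {β : N →ₗ[k] Y →ₗ[k] k}
    (hα : α.SeparatingLeft) (hβ : β.SeparatingLeft) (x : M ⊗[k] N)
    (h : ∀ s t, LinearMap.mul' k k (TensorProduct.map (α.flip s) (β.flip t) x) = 0) : x = 0 := by
  have h1 : ∀ t, TensorProduct.rid k M ((β.flip t).lTensor M x) = 0 := by
    intro t
    refine hα _ fun s => ?_
    rw [← h s t]
    generalize x = z
    induction z using TensorProduct.induction_on with
    | zero => simp
    | add x y hx hy =>
      simp only [LinearMap.map_add, LinearEquiv.map_add, LinearMap.add_apply, hx, hy]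
    | tmul m n => simp [mul_comm]
  obtain ⟨c, rfl⟩ := TensorProduct.eq_repr_basis_left (Module.Basis.ofVectorSpace k M) (x := x)
  suffices c = 0 by simp [this]
  ext i
  refine hβ _ fun t => ?_
  have h2 := h1 t
  have h3 : TensorProduct.rid k M ((β.flip t).lTensor M
      (c.sum fun i n => (Module.Basis.ofVectorSpace k M) i ⊗ₜ[k] n)) =
      c.sum fun i n => β n t • Module.Basis.ofVectorSpace k M i := by
    rw [Finsupp.sum, map_sum, map_sum]
    exact Finset.sum_congr rfl fun i _ => by simp
  rw [h3] at h2
  by_cases hi : i ∈ c.support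
  · exact linearIndependent_iff'.1 (Module.Basis.ofVectorSpace k M).linearIndependent
      c.support (fun i => β (c i) t) h2 i hi
  · simp [Finsupp.notMem_support_iff.1 hi]

lemma separatingLeft_liftQ_ker (α : M →ₗ[k] X →ₗ[k] k) :
    ((LinearMap.ker α).liftQ α le_rfl).SeparatingLeft := by
  intro m hm
  obtain ⟨m, rfl⟩ := Submodule.mkQ_surjective _ m
  rw [Submodule.mkQ_apply, Submodule.Quotient.mk_eq_zero, LinearMap.mem_ker]
  ext s
  exact hm s

/-- A tensor which is orthogonal to all `s ⊗ t` lies in `ker α ⊗ N + M ⊗ ker β`. -/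
lemma mem_sup_of_forall_pairing_eq_zero (α : M →ₗ[k] X →ₗ[k] k) (β : N →ₗ[k] Y →ₗ[k] k)
    (x : M ⊗[k] N)
    (h : ∀ s t, LinearMap.mul' k k (TensorProduct.map (α.flip s) (β.flip t) x) = 0) :
    x ∈ LinearMap.range ((LinearMap.ker α).subtype.rTensor N) ⊔
      LinearMap.range ((LinearMap.ker β).subtype.lTensor M) := by
  have hk := TensorProduct.map_ker (f := (LinearMap.ker α).subtype) (g := (LinearMap.ker α).mkQ)
    (LinearMap.exact_subtype_mkQ _) (Submodule.mkQ_surjective _)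
    (f' := (LinearMap.ker β).subtype) (g' := (LinearMap.ker β).mkQ)
    (LinearMap.exact_subtype_mkQ _) (Submodule.mkQ_surjective _)
  rw [sup_comm, ← hk, LinearMap.mem_ker]
  refine eq_zero_of_forall_pairing_eq_zero (separatingLeft_liftQ_ker α)
    (separatingLeft_liftQ_ker β) _ fun s t => ?_
  rw [← h s t]
  generalize x = z
  induction z using TensorProduct.induction_on with
  | zero => simp
  | add x y hx hy => simp only [LinearMap.map_add, hx, hy]
  | tmul m n => simp

/-- The case of a form without left radical in the first factor. -/
lemma mem_range_lTensor_of_forall_pairing_eq_zero {α : M →ₗ[k] X →ₗ[k] k}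
    (hα : α.SeparatingLeft) (β : N →ₗ[k] Y →ₗ[k] k) (x : M ⊗[k] N)
    (h : ∀ s t, LinearMap.mul' k k (TensorProduct.map (α.flip s) (β.flip t) x) = 0) :
    x ∈ LinearMap.range ((LinearMap.ker β).subtype.lTensor M) := by
  have h1 := mem_sup_of_forall_pairing_eq_zero α β x h
  have h2 : LinearMap.range ((LinearMap.ker α).subtype.rTensor N) = ⊥ := by
    have : (LinearMap.ker α).subtype = 0 := by
      ext ⟨m, hm⟩
      exact hα m fun y => by rw [LinearMap.mem_ker.1 hm]; rfl
    rw [this, LinearMap.rTensor_zero, LinearMap.range_zero]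
  rwa [h2, bot_sup_eq] at h1

lemma eq_zero_or_of_tmul_eq_zero (m : M) (n : N) (h : m ⊗ₜ[k] n = 0) : m = 0 ∨ n = 0 := by
  by_contra! hc
  refine hc.2 ((Module.forall_dual_apply_eq_zero_iff k n).1 fun φ => ?_)
  have h1 : TensorProduct.rid k M (φ.lTensor M (m ⊗ₜ[k] n)) = 0 := by rw [h]; simp
  simpa [hc.1] using h1

/-- If a form is a product of two non-zero forms, then it is non-degenerate if and only if both
factors are. -/
lemma nondegenerate_iff_of_tensor {B H : Type*} [AddCommGroup B] [Module k B] [AddCommGroup H]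
    [Module k H] {τ : B →ₗ[k] H →ₗ[k] k} {α : M →ₗ[k] X →ₗ[k] k} {β : N →ₗ[k] Y →ₗ[k] k}
    (e : M ⊗[k] N ≃ₗ[k] B) (η : X ⊗[k] Y ≃ₗ[k] H)
    (hτ : ∀ m n x y, τ (e (m ⊗ₜ n)) (η (x ⊗ₜ y)) = α m x * β n y)
    {m₀ : M} {x₀ : X} {n₀ : N} {y₀ : Y}
    (hm : α m₀ x₀ ≠ 0) (hn : β n₀ y₀ ≠ 0) :
    τ.Nondegenerate ↔ α.Nondegenerate ∧ β.Nondegenerate := by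
  have hL : ∀ z x y, τ (e z) (η (x ⊗ₜ y)) =
      LinearMap.mul' k k (TensorProduct.map (α.flip x) (β.flip y) z) := by
    intro z x y
    induction z using TensorProduct.induction_on with
    | zero => simp
    | add u v hu hv =>
      simp only [LinearMap.map_add, LinearEquiv.map_add, LinearMap.add_apply, hu, hv]
    | tmul m n => simp [hτ]
  have hR : ∀ z m n, τ (e (m ⊗ₜ n)) (η z) =
      LinearMap.mul' k k (TensorProduct.map (α m) (β n) z) := by
    intro z m n
    induction z using TensorProduct.induction_on with
    | zero => simp
    | add u v hu hv => simp only [LinearMap.map_add, LinearEquiv.map_add, hu, hv]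
    | tmul x y => simp [hτ]
  have hm0 : m₀ ≠ 0 := by rintro rfl; simp at hm
  have hx0 : x₀ ≠ 0 := by rintro rfl; simp at hm
  have hn0 : n₀ ≠ 0 := by rintro rfl; simp at hn
  have hy0 : y₀ ≠ 0 := by rintro rfl; simp at hn
  constructor
  · rintro ⟨h1, h2⟩
    refine ⟨⟨fun m h => ?_, fun x h => ?_⟩, ⟨fun n h => ?_, fun y h => ?_⟩⟩
    · refine (eq_zero_or_of_tmul_eq_zero m n₀
        (e.map_eq_zero_iff.1 (h1 _ fun y => ?_))).resolve_right hn0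
      obtain ⟨z, rfl⟩ := η.surjective y
      rw [hR, show α m = 0 from LinearMap.ext h]; simp
    · refine (eq_zero_or_of_tmul_eq_zero x y₀
        (η.map_eq_zero_iff.1 (h2 _ fun y => ?_))).resolve_right hy0
      obtain ⟨z, rfl⟩ := e.surjective y
      rw [hL, show α.flip x = 0 from LinearMap.ext h]; simp
    · refine (eq_zero_or_of_tmul_eq_zero m₀ n
        (e.map_eq_zero_iff.1 (h1 _ fun y => ?_))).resolve_left hm0
      obtain ⟨z, rfl⟩ := η.surjective y
      rw [hR, show β n = 0 from LinearMap.ext h]; simp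
    · refine (eq_zero_or_of_tmul_eq_zero x₀ y
        (η.map_eq_zero_iff.1 (h2 _ fun y => ?_))).resolve_left hx0
      obtain ⟨z, rfl⟩ := e.surjective y
      rw [hL, show β.flip y = 0 from LinearMap.ext h]; simp
  · rintro ⟨⟨h1, h2⟩, ⟨h3, h4⟩⟩
    refine ⟨fun b h => ?_, fun b h => ?_⟩
    · obtain ⟨z, rfl⟩ := e.surjective b
      rw [eq_zero_of_forall_pairing_eq_zero h1 h3 z fun x y => by rw [← hL, h],
        LinearEquiv.map_zero]
    · obtain ⟨z, rfl⟩ := η.surjective b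
      rw [eq_zero_of_forall_pairing_eq_zero (α := α.flip) (β := β.flip)
        (LinearMap.flip_separatingLeft.2 h2) (LinearMap.flip_separatingLeft.2 h4) z
        fun x y => by rw [LinearMap.flip_flip, LinearMap.flip_flip, ← hR, h], LinearEquiv.map_zero]

end Bilinear

/-! ### Convolution inverses and filtrations -/

section Convolution

open WithConv

variable {k C A : Type*} [Field k] [AddCommGroup C] [Module k C] [Coalgebra k C] [Ring A]
  [Algebra k A]

/-- A map which vanishes on the bottom step of a coalgebra filtration is locally nilpotent for the
convolution product. -/
lemma convPow_eq_zero {F : ℕ → Submodule k C}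
    (hF : ∀ n, ∀ c ∈ F n, Coalgebra.comul (R := k) c ∈
      ⨆ p : {p : ℕ × ℕ // p.1 + p.2 = n},
        Submodule.map₂ (TensorProduct.mk k C C) (F p.1.1) (F p.1.2))
    {N : WithConv (C →ₗ[k] A)} (hN : ∀ c ∈ F 0, N.ofConv c = 0) :
    ∀ m n, n < m → ∀ c ∈ F n, (N ^ m).ofConv c = 0 := by
  intro m
  induction m with
  | zero => intro n h; omega
  | succ m ih =>
    intro n hn c hc
    rw [pow_succ', LinearMap.convMul_def]
    suffices h : (⨆ p : {p : ℕ × ℕ // p.1 + p.2 = n},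
        Submodule.map₂ (TensorProduct.mk k C C) (F p.1.1) (F p.1.2)) ≤
        LinearMap.ker (LinearMap.mul' k A ∘ₗ TensorProduct.map N.ofConv (N ^ m).ofConv) from
      h (hF n c hc)
    refine iSup_le ?_
    rintro ⟨⟨i, j⟩, hij⟩
    rw [Submodule.map₂_le]
    intro x hx y hy
    simp only [LinearMap.mem_ker, LinearMap.comp_apply, TensorProduct.mk_apply,
      TensorProduct.map_tmul, LinearMap.mul'_apply]
    rcases Nat.eq_zero_or_pos i with rfl | hi
    · rw [hN x hx, zero_mul]
    · rw [ih j (by simp only at hij; omega) y hy, mul_zero]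

/-- A locally nilpotent `N` has a geometric series `∑ Nⁿ`, inverse to `1 - N`. -/
lemma isUnit_one_sub_of_locally_nilpotent {N : WithConv (C →ₗ[k] A)}
    (hN : ∀ c, ∃ m, ∀ n, m ≤ n → (N ^ n).ofConv c = 0) : IsUnit (1 - N) := by
  have hfin : ∀ c, (Function.support fun n => (N ^ n).ofConv c).Finite := by
    intro c
    obtain ⟨m, hm⟩ := hN c
    refine (Set.finite_Iio m).subset fun n hn => ?_
    by_contra h
    exact hn (hm n (not_lt.1 h))
  -- By `hfin` the sum is finite for every `c`, so `∑ᶠ` does not take its junk value.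
  let G : C →ₗ[k] A :=
    { toFun := fun c => ∑ᶠ n, (N ^ n).ofConv c
      map_add' := fun c d => by
        rw [← finsum_add_distrib (hfin c) (hfin d)]
        simp
      map_smul' := fun r c => by
        simp only [LinearMap.map_smul, RingHom.id_apply]
        rw [smul_finsum] }
  have hG : ∀ c m, (∀ n, m ≤ n → (N ^ n).ofConv c = 0) →
      G c = (∑ n ∈ Finset.range m, N ^ n).ofConv c := by
    intro c m hm
    rw [ofConv_sum, LinearMap.sum_apply]
    refine finsum_eq_sum_of_support_subset _ fun n hn => ?_
    rw [Finset.coe_range, Set.mem_Iio]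
    by_contra h
    exact hn (hm n (not_lt.1 h))
  have hfilter : ∀ (φ : C →ₗ[k] A) (x : C ⊗[k] C), ∃ m, ∀ n, m ≤ n →
      TensorProduct.map φ G x =
        TensorProduct.map φ (∑ i ∈ Finset.range n, N ^ i).ofConv x ∧
      TensorProduct.map G φ x =
        TensorProduct.map (∑ i ∈ Finset.range n, N ^ i).ofConv φ x := by
    intro φ x
    induction x using TensorProduct.induction_on with
    | zero => exact ⟨0, by simp⟩
    | add x y hx hy =>
      obtain ⟨m, hm⟩ := hx
      obtain ⟨m', hm'⟩ := hy
      refine ⟨max m m', fun n hn => ?_⟩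
      have h1 := hm n (le_trans (le_max_left _ _) hn)
      have h2 := hm' n (le_trans (le_max_right _ _) hn)
      rw [LinearMap.map_add, LinearMap.map_add, LinearMap.map_add, LinearMap.map_add,
        h1.1, h1.2, h2.1, h2.2]
      exact ⟨rfl, rfl⟩
    | tmul x y =>
      obtain ⟨m, hm⟩ := hN x
      obtain ⟨m', hm'⟩ := hN y
      refine ⟨max m m', fun n hn => ?_⟩
      simp only [TensorProduct.map_tmul,
        hG x n fun i hi => hm i ((le_max_left _ _).trans (hn.trans hi)),
        hG y n fun i hi => hm' i ((le_max_right _ _).trans (hn.trans hi)), and_self]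
  refine ⟨⟨1 - N, toConv G, ?_, ?_⟩, rfl⟩
  all_goals
    ext c
    obtain ⟨m, hm⟩ := hfilter (1 - N).ofConv (Coalgebra.comul c)
    obtain ⟨m', hm'⟩ := hN c
  · have h1 : ((1 - N) * toConv G).ofConv c =
        ((1 - N) * ∑ i ∈ Finset.range (max m m'), N ^ i).ofConv c := by
      simp only [LinearMap.convMul_def, LinearMap.comp_apply, ofConv_toConv]
      rw [(hm _ (le_max_left _ _)).1]
    rw [h1, mul_neg_geom_sum, ofConv_sub, LinearMap.sub_apply, hm' _ (le_max_right _ _), sub_zero]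
  · have h1 : (toConv G * (1 - N)).ofConv c =
        ((∑ i ∈ Finset.range (max m m'), N ^ i) * (1 - N)).ofConv c := by
      simp only [LinearMap.convMul_def, LinearMap.comp_apply, ofConv_toConv]
      rw [(hm _ (le_max_left _ _)).2]
    rw [h1, geom_sum_mul_neg, ofConv_sub, LinearMap.sub_apply, hm' _ (le_max_right _ _), sub_zero]

/-- Takeuchi's criterion: a map is convolution invertible as soon as it is so on the bottom
step of an exhaustive coalgebra filtration. -/
lemma exists_conv_inverse {F : ℕ → Submodule k C}
    (hF : ∀ n, ∀ c ∈ F n, Coalgebra.comul (R := k) c ∈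
      ⨆ p : {p : ℕ × ℕ // p.1 + p.2 = n},
        Submodule.map₂ (TensorProduct.mk k C C) (F p.1.1) (F p.1.2))
    (htop : ⨆ n, F n = ⊤) (f g : WithConv (C →ₗ[k] A))
    (hfg : ∀ c ∈ F 0, (f * g).ofConv c = algebraMap k A (Coalgebra.counit c))
    (hgf : ∀ c ∈ F 0, (g * f).ofConv c = algebraMap k A (Coalgebra.counit c)) :
    ∃ h, f * h = 1 ∧ h * f = 1 := by
  have key : ∀ u : WithConv (C →ₗ[k] A),
      (∀ c ∈ F 0, u.ofConv c = algebraMap k A (Coalgebra.counit c)) → IsUnit u := by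
    intro u hu
    rw [← sub_sub_cancel 1 u]
    have hN0 : ∀ c ∈ F 0, (1 - u).ofConv c = 0 := fun c hc => by
      rw [ofConv_sub, LinearMap.sub_apply, hu c hc, LinearMap.convOne_apply, sub_self]
    refine isUnit_one_sub_of_locally_nilpotent fun c => ?_
    have hc : c ∈ ⨆ n, F n := htop ▸ Submodule.mem_top
    induction hc using Submodule.iSup_induction' with
    | mem i x hx => exact ⟨i + 1, fun n hn => convPow_eq_zero hF hN0 n i hn x hx⟩
    | zero => exact ⟨0, by simp⟩
    | add x y _ _ hx hy =>
      obtain ⟨m, hm⟩ := hx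
      obtain ⟨m', hm'⟩ := hy
      refine ⟨max m m', fun n hn => ?_⟩
      rw [LinearMap.map_add, hm n (le_trans (le_max_left _ _) hn),
        hm' n (le_trans (le_max_right _ _) hn), add_zero]
  obtain ⟨u, hu⟩ := key _ hfg
  obtain ⟨v, hv⟩ := key _ hgf
  have h1 : f * (g * u⁻¹.val) = 1 := by rw [← mul_assoc, ← hu, Units.mul_inv]
  have h2 : (v⁻¹.val * g) * f = 1 := by rw [mul_assoc, ← hv, Units.inv_mul]
  refine ⟨g * u⁻¹.val, h1, ?_⟩
  rw [← left_inv_eq_right_inv h2 h1]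
  exact h2

end Convolution

/-! ### The antipode and its composite-inverse -/

section Antipode

open WithConv Coalgebra

variable {k A : Type*} [Field k] [Ring A] [HopfAlgebra k A]

/-- A bialgebra map of Hopf algebras respects the antipodes. -/
lemma map_antipode_of_comul {A' : Type*} [Ring A'] [HopfAlgebra k A'] (f : A →ₐ[k] A')
    (hΔ : ∀ a, comul (R := k) (f a) = TensorProduct.map f.toLinearMap f.toLinearMap (comul a))
    (hε : ∀ a, counit (R := k) (f a) = counit (R := k) a) (a : A) :
    f (HopfAlgebra.antipode k a) = HopfAlgebra.antipode k (f a) := by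
  have h1 : toConv (f.toLinearMap ∘ₗ HopfAlgebra.antipode k) * toConv f.toLinearMap = 1 := by
    ext a
    simp only [LinearMap.convMul_def, LinearMap.comp_apply, ofConv_toConv]
    have : ∀ X : A ⊗[k] A, LinearMap.mul' k A' (TensorProduct.map
        (f.toLinearMap ∘ₗ HopfAlgebra.antipode k) f.toLinearMap X) =
        f (LinearMap.mul' k A ((HopfAlgebra.antipode k).rTensor A X)) := by
      intro X
      induction X using TensorProduct.induction_on with
      | zero => simp
      | add x y hx hy => simp only [LinearMap.map_add, alg_add, hx, hy]
      | tmul x y => simp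
    rw [this, HopfAlgebra.mul_antipode_rTensor_comul_apply, LinearMap.convOne_apply]
    simp
  have h2 : toConv f.toLinearMap * toConv (HopfAlgebra.antipode k ∘ₗ f.toLinearMap) = 1 := by
    ext a
    simp only [LinearMap.convMul_def, LinearMap.comp_apply, ofConv_toConv]
    have : ∀ X : A ⊗[k] A, LinearMap.mul' k A' (TensorProduct.map
        f.toLinearMap (HopfAlgebra.antipode k ∘ₗ f.toLinearMap) X) =
        LinearMap.mul' k A' ((HopfAlgebra.antipode k).lTensor A'
          (TensorProduct.map f.toLinearMap f.toLinearMap X)) := by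
      intro X
      induction X using TensorProduct.induction_on with
      | zero => simp
      | add x y hx hy => simp only [LinearMap.map_add, hx, hy]
      | tmul x y => simp
    rw [this, ← hΔ, HopfAlgebra.mul_antipode_lTensor_comul_apply, LinearMap.convOne_apply, hε]
  exact LinearMap.congr_fun (congrArg WithConv.ofConv (left_inv_eq_right_inv h1 h2)) a

variable {T : A →ₗ[k] A}

lemma comp_antipode_apply (hT : T ∘ₗ HopfAlgebra.antipode k = LinearMap.id) (a : A) :
    T (HopfAlgebra.antipode k a) = a := LinearMap.congr_fun hT a

lemma antipode_comp_apply (hT : HopfAlgebra.antipode k ∘ₗ T = LinearMap.id) (a : A) :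
    HopfAlgebra.antipode k (T a) = a := LinearMap.congr_fun hT a

lemma antipodeInv_mul (hT : T ∘ₗ HopfAlgebra.antipode k = LinearMap.id)
    (hT' : HopfAlgebra.antipode k ∘ₗ T = LinearMap.id) (a b : A) : T (a * b) = T b * T a := by
  rw [← comp_antipode_apply hT (T b * T a), HopfAlgebra.antipode_mul_antidistrib,
    antipode_comp_apply hT', antipode_comp_apply hT']

lemma antipodeInv_one (hT : T ∘ₗ HopfAlgebra.antipode k = LinearMap.id) : T 1 = 1 := by
  conv_lhs => rw [← HopfAlgebra.antipode_one (R := k) (A := A)]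
  exact comp_antipode_apply hT 1

lemma comul_antipodeInv (hT : T ∘ₗ HopfAlgebra.antipode k = LinearMap.id)
    (hT' : HopfAlgebra.antipode k ∘ₗ T = LinearMap.id) (a : A) :
    comul (R := k) (T a) = TensorProduct.map T T (TensorProduct.comm k A A (comul (R := k) a)) := by
  conv_rhs => rw [← antipode_comp_apply hT' a, comul_antipode]
  generalize comul (R := k) (T a) = X
  induction X using TensorProduct.induction_on with
  | zero => simp
  | add x y hx hy => simp only [LinearMap.map_add, LinearEquiv.map_add, ← hx, ← hy]
  | tmul x y => simp [comp_antipode_apply hT]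

/-- `∑ a₂ S⁻¹(a₁) = ε(a)`. -/
lemma mul_antipodeInv (hT : T ∘ₗ HopfAlgebra.antipode k = LinearMap.id)
    (hT' : HopfAlgebra.antipode k ∘ₗ T = LinearMap.id) (a : A) :
    LinearMap.mul' k A (T.lTensor A (TensorProduct.comm k A A (comul a))) =
      algebraMap k A (counit a) := by
  rw [← comp_antipode_apply hT (LinearMap.mul' k A _), ← comp_antipode_apply hT (algebraMap k A _)]
  congr 1
  have h : ∀ X : A ⊗[k] A, HopfAlgebra.antipode k
      (LinearMap.mul' k A (T.lTensor A (TensorProduct.comm k A A X))) =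
      LinearMap.mul' k A ((HopfAlgebra.antipode k).lTensor A X) := by
    intro X
    induction X using TensorProduct.induction_on with
    | zero => simp
    | add x y hx hy => simp only [LinearMap.map_add, LinearEquiv.map_add, hx, hy]
    | tmul x y => simp [HopfAlgebra.antipode_mul_antidistrib, antipode_comp_apply hT']
  rw [h, HopfAlgebra.mul_antipode_lTensor_comul_apply]
  simp [Algebra.algebraMap_eq_smul_one]

/-- `∑ S⁻¹(a₂) a₁ = ε(a)`. -/
lemma antipodeInv_mul_comul (hT : T ∘ₗ HopfAlgebra.antipode k = LinearMap.id)
    (hT' : HopfAlgebra.antipode k ∘ₗ T = LinearMap.id) (a : A) :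
    LinearMap.mul' k A (T.rTensor A (TensorProduct.comm k A A (comul a))) =
      algebraMap k A (counit a) := by
  rw [← comp_antipode_apply hT (LinearMap.mul' k A _), ← comp_antipode_apply hT (algebraMap k A _)]
  congr 1
  have h : ∀ X : A ⊗[k] A, HopfAlgebra.antipode k
      (LinearMap.mul' k A (T.rTensor A (TensorProduct.comm k A A X))) =
      LinearMap.mul' k A ((HopfAlgebra.antipode k).rTensor A X) := by
    intro X
    induction X using TensorProduct.induction_on with
    | zero => simp
    | add x y hx hy => simp only [LinearMap.map_add, LinearEquiv.map_add, hx, hy]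
    | tmul x y => simp [HopfAlgebra.antipode_mul_antidistrib, antipode_comp_apply hT']
  rw [h, HopfAlgebra.mul_antipode_rTensor_comul_apply]
  simp [Algebra.algebraMap_eq_smul_one]

/-- A bijective antipode has a linear composite-inverse. -/
lemma exists_antipodeInv
    (h : Function.Bijective (HopfAlgebra.antipode k : A →ₗ[k] A)) :
    ∃ T : A →ₗ[k] A, T ∘ₗ HopfAlgebra.antipode k = LinearMap.id ∧
      HopfAlgebra.antipode k ∘ₗ T = LinearMap.id := by
  let e := LinearEquiv.ofBijective _ h
  refine ⟨e.symm.toLinearMap, ?_, ?_⟩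
  · ext a; exact e.symm_apply_apply a
  · ext a; exact e.apply_symm_apply a

/-- The identity, regarded as an element of the convolution algebra of linear maps from `A` to the
opposite algebra. -/
noncomputable def opConv (k A : Type*) [Field k] [Ring A] [HopfAlgebra k A] :
    WithConv (A →ₗ[k] Aᵐᵒᵖ) := toConv (MulOpposite.opLinearEquiv k).toLinearMap

lemma convMul_op_apply (f g : A →ₗ[k] A) (a : A) :
    MulOpposite.unop ((toConv ((MulOpposite.opLinearEquiv k).toLinearMap ∘ₗ f) *
      toConv ((MulOpposite.opLinearEquiv k).toLinearMap ∘ₗ g)).ofConv a) =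
    LinearMap.mul' k A (TensorProduct.map g f (TensorProduct.comm k A A (comul a))) := by
  simp only [LinearMap.convMul_def, LinearMap.comp_apply, ofConv_toConv]
  induction (comul a : A ⊗[k] A) using TensorProduct.induction_on with
  | zero => simp
  | add x y hx hy =>
    simp only [LinearMap.map_add, LinearEquiv.map_add, MulOpposite.unop_add, hx, hy]
  | tmul x y => simp

/-- A convolution inverse of the identity as a map `A → Aᵒᵖ` is a composite-inverse of the
antipode. -/
lemma exists_antipodeInv_of_conv {h : WithConv (A →ₗ[k] Aᵐᵒᵖ)} (h1 : opConv k A * h = 1)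
    (h2 : h * opConv k A = 1) :
    ∃ T : A →ₗ[k] A, T ∘ₗ HopfAlgebra.antipode k = LinearMap.id ∧
      HopfAlgebra.antipode k ∘ₗ T = LinearMap.id := by
  let T : A →ₗ[k] A := (MulOpposite.opLinearEquiv k).symm.toLinearMap ∘ₗ h.ofConv
  have hT : h = toConv ((MulOpposite.opLinearEquiv k).toLinearMap ∘ₗ T) := by
    ext a; simp [T]
  have hop : opConv k A = toConv ((MulOpposite.opLinearEquiv k).toLinearMap ∘ₗ LinearMap.id) := rfl
  have e1 : ∀ a, LinearMap.mul' k A (TensorProduct.map T LinearMap.id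
      (TensorProduct.comm k A A (comul a))) = algebraMap k A (counit a) := by
    intro a
    rw [← convMul_op_apply, ← hT, ← hop, h1, LinearMap.convOne_apply]
    simp
  have e2 : ∀ a, LinearMap.mul' k A (TensorProduct.map LinearMap.id T
      (TensorProduct.comm k A A (comul a))) = algebraMap k A (counit a) := by
    intro a
    rw [← convMul_op_apply, ← hT, ← hop, h2, LinearMap.convOne_apply]
    simp
  refine ⟨T, ?_, ?_⟩
  · have h3 : toConv (HopfAlgebra.antipode k (A := A)) * toConv (T ∘ₗ HopfAlgebra.antipode k) =
        1 := by
      ext a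
      have h4 := e2 (HopfAlgebra.antipode k a)
      rw [comul_antipode, HopfAlgebra.counit_antipode] at h4
      rw [LinearMap.convOne_apply, ← h4]
      simp only [LinearMap.convMul_def, LinearMap.comp_apply, ofConv_toConv]
      induction (comul a : A ⊗[k] A) using TensorProduct.induction_on with
      | zero => simp
      | add x y hx hy => simp only [LinearMap.map_add, LinearEquiv.map_add, hx, hy]
      | tmul x y => simp
    exact congrArg ofConv (left_inv_eq_right_inv LinearMap.id_mul_antipode h3).symm
  · have h3 : toConv (HopfAlgebra.antipode k (A := A)) * toConv (HopfAlgebra.antipode k ∘ₗ T) =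
        1 := by
      ext a
      have h4 := congrArg (HopfAlgebra.antipode k) (e1 a)
      rw [Algebra.algebraMap_eq_smul_one, map_smul, HopfAlgebra.antipode_one] at h4
      rw [LinearMap.convOne_apply, Algebra.algebraMap_eq_smul_one, ← h4]
      simp only [LinearMap.convMul_def, LinearMap.comp_apply, ofConv_toConv]
      induction (comul a : A ⊗[k] A) using TensorProduct.induction_on with
      | zero => simp
      | add x y hx hy => simp only [LinearMap.map_add, LinearEquiv.map_add, hx, hy]
      | tmul x y => simp [HopfAlgebra.antipode_mul_antidistrib]
    exact congrArg ofConv (left_inv_eq_right_inv LinearMap.id_mul_antipode h3).symm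

end Antipode

/-! ### The projection of the bosonization -/

namespace BraidedHopfAlgebra

variable {k J R : Type*} [Field k] [Ring J] [HopfAlgebra k J] [Ring R] [Algebra k R]
  [Coalgebra k R] (H : BraidedHopfAlgebra k J R)

/-- The projection `R # J → J`, `r # a ↦ ε(r) a`, a bialgebra map which splits the inclusion of
`J`. -/
noncomputable def projJ : H.Bosonization →ₐ[k] J :=
  TwistedTensor.lift H.smash ((Algebra.ofId k J).comp H.counitR) (AlgHom.id k J) <| by
    intro r a
    rw [TwistedTensor.braid_eq_T]
    change _ = LinearMap.mul' k _ (TensorProduct.map _ _ (H.smash.T 1 r 1 (Coalgebra.comul a)))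
    have h : ∀ X : J ⊗[k] J, LinearMap.mul' k J (TensorProduct.map
        ((Algebra.ofId k J).comp H.counitR).toLinearMap (AlgHom.id k J).toLinearMap
        (H.smash.T 1 r 1 X)) =
        Coalgebra.counit (R := k) r • TensorProduct.lid k J (Coalgebra.counit.rTensor J X) := by
      intro X
      induction X using TensorProduct.induction_on with
      | zero => simp
      | add x y hx hy => simp only [LinearMap.map_add, LinearEquiv.map_add, smul_add, hx, hy]
      | tmul x y =>
        have := H.counit_act x r
        simp [SmashData.T_tmul, counitR, smash, this, Algebra.ofId_apply,
          Algebra.algebraMap_eq_smul_one, smul_smul, mul_comm]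
    rw [h]
    simp [counitR, Algebra.ofId_apply, Algebra.algebraMap_eq_smul_one]

lemma projJ_inR (r : R) : H.projJ (H.inR r) = algebraMap k J (Coalgebra.counit r) :=
  TwistedTensor.lift_inl ..

lemma projJ_inJ (a : J) : H.projJ (H.inJ a) = a := TwistedTensor.lift_inr ..

/-- The coproducts of `R` and of `R # J` agree up to the coaction of the right tensor factor,
which a map `f` invariant under right multiplication by `J` does not see. -/
lemma map_inR_mul_inJ_right {M N : Type*} [AddCommGroup M] [Module k M] [AddCommGroup N]
    [Module k N] (f : H.Bosonization →ₗ[k] M) (g : H.Bosonization →ₗ[k] N)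
    (hf : ∀ b a, f (b * H.inJ a) = Coalgebra.counit (R := k) a • f b) (r : R) :
    TensorProduct.map f g (Coalgebra.comul (H.inR r)) =
      TensorProduct.map (f ∘ₗ H.inR.toLinearMap) (g ∘ₗ H.inR.toLinearMap) (Coalgebra.comul r) := by
  rw [comul_inR, comulR_eq_phi]
  induction (Coalgebra.comul r : R ⊗[k] R) using TensorProduct.induction_on with
  | zero => simp
  | add x y hx hy => simp only [LinearMap.map_add, LinearEquiv.map_add, alg_add, hx, hy]
  | tmul x y =>
    rw [phi_tmul, rho_apply]
    have h : ∀ X : J ⊗[k] R, TensorProduct.map f g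
        ((H.inR x ⊗ₜ 1) * Algebra.TensorProduct.map H.inJ H.inR X) =
        f (H.inR x) ⊗ₜ g (H.inR (TensorProduct.lid k R (Coalgebra.counit.rTensor R X))) := by
      intro X
      induction X using TensorProduct.induction_on with
      | zero => simp
      | add x y hx hy =>
        simp only [LinearMap.map_add, LinearEquiv.map_add, alg_add, mul_add, tmul_add, hx, hy]
      | tmul a z => simp [hf, TensorProduct.smul_tmul']
    rw [h, H.counit_coact]
    rfl

/-- `R` consists of coinvariants: `∑ r₁ ⊗ π(r₂) = r ⊗ 1`. -/
lemma map_projJ_right {M N : Type*} [AddCommGroup M] [Module k M] [AddCommGroup N]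
    [Module k N] (f : H.Bosonization →ₗ[k] M) (g : J →ₗ[k] N) (r : R) :
    TensorProduct.map f (g ∘ₗ H.projJ.toLinearMap) (Coalgebra.comul (H.inR r)) =
      f (H.inR r) ⊗ₜ g 1 := by
  rw [comul_inR, comulR_eq_phi]
  have h1 : ∀ X : R ⊗[k] R, TensorProduct.map f (g ∘ₗ H.projJ.toLinearMap)
      (H.phi (TwistedTensor.ofTensor H.braidedSquare X)) =
      f (H.inR (TensorProduct.rid k R (Coalgebra.counit.lTensor R X))) ⊗ₜ g 1 := by
    intro X
    induction X using TensorProduct.induction_on with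
    | zero => simp
    | add x y hx hy =>
      simp only [LinearMap.map_add, LinearEquiv.map_add, alg_add, add_tmul, hx, hy]
    | tmul x y =>
      rw [phi_tmul, rho_apply]
      have h : ∀ X : J ⊗[k] R, TensorProduct.map f (g ∘ₗ H.projJ.toLinearMap)
          ((H.inR x ⊗ₜ 1) * Algebra.TensorProduct.map H.inJ H.inR X) =
          f (H.inR x * H.inJ (TensorProduct.rid k J (Coalgebra.counit.lTensor J X))) ⊗ₜ g 1 := by
        intro X
        induction X using TensorProduct.induction_on with
        | zero => simp
        | add x y hx hy =>
          simp only [LinearMap.map_add, LinearEquiv.map_add, alg_add, mul_add, add_tmul, hx, hy]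
        | tmul a z =>
          simp [projJ_inR, Algebra.algebraMap_eq_smul_one, TensorProduct.smul_tmul]
      rw [h, H.coact_counit]
      simp [Algebra.algebraMap_eq_smul_one]
  rw [h1]
  simp

/-- `∑ π(r₁) ⊗ r₂` is the coaction on `R`. -/
lemma map_projJ_left {M N : Type*} [AddCommGroup M] [Module k M] [AddCommGroup N]
    [Module k N] (f : J →ₗ[k] M) (g : H.Bosonization →ₗ[k] N) (r : R) :
    TensorProduct.map (f ∘ₗ H.projJ.toLinearMap) g (Coalgebra.comul (H.inR r)) =
      TensorProduct.map f (g ∘ₗ H.inR.toLinearMap) (H.coact r) := by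
  rw [comul_inR, comulR_eq_phi]
  have h1 : ∀ X : R ⊗[k] R, TensorProduct.map (f ∘ₗ H.projJ.toLinearMap) g
      (H.phi (TwistedTensor.ofTensor H.braidedSquare X)) =
      TensorProduct.map f (g ∘ₗ H.inR.toLinearMap)
        (H.coact (TensorProduct.lid k R (Coalgebra.counit.rTensor R X))) := by
    intro X
    induction X using TensorProduct.induction_on with
    | zero => simp
    | add x y hx hy => simp only [LinearMap.map_add, LinearEquiv.map_add, alg_add, hx, hy]
    | tmul x y =>
      rw [phi_tmul, rho_apply]
      simp only [LinearMap.rTensor_tmul, TensorProduct.lid_tmul, map_smul]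
      generalize H.coact y = X
      induction X using TensorProduct.induction_on with
      | zero => simp
      | add x y hx hy => simp only [LinearMap.map_add, alg_add, mul_add, smul_add, hx, hy]
      | tmul a z =>
        simp [projJ_inR, projJ_inJ, Algebra.algebraMap_eq_smul_one, TensorProduct.smul_tmul']
  rw [h1]
  simp

lemma counit_projJ (b : H.Bosonization) :
    Coalgebra.counit (R := k) (H.projJ b) = Coalgebra.counit (R := k) b := by
  have h : (Bialgebra.counitAlgHom k J).comp H.projJ = H.bosCounit := by
    apply TwistedTensor.algHom_ext
    · intro r
      change Coalgebra.counit (H.projJ (H.inR r)) = H.bosCounit (H.inR r)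
      rw [projJ_inR, bosCounit_inR]
      simp
    · intro a
      change Coalgebra.counit (H.projJ (H.inJ a)) = H.bosCounit (H.inJ a)
      rw [projJ_inJ, bosCounit_inJ]
  exact AlgHom.congr_fun h b

lemma comul_projJ (b : H.Bosonization) : Coalgebra.comul (R := k) (H.projJ b) =
    TensorProduct.map H.projJ.toLinearMap H.projJ.toLinearMap (Coalgebra.comul b) := by
  have h : (Bialgebra.comulAlgHom k J).comp H.projJ =
      (Algebra.TensorProduct.map H.projJ H.projJ).comp (Bialgebra.comulAlgHom k _) := by
    apply TwistedTensor.algHom_ext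
    · intro r
      change Coalgebra.comul (H.projJ (H.inR r)) = TensorProduct.map H.projJ.toLinearMap
        (LinearMap.id ∘ₗ H.projJ.toLinearMap) (Coalgebra.comul (H.inR r))
      rw [map_projJ_right, projJ_inR]
      simp [projJ_inR, Algebra.algebraMap_eq_smul_one, TensorProduct.smul_tmul',
        Algebra.TensorProduct.one_def]
    · intro a
      change Coalgebra.comul (H.projJ (H.inJ a)) = Algebra.TensorProduct.map H.projJ H.projJ
        (Coalgebra.comul (H.inJ a))
      rw [projJ_inJ, comul_inJ, comulJ_apply]
      induction (Coalgebra.comul a : J ⊗[k] J) using TensorProduct.induction_on with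
      | zero => simp
      | add x y hx hy => simp only [alg_add, ← hx, ← hy]
      | tmul x y => simp [projJ_inJ]
  exact AlgHom.congr_fun h b

lemma projJ_antipode (b : H.Bosonization) :
    H.projJ (HopfAlgebra.antipode k b) = HopfAlgebra.antipode k (H.projJ b) :=
  map_antipode_of_comul _ H.comul_projJ H.counit_projJ b

lemma comul_inJ_eq_map (a : J) : Coalgebra.comul (R := k) (H.inJ a) =
    TensorProduct.map H.inJ.toLinearMap H.inJ.toLinearMap (Coalgebra.comul a) := H.comul_inJ a

lemma antipode_inJ (a : J) : HopfAlgebra.antipode k (H.inJ a) = H.inJ (HopfAlgebra.antipode k a) :=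
  (map_antipode_of_comul _ H.comul_inJ_eq_map H.counit_inJ a).symm

lemma induction_tmul {p : H.Bosonization → Prop} (b : H.Bosonization) (h0 : p 0)
    (hadd : ∀ x y, p x → p y → p (x + y)) (hmul : ∀ r a, p (H.inR r * H.inJ a)) : p b := by
  obtain ⟨b, rfl⟩ := (TwistedTensor.ofTensor H.smash).surjective b
  induction b using TensorProduct.induction_on with
  | zero => simpa using h0
  | add x y hx hy => rw [LinearEquiv.map_add]; exact hadd _ _ hx hy
  | tmul r a => rw [← TwistedTensor.inl_mul_inr]; exact hmul r a

/-- The map `r ⊗ a ↦ ∑ f(a₁)(r) ⊗ a₂`. If `f` is the action of `J`, it expresses the product `a r`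
in `R # J` in terms of the decomposition `R ⊗ J`; if `f` is the action composed with the inverse of
the antipode, it is the inverse of that map. -/
noncomputable def shear (f : J →ₗ[k] R →ₗ[k] R) : R ⊗[k] J →ₗ[k] R ⊗[k] J :=
  (TensorProduct.lift f.flip).rTensor J ∘ₗ (TensorProduct.assoc k R J J).symm.toLinearMap ∘ₗ
    (Coalgebra.comul (R := k) (A := J)).lTensor R

omit [Coalgebra k R] in
lemma shear_shear (f g : J →ₗ[k] R →ₗ[k] R)
    (h : ∀ a r, TensorProduct.lift (f.flip ∘ₗ g.flip r) (Coalgebra.comul a) =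
      Coalgebra.counit (R := k) a • r) (x : R ⊗[k] J) : shear f (shear g x) = x := by
  induction x using TensorProduct.induction_on with
  | zero => simp
  | add x y hx hy => simp only [LinearMap.map_add, hx, hy]
  | tmul r a =>
    have h1 : ∀ X : J ⊗[k] J, shear f ((TensorProduct.lift g.flip).rTensor J
        ((TensorProduct.assoc k R J J).symm (r ⊗ₜ X))) =
        (TensorProduct.lift (f.flip ∘ₗ g.flip r)).rTensor J
          ((TensorProduct.assoc k J J J).symm (Coalgebra.comul.lTensor J X)) := by
      intro X
      induction X using TensorProduct.induction_on with
      | zero => simp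
      | add x y hx hy => simp only [LinearMap.map_add, LinearEquiv.map_add, tmul_add, hx, hy]
      | tmul b c =>
        simp only [TensorProduct.assoc_symm_tmul, LinearMap.rTensor_tmul, TensorProduct.lift.tmul,
          LinearMap.lTensor_tmul, shear, LinearMap.comp_apply, LinearEquiv.coe_coe]
        induction (Coalgebra.comul c : J ⊗[k] J) using TensorProduct.induction_on with
        | zero => simp
        | add x y hx hy => simp only [LinearMap.map_add, LinearEquiv.map_add, tmul_add, hx, hy]
        | tmul u v => simp
    have h2 : ∀ X : J ⊗[k] J, (TensorProduct.lift (f.flip ∘ₗ g.flip r)).rTensor J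
        (Coalgebra.comul.rTensor J X) =
        r ⊗ₜ TensorProduct.lid k J (Coalgebra.counit.rTensor J X) := by
      intro X
      induction X using TensorProduct.induction_on with
      | zero => simp
      | add x y hx hy => simp only [LinearMap.map_add, LinearEquiv.map_add, tmul_add, hx, hy]
      | tmul b c =>
        simp only [LinearMap.rTensor_tmul, h]
        simp [TensorProduct.smul_tmul]
    change shear f ((TensorProduct.lift g.flip).rTensor J
        ((TensorProduct.assoc k R J J).symm (r ⊗ₜ Coalgebra.comul a))) = _
    rw [h1, Coalgebra.coassoc_symm_apply, h2]
    simp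

lemma inJ_mul_inR_eq_shear (a : J) (r : R) : H.inJ a * H.inR r =
    TwistedTensor.ofTensor H.smash (shear H.act.toLinearMap (r ⊗ₜ a)) := by
  rw [inJ_mul_inR]
  simp only [shear, LinearMap.comp_apply, LinearMap.lTensor_tmul, LinearEquiv.coe_coe]
  induction (Coalgebra.comul a : J ⊗[k] J) using TensorProduct.induction_on with
  | zero => simp
  | add x y hx hy => simp only [LinearMap.map_add, LinearEquiv.map_add, tmul_add, hx, hy]
  | tmul x y => simp [TwistedTensor.inl_mul_inr]

/-- If the antipode of `J` is bijective, then `r ⊗ a ↦ a r` is bijective as well. -/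
lemma exists_equiv_inJ_mul_inR
    (hJ : Function.Bijective (HopfAlgebra.antipode k : J →ₗ[k] J)) :
    ∃ e : R ⊗[k] J ≃ₗ[k] H.Bosonization, ∀ r a, e (r ⊗ₜ a) = H.inJ a * H.inR r := by
  obtain ⟨T, hT, hT'⟩ := exists_antipodeInv hJ
  have h1 : ∀ (a : J) (r : R), TensorProduct.lift (H.act.toLinearMap.flip ∘ₗ
      (H.act.toLinearMap ∘ₗ T).flip r) (Coalgebra.comul a) = Coalgebra.counit (R := k) a • r := by
    intro a r
    have h : ∀ X : J ⊗[k] J, TensorProduct.lift (H.act.toLinearMap.flip ∘ₗ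
        (H.act.toLinearMap ∘ₗ T).flip r) X =
        H.act (LinearMap.mul' k J (T.lTensor J (TensorProduct.comm k J J X))) r := by
      intro X
      induction X using TensorProduct.induction_on with
      | zero => simp
      | add x y hx hy =>
        simp only [LinearMap.map_add, LinearEquiv.map_add, alg_add, LinearMap.add_apply, hx, hy]
      | tmul x y => simp
    rw [h, mul_antipodeInv hT hT']
    simp [Algebra.algebraMap_eq_smul_one]
  have h2 : ∀ (a : J) (r : R), TensorProduct.lift ((H.act.toLinearMap ∘ₗ T).flip ∘ₗ
      H.act.toLinearMap.flip r) (Coalgebra.comul a) = Coalgebra.counit (R := k) a • r := by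
    intro a r
    have h : ∀ X : J ⊗[k] J, TensorProduct.lift ((H.act.toLinearMap ∘ₗ T).flip ∘ₗ
        H.act.toLinearMap.flip r) X =
        H.act (LinearMap.mul' k J (T.rTensor J (TensorProduct.comm k J J X))) r := by
      intro X
      induction X using TensorProduct.induction_on with
      | zero => simp
      | add x y hx hy =>
        simp only [LinearMap.map_add, LinearEquiv.map_add, alg_add, LinearMap.add_apply, hx, hy]
      | tmul x y => simp
    rw [h, antipodeInv_mul_comul hT hT']
    simp [Algebra.algebraMap_eq_smul_one]
  refine ⟨LinearEquiv.ofLinearMap (shear H.act.toLinearMap) (shear (H.act.toLinearMap ∘ₗ T))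
    (LinearMap.ext fun x => shear_shear _ _ h1 x) (LinearMap.ext fun x => shear_shear _ _ h2 x) ≪≫ₗ
      TwistedTensor.ofTensor H.smash, fun r a => (H.inJ_mul_inR_eq_shear a r).symm⟩

/-- `∑ a₁ r S(a₂) = a ▷ r`, in the form `a r = ∑ (a₁ ▷ r) a₂`, paired with a map which is
invariant under right multiplication by `J`. -/
lemma apply_inJ_mul_inR {M : Type*} [AddCommGroup M] [Module k M] (f : H.Bosonization →ₗ[k] M)
    (hf : ∀ b a, f (b * H.inJ a) = Coalgebra.counit (R := k) a • f b) (a : J) (r : R) :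
    f (H.inJ a * H.inR r) = f (H.inR (H.act a r)) := by
  rw [inJ_mul_inR]
  have h : ∀ X : J ⊗[k] J, f (LinearMap.mul' k _ (TensorProduct.map
      (H.inR.toLinearMap ∘ₗ LinearMap.applyₗ r ∘ₗ H.act.toLinearMap) H.inJ.toLinearMap X)) =
      f (H.inR (H.act (TensorProduct.rid k J (Coalgebra.counit.lTensor J X)) r)) := by
    intro X
    induction X using TensorProduct.induction_on with
    | zero => simp
    | add x y hx hy =>
      simp only [LinearMap.map_add, LinearEquiv.map_add, alg_add, LinearMap.add_apply, hx, hy]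
    | tmul x y => simp [hf]
  rw [h]
  simp

/-- `a ▷ r = ∑ a₁ r S(a₂)` in the bosonization. -/
lemma inR_act (a : J) (r : R) : H.inR (H.act a r) = LinearMap.mul' k H.Bosonization
    (TensorProduct.map (LinearMap.mulRight k (H.inR r) ∘ₗ H.inJ.toLinearMap)
      (H.inJ.toLinearMap ∘ₗ HopfAlgebra.antipode k) (Coalgebra.comul a)) := by
  let W : J ⊗[k] (J ⊗[k] J) →ₗ[k] H.Bosonization := LinearMap.mul' k H.Bosonization ∘ₗ
    TensorProduct.map (H.inR.toLinearMap ∘ₗ LinearMap.applyₗ r ∘ₗ H.act.toLinearMap)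
      (H.inJ.toLinearMap ∘ₗ LinearMap.mul' k J ∘ₗ (HopfAlgebra.antipode k).lTensor J)
  have h1 : ∀ X : J ⊗[k] J, LinearMap.mul' k H.Bosonization
      (TensorProduct.map (LinearMap.mulRight k (H.inR r) ∘ₗ H.inJ.toLinearMap)
      (H.inJ.toLinearMap ∘ₗ HopfAlgebra.antipode k) X) =
      W (TensorProduct.assoc k J J J (Coalgebra.comul.rTensor J X)) := by
    intro X
    induction X using TensorProduct.induction_on with
    | zero => simp
    | add x y hx hy => simp only [LinearMap.map_add, LinearEquiv.map_add, hx, hy]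
    | tmul x y =>
      simp only [TensorProduct.map_tmul, LinearMap.mul'_apply, LinearMap.comp_apply,
        AlgHom.toLinearMap_apply, LinearMap.mulRight_apply, inJ_mul_inR, LinearMap.rTensor_tmul]
      induction (Coalgebra.comul x : J ⊗[k] J) using TensorProduct.induction_on with
      | zero => simp
      | add x y hx hy =>
        simp only [LinearMap.map_add, LinearEquiv.map_add, add_mul, add_tmul, hx, hy]
      | tmul u v => simp [W, mul_assoc]
  have h2 : ∀ X : J ⊗[k] J, W (Coalgebra.comul.lTensor J X) =
      H.inR (H.act (TensorProduct.rid k J (Coalgebra.counit.lTensor J X)) r) := by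
    intro X
    induction X using TensorProduct.induction_on with
    | zero => simp
    | add x y hx hy =>
      simp only [LinearMap.map_add, LinearEquiv.map_add, alg_add, LinearMap.add_apply, hx, hy]
    | tmul x y => simp [W, Algebra.algebraMap_eq_smul_one]
  rw [h1, Coalgebra.coassoc_apply, h2]
  simp

end BraidedHopfAlgebra

/-! ### Skew pairings of bosonizations -/

namespace BraidedHopfAlgebra

variable {k J R : Type*} [Field k] [Ring J] [HopfAlgebra k J] [Ring R] [Algebra k R]
  [Coalgebra k R] (H : BraidedHopfAlgebra k J R)

/-- If `f` is invariant under right multiplication by `J` and `g` factors through the projection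
to `J`, then the convolution product of `f` and `g` is `f ⊗ g` on `R ⊗ J`. -/
lemma conv_inR_mul_inJ (f g : H.Bosonization →ₗ[k] k)
    (hf : ∀ b a, f (b * H.inJ a) = Coalgebra.counit (R := k) a • f b)
    (hg : ∀ b, g b = g (H.inJ (H.projJ b))) (r : R) (a : J) :
    LinearMap.mul' k k (TensorProduct.map f g (Coalgebra.comul (H.inR r * H.inJ a))) =
      f (H.inR r) * g (H.inJ a) := by
  rw [Bialgebra.comul_mul, H.comul_inJ_eq_map]
  have h : ∀ X : J ⊗[k] J, LinearMap.mul' k k (TensorProduct.map f g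
      (Coalgebra.comul (H.inR r) * TensorProduct.map H.inJ.toLinearMap H.inJ.toLinearMap X)) =
      f (H.inR r) * g (H.inJ (TensorProduct.lid k J (Coalgebra.counit.rTensor J X))) := by
    intro X
    induction X using TensorProduct.induction_on with
    | zero => simp
    | add x y hx hy =>
      simp only [LinearMap.map_add, LinearEquiv.map_add, alg_add, mul_add, hx, hy]
    | tmul u v =>
      have h1 : ∀ Y : H.Bosonization ⊗[k] H.Bosonization, TensorProduct.map f g
          (Y * TensorProduct.map H.inJ.toLinearMap H.inJ.toLinearMap (u ⊗ₜ v)) =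
          Coalgebra.counit (R := k) u • TensorProduct.map f
            ((g ∘ₗ H.inJ.toLinearMap ∘ₗ LinearMap.mulRight k v) ∘ₗ H.projJ.toLinearMap) Y := by
        intro Y
        induction Y using TensorProduct.induction_on with
        | zero => simp
        | add x y hx hy => simp only [LinearMap.map_add, add_mul, smul_add, hx, hy]
        | tmul b c =>
          have : g (c * H.inJ v) = g (H.inJ (H.projJ c) * H.inJ v) := by
            rw [hg, map_mul, H.projJ_inJ, map_mul]
          simp [hf, this, TensorProduct.smul_tmul']
      rw [h1, map_projJ_right]
      simp [mul_left_comm]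
  rw [h]
  simp

lemma projJ_antipodeInv {TJ : J →ₗ[k] J}
    (hTJ : TJ ∘ₗ HopfAlgebra.antipode k = LinearMap.id)
    {T : H.Bosonization →ₗ[k] H.Bosonization}
    (hT' : HopfAlgebra.antipode k ∘ₗ T = LinearMap.id) (b : H.Bosonization) :
    H.projJ (T b) = TJ (H.projJ b) := by
  rw [← comp_antipode_apply hTJ (H.projJ (T b)), ← H.projJ_antipode, antipode_comp_apply hT']

end BraidedHopfAlgebra

/-- The condition that a pairing of bosonizations `R # J` and `S # K` is trivial on `J ⊗ S` and
on `R ⊗ K`. -/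
structure IsMixedTrivial {k J K R S : Type*} [Field k] [Ring J] [HopfAlgebra k J] [Ring K]
    [HopfAlgebra k K] [Ring R] [Algebra k R] [Coalgebra k R] [Ring S] [Algebra k S] [Coalgebra k S]
    {𝓡 : BraidedHopfAlgebra k J R} {𝓢 : BraidedHopfAlgebra k K S}
    (τ : 𝓡.Bosonization →ₗ[k] 𝓢.Bosonization →ₗ[k] k) : Prop where
  inJ_inR : ∀ (a : J) (s : S), τ (𝓡.inJ a) (𝓢.inR s) =
    Coalgebra.counit (R := k) a * Coalgebra.counit (R := k) s
  inR_inJ : ∀ (r : R) (x : K), τ (𝓡.inR r) (𝓢.inJ x) =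
    Coalgebra.counit (R := k) r * Coalgebra.counit (R := k) x

namespace IsSkewPairing

variable {k J K R S : Type*} [Field k] [Ring J] [HopfAlgebra k J] [Ring K]
  [HopfAlgebra k K] [Ring R] [Algebra k R] [Coalgebra k R] [Ring S] [Algebra k S] [Coalgebra k S]
  {𝓡 : BraidedHopfAlgebra k J R} {𝓢 : BraidedHopfAlgebra k K S}
  {τ : 𝓡.Bosonization →ₗ[k] 𝓢.Bosonization →ₗ[k] k} (hτ : IsSkewPairing τ)
  (h : IsMixedTrivial τ)

include hτ h

/-- The pairing with `K` factors through the projection `R # J → J`. -/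
lemma inJ_right (b : 𝓡.Bosonization) (x : K) :
    τ b (𝓢.inJ x) = τ (𝓡.inJ (𝓡.projJ b)) (𝓢.inJ x) := by
  induction b using 𝓡.induction_tmul with
  | h0 => simp [map_zero]
  | hadd x y hx hy => simp only [LinearMap.map_add, alg_add, LinearMap.add_apply, hx, hy]
  | hmul r a =>
    rw [hτ.mul_left, 𝓢.comul_inJ_eq_map, map_mul, 𝓡.projJ_inJ, 𝓡.projJ_inR]
    have h1 : ∀ X : K ⊗[k] K, LinearMap.mul' k k (TensorProduct.map (τ (𝓡.inR r)) (τ (𝓡.inJ a))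
        (TensorProduct.map 𝓢.inJ.toLinearMap 𝓢.inJ.toLinearMap X)) =
        Coalgebra.counit (R := k) r *
          τ (𝓡.inJ a) (𝓢.inJ (TensorProduct.lid k K (Coalgebra.counit.rTensor K X))) := by
      intro X
      induction X using TensorProduct.induction_on with
      | zero => simp
      | add x y hx hy =>
        simp only [LinearMap.map_add, LinearEquiv.map_add, alg_add, mul_add, hx, hy]
      | tmul u v => simp [h.inR_inJ, mul_assoc]
    rw [h1]
    simp [Algebra.algebraMap_eq_smul_one]

/-- The pairing with `J` factors through the projection `S # K → K`. -/
lemma inJ_left (a : J) (y : 𝓢.Bosonization) :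
    τ (𝓡.inJ a) y = τ (𝓡.inJ a) (𝓢.inJ (𝓢.projJ y)) := by
  induction y using 𝓢.induction_tmul with
  | h0 => simp [map_zero]
  | hadd x y hx hy => simp only [LinearMap.map_add, alg_add, hx, hy]
  | hmul s x =>
    rw [hτ.mul_right, 𝓡.comul_inJ_eq_map, map_mul, 𝓢.projJ_inJ, 𝓢.projJ_inR]
    have h1 : ∀ X : J ⊗[k] J, LinearMap.mul' k k (TensorProduct.map (τ.flip (𝓢.inJ x))
        (τ.flip (𝓢.inR s)) (TensorProduct.map 𝓡.inJ.toLinearMap 𝓡.inJ.toLinearMap X)) =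
        Coalgebra.counit (R := k) s *
          τ (𝓡.inJ (TensorProduct.rid k J (Coalgebra.counit.lTensor J X))) (𝓢.inJ x) := by
      intro X
      induction X using TensorProduct.induction_on with
      | zero => simp
      | add x y hx hy =>
        simp only [LinearMap.map_add, LinearEquiv.map_add, alg_add, LinearMap.add_apply, mul_add,
          hx, hy]
      | tmul u v => simp [h.inJ_inR]; ring
    rw [h1]
    simp [Algebra.algebraMap_eq_smul_one]

lemma flip_inJ_eq (x : K) : τ.flip (𝓢.inJ x) =
    (τ.flip (𝓢.inJ x) ∘ₗ 𝓡.inJ.toLinearMap) ∘ₗ 𝓡.projJ.toLinearMap :=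
  LinearMap.ext fun b => hτ.inJ_right h b x

lemma inJ_eq (a : J) : τ (𝓡.inJ a) =
    (τ (𝓡.inJ a) ∘ₗ 𝓢.inJ.toLinearMap) ∘ₗ 𝓢.projJ.toLinearMap :=
  LinearMap.ext fun b => hτ.inJ_left h a b

lemma mul_inJ_inR (b : 𝓡.Bosonization) (a : J) (s : S) : τ (b * 𝓡.inJ a) (𝓢.inR s) =
    Coalgebra.counit (R := k) a * τ b (𝓢.inR s) := by
  rw [hτ.mul_left, hτ.inJ_eq h, 𝓢.map_projJ_right]
  simp [hτ.one_right, 𝓡.counit_inJ, mul_comm]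

lemma inR_inJ_mul (r : R) (x : K) (y : 𝓢.Bosonization) : τ (𝓡.inR r) (𝓢.inJ x * y) =
    Coalgebra.counit (R := k) x * τ (𝓡.inR r) y := by
  rw [hτ.mul_right, hτ.flip_inJ_eq h, 𝓡.map_projJ_right]
  simp [hτ.one_left, 𝓢.counit_inJ, mul_comm]

/-- In terms of the decompositions `R # J = R J` and `S # K = K S`, the pairing is the tensor
product of its restrictions. -/
lemma inR_mul_inJ_inJ_mul_inR (r : R) (a : J) (x : K) (s : S) :
    τ (𝓡.inR r * 𝓡.inJ a) (𝓢.inJ x * 𝓢.inR s) =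
      τ (𝓡.inR r) (𝓢.inR s) * τ (𝓡.inJ a) (𝓢.inJ x) := by
  rw [hτ.mul_right]
  exact 𝓡.conv_inR_mul_inJ _ _ (fun b a => by simp [hτ.mul_inJ_inR h])
    (fun b => hτ.inJ_right h b x) r a

lemma inR_mul_inJ (r : R) (y : 𝓢.Bosonization) (x : K) : τ (𝓡.inR r) (y * 𝓢.inJ x) =
    LinearMap.mul' k k (TensorProduct.map (τ.flip (𝓢.inJ x) ∘ₗ 𝓡.inJ.toLinearMap)
      (τ.flip y ∘ₗ 𝓡.inR.toLinearMap) (𝓡.coact r)) := by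
  rw [hτ.mul_right, hτ.flip_inJ_eq h, 𝓡.map_projJ_left]
  congr 3
  ext a
  simp [𝓡.projJ_inJ]

/-- The adjoint of the action on `R` is the coaction on `S`. -/
lemma act_left (a : J) (r : R) (s : S) : τ (𝓡.inR (𝓡.act a r)) (𝓢.inR s) =
    LinearMap.mul' k k (TensorProduct.map (τ (𝓡.inJ a) ∘ₗ 𝓢.inJ.toLinearMap)
      (τ (𝓡.inR r) ∘ₗ 𝓢.inR.toLinearMap) (𝓢.coact s)) := by
  have h1 := 𝓡.apply_inJ_mul_inR (τ.flip (𝓢.inR s)) (fun b a => by simp [hτ.mul_inJ_inR h]) a r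
  rw [LinearMap.flip_apply, LinearMap.flip_apply] at h1
  rw [← h1, hτ.mul_left, hτ.inJ_eq h, 𝓢.map_projJ_left]
  congr 3
  ext a
  simp [𝓢.projJ_inJ]

/-- The adjoint of the action on `S` is the coaction on `R`, up to the antipode of `K`. -/
lemma act_right (r : R) (x : K) (s : S) : τ (𝓡.inR r) (𝓢.inR (𝓢.act x s)) =
    LinearMap.mul' k k (TensorProduct.map
      (τ.flip (𝓢.inJ (HopfAlgebra.antipode k x)) ∘ₗ 𝓡.inJ.toLinearMap)
      (τ.flip (𝓢.inR s) ∘ₗ 𝓡.inR.toLinearMap) (𝓡.coact r)) := by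
  rw [← hτ.inR_mul_inJ h, 𝓢.inR_act]
  have h1 : ∀ X : K ⊗[k] K, τ (𝓡.inR r) (LinearMap.mul' k 𝓢.Bosonization
      (TensorProduct.map (LinearMap.mulRight k (𝓢.inR s) ∘ₗ 𝓢.inJ.toLinearMap)
        (𝓢.inJ.toLinearMap ∘ₗ HopfAlgebra.antipode k) X)) =
      τ (𝓡.inR r) (𝓢.inR s * 𝓢.inJ (HopfAlgebra.antipode k
        (TensorProduct.lid k K (Coalgebra.counit.rTensor K X)))) := by
    intro X
    induction X using TensorProduct.induction_on with
    | zero => simp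
    | add x y hx hy =>
      simp only [LinearMap.map_add, LinearEquiv.map_add, alg_add, mul_add, hx, hy]
    | tmul u v => simp [mul_assoc, hτ.inR_inJ_mul h]
  rw [h1]
  simp

/-- `τ(r, s s') = ∑ τ(r₍₁₎, s') τ(r₍₂₎, s)`. -/
lemma inR_inR_mul (r : R) (s s' : S) : τ (𝓡.inR r) (𝓢.inR (s * s')) =
    LinearMap.mul' k k (TensorProduct.map
      (τ.flip (𝓢.inR s') ∘ₗ 𝓡.inR.toLinearMap) (τ.flip (𝓢.inR s) ∘ₗ 𝓡.inR.toLinearMap)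
      (Coalgebra.comul r)) := by
  rw [map_mul, hτ.mul_right,
    𝓡.map_inR_mul_inJ_right _ _ fun b a => by simp [hτ.mul_inJ_inR h]]

omit hτ h in
variable (τ) in
/-- The restriction of the pairing to `R ⊗ S`. -/
noncomputable abbrev restrictRS : R →ₗ[k] S →ₗ[k] k :=
  τ.compl₁₂ 𝓡.inR.toLinearMap 𝓢.inR.toLinearMap

/-- `τ(r r', s) = ∑ τ(r₀, s₍₁₎) τ(r₋₁ ▷ r', s₍₂₎)`. -/
lemma inR_mul_inR (r r' : R) (s : S) : τ (𝓡.inR (r * r')) (𝓢.inR s) =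
    LinearMap.mul' k k (TensorProduct.map₂ (restrictRS τ)
      (restrictRS τ ∘ₗ 𝓡.act.toLinearMap.flip r') (TensorProduct.comm k J R (𝓡.coact r))
      (Coalgebra.comul s)) := by
  rw [map_mul, hτ.mul_left, 𝓢.comul_inR, 𝓢.comulR_eq_phi]
  induction (Coalgebra.comul s : S ⊗[k] S) using TensorProduct.induction_on with
  | zero => simp
  | add x y hx hy => simp only [LinearMap.map_add, LinearEquiv.map_add, alg_add, hx, hy]
  | tmul x y =>
    rw [𝓢.phi_tmul, 𝓢.rho_apply]
    let F : J →ₗ[k] K →ₗ[k] k := τ.compl₁₂ 𝓡.inJ.toLinearMap 𝓢.inJ.toLinearMap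
    let G : R →ₗ[k] S →ₗ[k] k := LinearMap.smulRight (τ.flip (𝓢.inR x) ∘ₗ 𝓡.inR.toLinearMap)
      (τ (𝓡.inR r') ∘ₗ 𝓢.inR.toLinearMap)
    have h1 : ∀ Y : K ⊗[k] S, LinearMap.mul' k k (TensorProduct.map (τ (𝓡.inR r)) (τ (𝓡.inR r'))
        ((𝓢.inR x ⊗ₜ 1) * Algebra.TensorProduct.map 𝓢.inJ 𝓢.inR Y)) =
        LinearMap.mul' k k (TensorProduct.map₂ F G (𝓡.coact r) Y) := by
      intro Y
      induction Y using TensorProduct.induction_on with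
      | zero => simp
      | add x y hx hy => simp only [LinearMap.map_add, alg_add, mul_add, hx, hy]
      | tmul c z =>
        simp only [Algebra.TensorProduct.map_tmul, Algebra.TensorProduct.tmul_mul_tmul,
          TensorProduct.map_tmul, LinearMap.mul'_apply, one_mul, hτ.inR_mul_inJ h]
        generalize 𝓡.coact r = X
        induction X using TensorProduct.induction_on with
        | zero => simp
        | add x y hx hy => simp only [LinearMap.map_add, LinearMap.add_apply, add_mul, hx, hy]
        | tmul a t => simp [F, G, TensorProduct.map₂_apply_tmul, mul_assoc]
    have h2 : ∀ X : J ⊗[k] R, LinearMap.mul' k k (TensorProduct.map₂ (restrictRS τ)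
        (restrictRS τ ∘ₗ 𝓡.act.toLinearMap.flip r') (TensorProduct.comm k J R X) (x ⊗ₜ y)) =
        LinearMap.mul' k k (TensorProduct.map₂ F G X (𝓢.coact y)) := by
      intro X
      induction X using TensorProduct.induction_on with
      | zero => simp
      | add x y hx hy =>
        simp only [LinearMap.map_add, LinearEquiv.map_add, LinearMap.add_apply, hx, hy]
      | tmul a t =>
        have h3 := hτ.act_left h a r' y
        simp only [TensorProduct.comm_tmul, TensorProduct.map₂_apply_tmul, TensorProduct.map_tmul,
          LinearMap.mul'_apply, LinearMap.comp_apply, LinearMap.compl₁₂_apply,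
          AlgHom.toLinearMap_apply, LinearMap.flip_apply, h3]
        generalize 𝓢.coact y = Y
        induction Y using TensorProduct.induction_on with
        | zero => simp
        | add x y hx hy => simp only [LinearMap.map_add, mul_add, hx, hy]
        | tmul c z => simp [F, G, mul_left_comm]
    rw [h1, h2]

/-- `∑ τ(r, s₍₁₎) τ(r', s₍₂₎) = ∑ τ(r₀ (S⁻¹(r₋₁) ▷ r'), s)`. -/
lemma comul_right {T : J →ₗ[k] J} (hT : T ∘ₗ HopfAlgebra.antipode k = LinearMap.id)
    (hT' : HopfAlgebra.antipode k ∘ₗ T = LinearMap.id) (r r' : R) (s : S) :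
    LinearMap.mul' k k (TensorProduct.map (restrictRS τ r) (restrictRS τ r')
      (Coalgebra.comul s)) =
    TensorProduct.lift ((LinearMap.mul k R).compr₂ (τ.flip (𝓢.inR s) ∘ₗ 𝓡.inR.toLinearMap))
      (TensorProduct.map LinearMap.id (𝓡.act.toLinearMap.flip r' ∘ₗ T)
        (TensorProduct.comm k J R (𝓡.coact r))) := by
  -- Expanding the right hand side by `inR_mul_inR` gives
  -- `∑ τ(r₀, s₍₁₎) τ(r₋₁ S⁻¹(r₋₂) ▷ r', s₍₂₎)`, where `Q` is `(b ⊗ c) ↦ c S⁻¹(b) ▷ r'`.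
  set Y := Coalgebra.comul (R := k) s
  let p : R ⊗[k] R →ₗ[k] k := LinearMap.mul' k k ∘ₗ
    (TensorProduct.map₂ (restrictRS τ) (restrictRS τ)).flip Y
  let Q : J ⊗[k] J →ₗ[k] R := 𝓡.act.toLinearMap.flip r' ∘ₗ LinearMap.mul' k J ∘ₗ T.lTensor J ∘ₗ
    (TensorProduct.comm k J J).toLinearMap
  have hp : ∀ t u : R, p (t ⊗ₜ u) =
      LinearMap.mul' k k (TensorProduct.map (restrictRS τ t) (restrictRS τ u) Y) := by
    intro t u
    simp only [p, LinearMap.comp_apply, LinearMap.flip_apply]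
    induction Y using TensorProduct.induction_on with
    | zero => simp
    | add x y hx hy => simp only [LinearMap.map_add, hx, hy]
    | tmul c z => simp
  have h1 : ∀ X : J ⊗[k] R, TensorProduct.lift ((LinearMap.mul k R).compr₂
      (τ.flip (𝓢.inR s) ∘ₗ 𝓡.inR.toLinearMap))
      (TensorProduct.map LinearMap.id (𝓡.act.toLinearMap.flip r' ∘ₗ T)
        (TensorProduct.comm k J R X)) =
      p (TensorProduct.comm k R R (Q.rTensor R ((TensorProduct.assoc k J J R).symm
        (𝓡.coact.lTensor J X)))) := by
    intro X
    induction X using TensorProduct.induction_on with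
    | zero => simp
    | add x y hx hy => simp only [LinearMap.map_add, LinearEquiv.map_add, hx, hy]
    | tmul a t =>
      have h2 := hτ.inR_mul_inR h t (𝓡.act (T a) r') s
      simp only [TensorProduct.comm_tmul, TensorProduct.map_tmul, TensorProduct.lift.tmul,
        LinearMap.compr₂_apply, LinearMap.mul_apply', LinearMap.comp_apply, LinearMap.flip_apply,
        AlgHom.toLinearMap_apply, LinearMap.id_apply, LinearMap.lTensor_tmul, h2]
      induction 𝓡.coact t using TensorProduct.induction_on with
      | zero => simp
      | add x y hx hy =>
        simp only [LinearMap.map_add, LinearEquiv.map_add, LinearMap.add_apply, tmul_add, hx, hy]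
      | tmul b u =>
        simp only [TensorProduct.assoc_symm_tmul, LinearMap.rTensor_tmul, TensorProduct.comm_tmul,
          hp, TensorProduct.map₂_apply_tmul]
        simp [Q]
        rfl
  have h3 : ∀ X : J ⊗[k] R, p (TensorProduct.comm k R R (Q.rTensor R
      (Coalgebra.comul.rTensor R X))) =
      p (TensorProduct.lid k R (Coalgebra.counit.rTensor R X) ⊗ₜ r') := by
    intro X
    induction X using TensorProduct.induction_on with
    | zero => simp
    | add x y hx hy => simp only [LinearMap.map_add, LinearEquiv.map_add, add_tmul, hx, hy]
    | tmul a t =>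
      have h4 : Q (Coalgebra.comul a) = Coalgebra.counit (R := k) a • r' := by
        simp only [Q, LinearMap.comp_apply, LinearEquiv.coe_coe, mul_antipodeInv hT hT']
        simp [Algebra.algebraMap_eq_smul_one]
      simp only [LinearMap.rTensor_tmul, h4, TensorProduct.comm_tmul, TensorProduct.lid_tmul]
      rw [TensorProduct.smul_tmul]
  rw [h1, ← 𝓡.coassoc, LinearEquiv.symm_apply_apply, h3, 𝓡.counit_coact, hp]

variable {TJ : J →ₗ[k] J} (hTJ : TJ ∘ₗ HopfAlgebra.antipode k = LinearMap.id)
    {T : 𝓡.Bosonization →ₗ[k] 𝓡.Bosonization}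
    (hT : T ∘ₗ HopfAlgebra.antipode k = LinearMap.id)
    (hT' : HopfAlgebra.antipode k ∘ₗ T = LinearMap.id)
include hTJ hT hT'

lemma antipodeInv_inR_mul_inJ (r : R) (y : 𝓢.Bosonization) (x : K) :
    τ (T (𝓡.inR r)) (y * 𝓢.inJ x) = Coalgebra.counit (R := k) x * τ (T (𝓡.inR r)) y := by
  rw [hτ.mul_right, comul_antipodeInv hT hT']
  have h1 : ∀ X : 𝓡.Bosonization ⊗[k] 𝓡.Bosonization, LinearMap.mul' k k
      (TensorProduct.map (τ.flip (𝓢.inJ x)) (τ.flip y)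
        (TensorProduct.map T T (TensorProduct.comm k _ _ X))) =
      LinearMap.mul' k k (TensorProduct.map (τ.flip y ∘ₗ T)
        ((τ.flip (𝓢.inJ x) ∘ₗ 𝓡.inJ.toLinearMap ∘ₗ TJ) ∘ₗ 𝓡.projJ.toLinearMap) X) := by
    intro X
    induction X using TensorProduct.induction_on with
    | zero => simp
    | add x y hx hy => simp only [LinearMap.map_add, LinearEquiv.map_add, hx, hy]
    | tmul b c =>
      have := hτ.inJ_right h (T c) x
      rw [𝓡.projJ_antipodeInv hTJ hT'] at this
      simp [this, mul_comm]
  rw [h1, 𝓡.map_projJ_right]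
  simp [antipodeInv_one hTJ, hτ.one_left, 𝓢.counit_inJ, mul_comm]

lemma antipodeInv_mul_antipodeInv (r r' : R) (s : S) :
    τ (T (𝓡.inR r) * T (𝓡.inR r')) (𝓢.inR s) = LinearMap.mul' k k (TensorProduct.map
      (τ (T (𝓡.inR r)) ∘ₗ 𝓢.inR.toLinearMap) (τ (T (𝓡.inR r')) ∘ₗ 𝓢.inR.toLinearMap)
      (Coalgebra.comul s)) := by
  rw [hτ.mul_left, 𝓢.map_inR_mul_inJ_right _ _
    fun b a => hτ.antipodeInv_inR_mul_inJ h hTJ hT hT' r b a]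

/-- In terms of the decompositions `R # J = S⁻¹(R) J` and `S # K = S K`, the pairing is the tensor
product of its restrictions. -/
lemma antipodeInv_mul_inJ_inR_mul_inJ (r : R) (a : J) (s : S) (x : K) :
    τ (T (𝓡.inR r) * 𝓡.inJ a) (𝓢.inR s * 𝓢.inJ x) =
      τ (T (𝓡.inR r)) (𝓢.inR s) * τ (𝓡.inJ a) (𝓢.inJ x) := by
  rw [hτ.mul_left]
  exact 𝓢.conv_inR_mul_inJ _ _ (fun b a => hτ.antipodeInv_inR_mul_inJ h hTJ hT hT' r b a)
    (fun b => hτ.inJ_left h a b) s x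

omit hTJ hT hT'

omit h in
lemma restrictRS_one : restrictRS τ 1 1 ≠ 0 := by
  simp [hτ.one_left]

/-- The pairing is non-degenerate if and only if both of its restrictions are. -/
lemma nondegenerate_iff (hK : Function.Bijective (HopfAlgebra.antipode k : K →ₗ[k] K)) :
    τ.Nondegenerate ↔
      (τ.compl₁₂ 𝓡.inJ.toLinearMap 𝓢.inJ.toLinearMap).Nondegenerate ∧
      (τ.compl₁₂ 𝓡.inR.toLinearMap 𝓢.inR.toLinearMap).Nondegenerate := by
  obtain ⟨e, he⟩ := 𝓢.exists_equiv_inJ_mul_inR hK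
  rw [and_comm]
  refine nondegenerate_iff_of_tensor (TwistedTensor.ofTensor 𝓡.smash) e
    (fun r a s x => ?_) (m₀ := 1) (x₀ := 1) (n₀ := 1) (y₀ := 1) hτ.restrictRS_one ?_
  · rw [← TwistedTensor.inl_mul_inr, he]
    exact hτ.inR_mul_inJ_inJ_mul_inR h r a x s
  · simp [hτ.one_left]

include hTJ hT hT' in
/-- The analogue of `nondegenerate_iff` for the decomposition `R # J = S⁻¹(R) J`. -/
lemma nondegenerate_iff_antipodeInv
    (hJ : Function.Bijective (HopfAlgebra.antipode k : J →ₗ[k] J)) :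
    τ.Nondegenerate ↔
      (τ.compl₁₂ ((LinearMap.range 𝓡.inR.toLinearMap).map T).subtype
        𝓢.inR.toLinearMap).Nondegenerate ∧
      (τ.compl₁₂ 𝓡.inJ.toLinearMap 𝓢.inJ.toLinearMap).Nondegenerate := by
  obtain ⟨e, he⟩ := 𝓡.exists_equiv_inJ_mul_inR hJ
  let eT : 𝓡.Bosonization ≃ₗ[k] 𝓡.Bosonization := LinearEquiv.ofLinearMap T
    (HopfAlgebra.antipode k) hT hT'
  let P := (LinearMap.range 𝓡.inR.toLinearMap).map T
  have hinj : Function.Injective (T ∘ₗ 𝓡.inR.toLinearMap) := by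
    refine eT.injective.comp fun r r' hr => ?_
    have := congrArg (fun b => TensorProduct.rid k R (Coalgebra.counit.lTensor R
      ((TwistedTensor.ofTensor 𝓡.smash).symm b))) hr
    simpa [TwistedTensor.inl_apply] using this
  have hP : LinearMap.range (T ∘ₗ 𝓡.inR.toLinearMap) = P := LinearMap.range_comp _ _
  let eR : R ≃ₗ[k] P := LinearEquiv.ofInjective _ hinj ≪≫ₗ LinearEquiv.ofEq _ _ hP
  have heR : ∀ r, (eR r : 𝓡.Bosonization) = T (𝓡.inR r) := fun r => rfl
  let eJ : J ≃ₗ[k] J := LinearEquiv.ofBijective _ hJ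
  let E : P ⊗[k] J ≃ₗ[k] 𝓡.Bosonization := TensorProduct.congr eR.symm eJ ≪≫ₗ e ≪≫ₗ eT
  have hE : ∀ (r : R) (a : J), E (eR r ⊗ₜ a) = T (𝓡.inR r) * 𝓡.inJ a := by
    intro r a
    have h1 : E (eR r ⊗ₜ a) = T (e (eR.symm (eR r) ⊗ₜ HopfAlgebra.antipode k a)) := rfl
    rw [h1, LinearEquiv.symm_apply_apply, he, antipodeInv_mul hT hT', ← 𝓡.antipode_inJ,
      comp_antipode_apply hT]
  refine nondegenerate_iff_of_tensor E (TwistedTensor.ofTensor 𝓢.smash)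
    (fun r a s x => ?_) (m₀ := eR 1) (x₀ := 1) (n₀ := 1) (y₀ := 1) ?_ ?_
  · obtain ⟨r, rfl⟩ := eR.surjective r
    rw [← TwistedTensor.inl_mul_inr, hE]
    exact hτ.antipodeInv_mul_inJ_inR_mul_inJ h hTJ hT hT' r a s x
  · simp [heR, antipodeInv_one hT, hτ.one_left]
  · simp [hτ.one_left]

end IsSkewPairing

/-! ### Conjugation in the generalized quantum double -/

section Conjugate

variable {k A D : Type*} [Field k] [Ring A] [HopfAlgebra k A] [Ring D] [Algebra k D]

/-- A commutation rule `a d = ∑ F(a₁) a₂` computes the conjugation `∑ a₁ d S(a₂) = F(a)`. -/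
lemma conjugate_eq_of_mul_eq (φ : A →ₐ[k] D) (d : D) (F : A →ₗ[k] D)
    (hF : ∀ a, φ a * d = LinearMap.mul' k D (TensorProduct.map F φ.toLinearMap
      (Coalgebra.comul a))) (a : A) : conjugate φ a d = F a := by
  let S := HopfAlgebra.antipode k (A := A)
  have h1 : ∀ X : A ⊗[k] A, LinearMap.mul' k D (TensorProduct.map
      (LinearMap.mulRight k d ∘ₗ φ.toLinearMap) (φ.toLinearMap ∘ₗ S) X) =
      LinearMap.mul' k D (TensorProduct.map F (φ.toLinearMap ∘ₗ LinearMap.mul' k A ∘ₗ S.lTensor A)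
        (TensorProduct.assoc k A A A (Coalgebra.comul.rTensor A X))) := by
    intro X
    induction X using TensorProduct.induction_on with
    | zero => simp
    | add x y hx hy => simp only [LinearMap.map_add, LinearEquiv.map_add, hx, hy]
    | tmul u v =>
      simp only [TensorProduct.map_tmul, LinearMap.mul'_apply, LinearMap.comp_apply,
        LinearMap.mulRight_apply, AlgHom.toLinearMap_apply, hF, LinearMap.rTensor_tmul]
      induction (Coalgebra.comul u : A ⊗[k] A) using TensorProduct.induction_on with
      | zero => simp
      | add x y hx hy =>
        simp only [LinearMap.map_add, LinearEquiv.map_add, add_tmul, add_mul, hx, hy]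
      | tmul x y => simp [mul_assoc]
  have h2 : ∀ X : A ⊗[k] A, LinearMap.mul' k D (TensorProduct.map F
      (φ.toLinearMap ∘ₗ LinearMap.mul' k A ∘ₗ S.lTensor A) (Coalgebra.comul.lTensor A X)) =
      F (TensorProduct.rid k A (Coalgebra.counit.lTensor A X)) := by
    intro X
    induction X using TensorProduct.induction_on with
    | zero => simp
    | add x y hx hy => simp only [LinearMap.map_add, LinearEquiv.map_add, hx, hy]
    | tmul u v => simp [S, Algebra.algebraMap_eq_smul_one]
  rw [conjugate, h1, Coalgebra.coassoc_apply, h2]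
  simp

/-- `∑ a₁ (S(a₂)₂ t(S(a₂)₁)) = t(S(a))`. -/
lemma mul_transL_antipode (t : A →ₗ[k] k) (a : A) :
    LinearMap.mul' k A ((transL t ∘ₗ HopfAlgebra.antipode k).lTensor A (Coalgebra.comul a)) =
      algebraMap k A (t (HopfAlgebra.antipode k a)) := by
  let S := HopfAlgebra.antipode k (A := A)
  have h0 : ∀ X : A ⊗[k] A, TensorProduct.lid k A (t.rTensor A (TensorProduct.map S S
      (TensorProduct.comm k A A X))) = TensorProduct.rid k A (TensorProduct.map S (t ∘ₗ S) X) := by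
    intro X
    induction X using TensorProduct.induction_on with
    | zero => simp
    | add x y hx hy => simp only [LinearMap.map_add, LinearEquiv.map_add, hx, hy]
    | tmul u v => simp
  have h1 : ∀ X : A ⊗[k] A, LinearMap.mul' k A ((transL t ∘ₗ S).lTensor A X) =
      TensorProduct.rid k A (TensorProduct.map (LinearMap.mul' k A ∘ₗ S.lTensor A) (t ∘ₗ S)
        ((TensorProduct.assoc k A A A).symm (Coalgebra.comul.lTensor A X))) := by
    intro X
    induction X using TensorProduct.induction_on with
    | zero => simp
    | add x y hx hy => simp only [LinearMap.map_add, LinearEquiv.map_add, hx, hy]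
    | tmul u v =>
      simp only [LinearMap.lTensor_tmul, LinearMap.comp_apply, transL_apply]
      rw [comul_antipode, h0]
      induction (Coalgebra.comul v : A ⊗[k] A) using TensorProduct.induction_on with
      | zero => simp
      | add x y hx hy =>
        simp only [LinearMap.map_add, LinearEquiv.map_add, tmul_add, hx, hy]
      | tmul x y => simp
  have h2 : ∀ X : A ⊗[k] A, TensorProduct.rid k A (TensorProduct.map
      (LinearMap.mul' k A ∘ₗ S.lTensor A) (t ∘ₗ S) (Coalgebra.comul.rTensor A X)) =
      Algebra.linearMap k A (t (S (TensorProduct.lid k A (Coalgebra.counit.rTensor A X)))) := by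
    intro X
    induction X using TensorProduct.induction_on with
    | zero => simp
    | add x y hx hy => simp only [LinearMap.map_add, LinearEquiv.map_add, hx, hy]
    | tmul u v =>
      simp only [LinearMap.rTensor_tmul, TensorProduct.map_tmul, TensorProduct.rid_tmul,
        LinearMap.comp_apply, S, HopfAlgebra.mul_antipode_lTensor_comul_apply,
        TensorProduct.lid_tmul, LinearMap.map_smul, Algebra.linearMap_apply,
        Algebra.algebraMap_eq_smul_one]
      exact smul_comm _ _ _
  rw [h1, Coalgebra.coassoc_symm_apply, h2]
  simp [S]

end Conjugate

namespace IsSkewPairing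

section

variable {k B H : Type*} [Field k] [Ring B] [HopfAlgebra k B] [Ring H] [HopfAlgebra k H]
  {τ : B →ₗ[k] H →ₗ[k] k} (hτ : IsSkewPairing τ)

/-- The commutation rule of the generalized quantum double. -/
lemma inRight_mul_inLeft (y : H) (b : B) :
    GeneralizedDouble.inRight hτ y * GeneralizedDouble.inLeft hτ b =
    LinearMap.mul' k _ (TensorProduct.map ((GeneralizedDouble.inLeft hτ).toLinearMap ∘ₗ
      LinearMap.applyₗ b ∘ₗ hτ.doubleAct.toLinearMap) (GeneralizedDouble.inRight hτ).toLinearMap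
      (doubleCoact k H y)) := by
  rw [TwistedTensor.inr_mul_inl, TwistedTensor.braid_eq_T]
  change TwistedTensor.ofTensor hτ.doubleData (hτ.doubleData.T 1 b 1 (doubleCoact k H y)) = _
  induction (doubleCoact k H y) using TensorProduct.induction_on with
  | zero => simp
  | tmul x y => simp [SmashData.T_tmul, TwistedTensor.inl_mul_inr, doubleData]
  | add x y hx hy => simp only [LinearMap.map_add, LinearEquiv.map_add, hx, hy]

lemma doubleCoact_apply (y : H) : doubleCoact k H y =
    TensorProduct.rightComm k H H H (Coalgebra.comul.rTensor H (Coalgebra.comul y)) := rfl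

end

variable {k J K R S : Type*} [Field k] [Ring J] [HopfAlgebra k J] [Ring K]
  [HopfAlgebra k K] [Ring R] [Algebra k R] [Coalgebra k R] [Ring S] [Algebra k S] [Coalgebra k S]
  {𝓡 : BraidedHopfAlgebra k J R} {𝓢 : BraidedHopfAlgebra k K S}
  {τ : 𝓡.Bosonization →ₗ[k] 𝓢.Bosonization →ₗ[k] k} (hτ : IsSkewPairing τ)
  (h : IsMixedTrivial τ)

omit hτ in
variable (τ) in
/-- The operators `r ↦ ∑ τ(r₋₁, x) r₀` on `R`. -/
noncomputable def coactOp : K →ₗ[k] R →ₗ[k] R :=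
  (TensorProduct.lift (LinearMap.smulRightₗ ∘ₗ
    τ.compl₁₂ 𝓡.inJ.toLinearMap 𝓢.inJ.toLinearMap) ∘ₗ 𝓡.coact).flip

omit hτ in
lemma coactOp_apply (x : K) (r : R) : coactOp τ x r = TensorProduct.lid k R
    ((τ.flip (𝓢.inJ x) ∘ₗ 𝓡.inJ.toLinearMap).rTensor R (𝓡.coact r)) := by
  simp only [coactOp, LinearMap.flip_apply, LinearMap.comp_apply]
  induction 𝓡.coact r using TensorProduct.induction_on with
  | zero => simp
  | add x y hx hy =>
    simp only [LinearMap.map_add, LinearEquiv.map_add, LinearMap.add_apply, hx, hy]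
  | tmul a t => simp

include h

lemma algU_inJ_inR (x : K) (r : R) : hτ.algU (𝓢.inJ x) (𝓡.inR r) = 𝓡.inR (coactOp τ x r) := by
  have h1 : hτ.algU (𝓢.inJ x) (𝓡.inR r) = TensorProduct.lid k 𝓡.Bosonization
    (TensorProduct.map (τ.flip (𝓢.inJ x)) LinearMap.id (Coalgebra.comul (𝓡.inR r))) := rfl
  rw [h1, hτ.flip_inJ_eq h, 𝓡.map_projJ_left, coactOp_apply]
  induction 𝓡.coact r using TensorProduct.induction_on with
  | zero => simp
  | add x y hx hy => simp only [LinearMap.map_add, LinearEquiv.map_add, alg_add, hx, hy]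
  | tmul a t => simp

lemma algV_inJ_inR (x : K) (r : R) : hτ.algV (𝓢.inJ x) (𝓡.inR r) =
    Coalgebra.counit (R := k) x • 𝓡.inR r := by
  have h1 : hτ.algV (𝓢.inJ x) (𝓡.inR r) = TensorProduct.rid k 𝓡.Bosonization
    (TensorProduct.map LinearMap.id ((τ ∘ₗ HopfAlgebra.antipode k).flip (𝓢.inJ x))
      (Coalgebra.comul (𝓡.inR r))) := rfl
  have h2 : (τ ∘ₗ HopfAlgebra.antipode k).flip (𝓢.inJ x) =
      (τ.flip (𝓢.inJ x) ∘ₗ 𝓡.inJ.toLinearMap ∘ₗ HopfAlgebra.antipode k) ∘ₗ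
        𝓡.projJ.toLinearMap := by
    ext b
    simp [hτ.inJ_right h (HopfAlgebra.antipode k b), 𝓡.projJ_antipode]
  rw [h1, h2, 𝓡.map_projJ_right]
  simp [hτ.one_left, 𝓢.counit_inJ]

/-- The commutation rule `x r = ∑ τ(r₋₁, x₁) r₀ x₂` of `K` and `R` in the double. -/
lemma inRight_inJ_mul_inLeft_inR (x : K) (r : R) :
    GeneralizedDouble.inRight hτ (𝓢.inJ x) * GeneralizedDouble.inLeft hτ (𝓡.inR r) =
    LinearMap.mul' k _ (TensorProduct.map
      (((GeneralizedDouble.inLeft hτ).comp 𝓡.inR).toLinearMap ∘ₗ (coactOp τ).flip r)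
      ((GeneralizedDouble.inRight hτ).comp 𝓢.inJ).toLinearMap (Coalgebra.comul x)) := by
  let F := (((GeneralizedDouble.inLeft hτ).comp 𝓡.inR).toLinearMap ∘ₗ (coactOp τ).flip r)
  let φ := ((GeneralizedDouble.inRight hτ).comp 𝓢.inJ).toLinearMap
  rw [inRight_mul_inLeft, doubleCoact_apply, 𝓢.comul_inJ_eq_map]
  have h1 : ∀ X : K ⊗[k] K, Coalgebra.comul.rTensor 𝓢.Bosonization
      (TensorProduct.map 𝓢.inJ.toLinearMap 𝓢.inJ.toLinearMap X) =
      TensorProduct.map (TensorProduct.map 𝓢.inJ.toLinearMap 𝓢.inJ.toLinearMap)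
        𝓢.inJ.toLinearMap (Coalgebra.comul.rTensor K X) := by
    intro X
    induction X using TensorProduct.induction_on with
    | zero => simp
    | add x y hx hy => simp only [LinearMap.map_add, hx, hy]
    | tmul u v => simp [𝓢.comul_inJ_eq_map]
  have h2 : ∀ X : (K ⊗[k] K) ⊗[k] K, LinearMap.mul' k _ (TensorProduct.map
      ((GeneralizedDouble.inLeft hτ).toLinearMap ∘ₗ LinearMap.applyₗ (𝓡.inR r) ∘ₗ
        hτ.doubleAct.toLinearMap) (GeneralizedDouble.inRight hτ).toLinearMap
      (TensorProduct.rightComm k _ _ _ (TensorProduct.map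
        (TensorProduct.map 𝓢.inJ.toLinearMap 𝓢.inJ.toLinearMap) 𝓢.inJ.toLinearMap X))) =
      LinearMap.mul' k _ (TensorProduct.map F φ (TensorProduct.rid k _
        (Coalgebra.counit.lTensor _ X))) := by
    intro X
    induction X using TensorProduct.induction_on with
    | zero => simp
    | add x y hx hy => simp only [LinearMap.map_add, LinearEquiv.map_add, hx, hy]
    | tmul X v =>
    induction X using TensorProduct.induction_on with
    | zero => simp
    | add x y hx hy => simp only [LinearMap.map_add, LinearEquiv.map_add, add_tmul, hx, hy]
    | tmul u w =>
      simp [doubleAct_tmul, hτ.algV_inJ_inR h, hτ.algU_inJ_inR h, F, φ]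
  have h3 : ∀ X : K ⊗[k] K, TensorProduct.rid k _ (Coalgebra.counit.lTensor _
      ((TensorProduct.assoc k K K K).symm (Coalgebra.comul.lTensor K X))) =
      (TensorProduct.rid k K ∘ₗ Coalgebra.counit.lTensor K ∘ₗ Coalgebra.comul).lTensor K X := by
    intro X
    induction X using TensorProduct.induction_on with
    | zero => simp
    | add x y hx hy => simp only [LinearMap.map_add, LinearEquiv.map_add, hx, hy]
    | tmul u v =>
      simp only [LinearMap.lTensor_tmul, LinearMap.comp_apply]
      induction (Coalgebra.comul v : K ⊗[k] K) using TensorProduct.induction_on with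
      | zero => simp
      | add x y hx hy => simp only [LinearMap.map_add, LinearEquiv.map_add, tmul_add, hx, hy]
      | tmul u w => simp
  have h4 : TensorProduct.rid k K ∘ₗ Coalgebra.counit.lTensor K ∘ₗ Coalgebra.comul =
      LinearMap.id (R := k) (M := K) := by ext; simp
  rw [h1, h2, ← Coalgebra.coassoc_symm_apply, h3, h4, LinearMap.lTensor_id]
  rfl

/-- Conjugation by `K` in the double restricts to `R`. -/
lemma conjugate_inR (x : K) (r : R) :
    conjugate ((GeneralizedDouble.inRight hτ).comp 𝓢.inJ) x
      (GeneralizedDouble.inLeft hτ (𝓡.inR r)) =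
    GeneralizedDouble.inLeft hτ (𝓡.inR (coactOp τ x r)) := by
  have h1 := conjugate_eq_of_mul_eq ((GeneralizedDouble.inRight hτ).comp 𝓢.inJ)
    (GeneralizedDouble.inLeft hτ (𝓡.inR r))
    (((GeneralizedDouble.inLeft hτ).comp 𝓡.inR).toLinearMap ∘ₗ (coactOp τ).flip r)
    (fun x => by rw [AlgHom.comp_apply]; exact hτ.inRight_inJ_mul_inLeft_inR h x r) x
  rw [h1, LinearMap.comp_apply, AlgHom.toLinearMap_apply, AlgHom.comp_apply, LinearMap.flip_apply]

omit h in
lemma algU_inJ (y : 𝓢.Bosonization) (a : J) : hτ.algU y (𝓡.inJ a) =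
    𝓡.inJ (transL (τ.flip y ∘ₗ 𝓡.inJ.toLinearMap) a) := by
  rw [algU_apply, 𝓡.comul_inJ_eq_map, transL_apply]
  induction (Coalgebra.comul a : J ⊗[k] J) using TensorProduct.induction_on with
  | zero => simp
  | add x y hx hy =>
    simp only [LinearMap.map_add, LinearEquiv.map_add, alg_add, LinearMap.add_apply, hx, hy]
  | tmul u v => simp [evalL_tmul]

omit h in
lemma algV_inJ (y : 𝓢.Bosonization) (a : J) : hτ.algV y (𝓡.inJ a) =
    𝓡.inJ (transR (τ.flip y ∘ₗ 𝓡.inJ.toLinearMap ∘ₗ HopfAlgebra.antipode k) a) := by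
  rw [algV_apply, 𝓡.comul_inJ_eq_map, transR_apply]
  induction (Coalgebra.comul a : J ⊗[k] J) using TensorProduct.induction_on with
  | zero => simp
  | add x y hx hy =>
    simp only [LinearMap.map_add, LinearEquiv.map_add, alg_add, LinearMap.add_apply, hx, hy]
  | tmul u v => simp [evalL_tmul, 𝓡.antipode_inJ]

/-- The action of `(S # K) ⊗ (S # K)` on `J` factors through the projection to `K ⊗ K`. -/
lemma doubleAct_inJ (p q : 𝓢.Bosonization) (a : J) : hτ.doubleAct (p ⊗ₜ q) (𝓡.inJ a) =
    hτ.doubleAct (𝓢.inJ (𝓢.projJ p) ⊗ₜ 𝓢.inJ (𝓢.projJ q)) (𝓡.inJ a) := by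
  have h1 : ∀ y : 𝓢.Bosonization, τ.flip y ∘ₗ 𝓡.inJ.toLinearMap =
      τ.flip (𝓢.inJ (𝓢.projJ y)) ∘ₗ 𝓡.inJ.toLinearMap := fun y =>
    LinearMap.ext fun a => hτ.inJ_left h a y
  have hV : hτ.algV q (𝓡.inJ a) = hτ.algV (𝓢.inJ (𝓢.projJ q)) (𝓡.inJ a) := by
    rw [algV_inJ, algV_inJ, ← LinearMap.comp_assoc, h1, LinearMap.comp_assoc]
  rw [doubleAct_tmul, doubleAct_tmul, hV, algV_inJ, algU_inJ, algU_inJ, h1]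

/-- The commutation rule `s a = ∑ τ(a₁, s₋₁) a₂ s₀` of `S` and `J` in the double. -/
lemma inRight_inR_mul_inLeft_inJ (s : S) (a : J) :
    GeneralizedDouble.inRight hτ (𝓢.inR s) * GeneralizedDouble.inLeft hτ (𝓡.inJ a) =
    LinearMap.mul' k _ (TensorProduct.map
      ((GeneralizedDouble.inLeft hτ).toLinearMap ∘ₗ (hτ.algU.toLinearMap ∘ₗ 𝓢.inJ.toLinearMap).flip
        (𝓡.inJ a))
      ((GeneralizedDouble.inRight hτ).comp 𝓢.inR).toLinearMap (𝓢.coact s)) := by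
  rw [inRight_mul_inLeft, doubleCoact_apply]
  have h1 : ∀ X : (𝓢.Bosonization ⊗[k] 𝓢.Bosonization) ⊗[k] 𝓢.Bosonization,
      LinearMap.mul' k _ (TensorProduct.map ((GeneralizedDouble.inLeft hτ).toLinearMap ∘ₗ
        LinearMap.applyₗ (𝓡.inJ a) ∘ₗ hτ.doubleAct.toLinearMap)
        (GeneralizedDouble.inRight hτ).toLinearMap (TensorProduct.rightComm k _ _ _ X)) =
      LinearMap.mul' k _ (TensorProduct.map ((GeneralizedDouble.inLeft hτ).toLinearMap ∘ₗ
        LinearMap.applyₗ (𝓡.inJ a) ∘ₗ hτ.doubleAct.toLinearMap)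
        (GeneralizedDouble.inRight hτ).toLinearMap (TensorProduct.rightComm k _ _ _
          ((𝓢.inJ.toLinearMap ∘ₗ 𝓢.projJ.toLinearMap).lTensor _ X))) := by
    intro X
    induction X using TensorProduct.induction_on with
    | zero => simp
    | add x y hx hy => simp only [LinearMap.map_add, LinearEquiv.map_add, hx, hy]
    | tmul X v =>
    induction X using TensorProduct.induction_on with
    | zero => simp
    | add x y hx hy => simp only [LinearMap.map_add, LinearEquiv.map_add, add_tmul, hx, hy]
    | tmul u w =>
      have h2 := hτ.doubleAct_inJ h u (𝓢.inJ (𝓢.projJ v)) a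
      rw [𝓢.projJ_inJ, ← hτ.doubleAct_inJ h u v] at h2
      simp [h2]
  have h2 : ∀ X : 𝓢.Bosonization ⊗[k] 𝓢.Bosonization,
      LinearMap.mul' k _ (TensorProduct.map ((GeneralizedDouble.inLeft hτ).toLinearMap ∘ₗ
        LinearMap.applyₗ (𝓡.inJ a) ∘ₗ hτ.doubleAct.toLinearMap)
        (GeneralizedDouble.inRight hτ).toLinearMap (TensorProduct.rightComm k _ _ _ (X ⊗ₜ 1))) =
      LinearMap.mul' k _ (TensorProduct.map (((GeneralizedDouble.inLeft hτ).toLinearMap ∘ₗ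
        (hτ.algU.toLinearMap ∘ₗ 𝓢.inJ.toLinearMap).flip (𝓡.inJ a)) ∘ₗ 𝓢.projJ.toLinearMap)
        (GeneralizedDouble.inRight hτ).toLinearMap X) := by
    intro X
    induction X using TensorProduct.induction_on with
    | zero => simp
    | add x y hx hy => simp only [LinearMap.map_add, LinearEquiv.map_add, add_tmul, hx, hy]
    | tmul u w =>
      have h3 := hτ.doubleAct_inJ h u 1 a
      rw [map_one, map_one, doubleAct_tmul, doubleAct_tmul, map_one, Module.End.one_apply] at h3
      simp [doubleAct_tmul, h3]
  have h3 := 𝓢.map_projJ_right Coalgebra.comul 𝓢.inJ.toLinearMap s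
  rw [h1, ← LinearMap.comp_apply (LinearMap.lTensor _ _), LinearMap.lTensor_comp_rTensor, h3,
    AlgHom.toLinearMap_apply, map_one, h2, 𝓢.map_projJ_left]
  rfl

/-- Conjugation by `J` in the double restricts to `S`. -/
lemma conjugate_inJ (a : J) (s : S) :
    conjugate ((GeneralizedDouble.inLeft hτ).comp 𝓡.inJ) a
      (GeneralizedDouble.inRight hτ (𝓢.inR s)) =
    GeneralizedDouble.inRight hτ (𝓢.inR (TensorProduct.lid k S
      ((τ (𝓡.inJ (HopfAlgebra.antipode k a)) ∘ₗ 𝓢.inJ.toLinearMap).rTensor S (𝓢.coact s)))) := by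
  let ψ := (GeneralizedDouble.inLeft hτ).comp 𝓡.inJ
  let φ := (GeneralizedDouble.inRight hτ).comp 𝓢.inR
  let t : K →ₗ[k] J →ₗ[k] J := transL ∘ₗ (τ.compl₁₂ 𝓡.inJ.toLinearMap 𝓢.inJ.toLinearMap).flip
  -- `E` collects the commutation rule: `s b = E(s₋₁ ⊗ s₀)(b)` for `b ∈ J`.
  let E : K ⊗[k] S →ₗ[k] J →ₗ[k] GeneralizedDouble hτ := TensorProduct.lift
    (LinearMap.mk₂ k (fun x s => LinearMap.mulRight k (φ s) ∘ₗ ψ.toLinearMap ∘ₗ t x)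
      (fun x y s => by ext; simp) (fun c x s => by ext; simp)
      (fun x s t => by ext; simp [mul_add]) (fun c x s => by ext; simp))
  have hE : ∀ (b : J), φ s * ψ b = E (𝓢.coact s) b := by
    intro b
    refine (hτ.inRight_inR_mul_inLeft_inJ h s b).trans ?_
    induction 𝓢.coact s using TensorProduct.induction_on with
    | zero => simp
    | add x y hx hy => simp only [LinearMap.map_add, LinearMap.add_apply, hx, hy]
    | tmul x s =>
      simp only [TensorProduct.map_tmul, LinearMap.comp_apply, LinearMap.flip_apply,
        AlgHom.toLinearMap_apply, algU_inJ, E, TensorProduct.lift.tmul, LinearMap.mk₂_apply]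
      rfl
  have h1 : ∀ X : J ⊗[k] J, LinearMap.mul' k _ (TensorProduct.map
      (LinearMap.mulRight k (φ s) ∘ₗ ψ.toLinearMap) (ψ.toLinearMap ∘ₗ HopfAlgebra.antipode k) X) =
      LinearMap.mul' k _ (TensorProduct.map ψ.toLinearMap
        (E (𝓢.coact s) ∘ₗ HopfAlgebra.antipode k) X) := by
    intro X
    induction X using TensorProduct.induction_on with
    | zero => simp
    | add x y hx hy => simp only [LinearMap.map_add, hx, hy]
    | tmul u v =>
      simp only [TensorProduct.map_tmul, LinearMap.comp_apply, LinearMap.mul'_apply, ← hE,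
        LinearMap.mulRight_apply, AlgHom.toLinearMap_apply, mul_assoc]
  refine (h1 _).trans ?_
  change _ = φ _
  induction 𝓢.coact s using TensorProduct.induction_on with
  | zero => simp
  | add x y hx hy =>
    simp only [LinearMap.map_add, LinearEquiv.map_add, alg_add, LinearMap.add_comp,
      TensorProduct.map_add_right, LinearMap.add_apply, hx, hy]
  | tmul x s =>
    have h2 : ∀ X : J ⊗[k] J, LinearMap.mul' k _ (TensorProduct.map ψ.toLinearMap
        (E (x ⊗ₜ s) ∘ₗ HopfAlgebra.antipode k) X) =
        ψ (LinearMap.mul' k J ((t x ∘ₗ HopfAlgebra.antipode k).lTensor J X)) * φ s := by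
      intro X
      induction X using TensorProduct.induction_on with
      | zero => simp
      | add x y hx hy => simp only [LinearMap.map_add, alg_add, add_mul, hx, hy]
      | tmul u v => simp [E, mul_assoc]
    rw [h2]
    simp only [t, LinearMap.comp_apply]
    rw [mul_transL_antipode]
    simp [Algebra.algebraMap_eq_smul_one]

end IsSkewPairing

lemma lid_rTensor_mem {k K V : Type*} [Field k] [AddCommGroup K] [Module k K]
    [AddCommGroup V] [Module k V] (P : Submodule k V)
    (f : K →ₗ[k] k) {X : K ⊗[k] V} (hX : X ∈ LinearMap.range (P.subtype.lTensor K)) :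
    TensorProduct.lid k V (f.rTensor V X) ∈ P := by
  obtain ⟨Y, rfl⟩ := hX
  induction Y using TensorProduct.induction_on with
  | zero => simp
  | add x y hx hy => simp only [LinearMap.map_add, LinearEquiv.map_add, P.add_mem hx hy]
  | tmul x v => simpa using P.smul_mem _ v.2

/-! ### Bijectivity of the antipode of a bosonization -/

lemma map₂_mk_mul_map₂_mk_le {k A B : Type*} [Field k] [Ring A] [Algebra k A] [Ring B]
    [Algebra k B] (P P' : Submodule k A) (Q Q' : Submodule k B) :
    Submodule.map₂ (TensorProduct.mk k A B) P Q * Submodule.map₂ (TensorProduct.mk k A B) P' Q' ≤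
      Submodule.map₂ (TensorProduct.mk k A B) (P * P') (Q * Q') := by
  rw [Submodule.map₂_eq_span_image2, Submodule.map₂_eq_span_image2, Submodule.span_mul_span,
    Submodule.span_le]
  rintro _ ⟨_, ⟨p, hp, q, hq, rfl⟩, _, ⟨p', hp', q', hq', rfl⟩, rfl⟩
  simp only [TensorProduct.mk_apply, Algebra.TensorProduct.tmul_mul_tmul]
  exact Submodule.apply_mem_map₂ _ (Submodule.mul_mem_mul hp hp') (Submodule.mul_mem_mul hq hq')

namespace BraidedHopfAlgebra

variable {k J R : Type*} [Field k] [Ring J] [HopfAlgebra k J] [Ring R] [Algebra k R]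
  [Coalgebra k R] (H : BraidedHopfAlgebra k J R)

lemma comul_inR_of_mem_primitives {v : R} (hv : v ∈ primitives k R) :
    Coalgebra.comul (R := k) (H.inR v) =
      H.inR v ⊗ₜ 1 + TensorProduct.map H.inJ.toLinearMap H.inR.toLinearMap (H.coact v) := by
  rw [H.comul_inR, H.comulR_eq_phi, mem_primitives.1 hv, LinearEquiv.map_add, alg_add,
    H.phi_tmul, H.phi_tmul, map_one, mul_one, map_one]
  change _ + 1 * H.rho v = _
  rw [one_mul]
  rfl

include H in
lemma counit_eq_zero_of_mem_primitives {v : R} (hv : v ∈ primitives k R) :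
    Coalgebra.counit (R := k) v = 0 := by
  have h1 := congrArg (TensorProduct.lid k R) (Coalgebra.rTensor_counit_comul (R := k) v)
  rw [mem_primitives.1 hv] at h1
  simp only [LinearMap.map_add, LinearMap.rTensor_tmul, LinearEquiv.map_add, H.counit_one,
    TensorProduct.lid_tmul, one_smul, add_eq_right] at h1
  have h2 := congrArg (Coalgebra.counit (R := k)) h1
  simpa [H.counit_one] using h2

/-- The subspaces `J V J V ⋯ V J` of `R # J`, where `V = P(R)` occurs `n` times. -/
noncomputable def primFiltration : ℕ → Submodule k H.Bosonization
  | 0 => LinearMap.range H.inJ.toLinearMap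
  | n + 1 => primFiltration n * (primitives k R).map H.inR.toLinearMap *
      LinearMap.range H.inJ.toLinearMap

lemma one_mem_range_inJ : (1 : H.Bosonization) ∈ LinearMap.range H.inJ.toLinearMap :=
  ⟨1, map_one H.inJ⟩

lemma range_inJ_mul_self_le : LinearMap.range H.inJ.toLinearMap *
    LinearMap.range H.inJ.toLinearMap ≤ LinearMap.range H.inJ.toLinearMap := by
  rw [Submodule.mul_le]
  rintro _ ⟨a, rfl⟩ _ ⟨b, rfl⟩
  exact ⟨a * b, map_mul H.inJ _ _⟩

lemma primFiltration_mul_inJ_le (n : ℕ) : H.primFiltration n *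
    LinearMap.range H.inJ.toLinearMap ≤ H.primFiltration n := by
  cases n with
  | zero => exact H.range_inJ_mul_self_le
  | succ n =>
    rw [primFiltration, mul_assoc]
    exact mul_le_mul' le_rfl H.range_inJ_mul_self_le

lemma primFiltration_mul_primitives_le (n : ℕ) : H.primFiltration n *
    (primitives k R).map H.inR.toLinearMap ≤ H.primFiltration (n + 1) := by
  intro x hx
  rw [primFiltration, ← mul_one x]
  exact Submodule.mul_mem_mul hx H.one_mem_range_inJ

/-- Since `Δ(v) = v ⊗ 1 + ∑ v₋₁ ⊗ v₀` for primitive `v`, the coproduct respects the number of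
primitive factors. -/
lemma comul_mem_of_mem_primFiltration (n : ℕ) : ∀ c ∈ H.primFiltration n,
    Coalgebra.comul (R := k) c ∈ ⨆ p : {p : ℕ × ℕ // p.1 + p.2 = n},
      Submodule.map₂ (TensorProduct.mk k _ _) (H.primFiltration p.1.1)
        (H.primFiltration p.1.2) := by
  let M := LinearMap.range H.inJ.toLinearMap
  have hM : ∀ m ∈ M, Coalgebra.comul (R := k) m ∈ Submodule.map₂ (TensorProduct.mk k _ _) M M := by
    rintro _ ⟨a, rfl⟩
    rw [AlgHom.toLinearMap_apply, H.comul_inJ_eq_map]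
    induction (Coalgebra.comul a : J ⊗[k] J) using TensorProduct.induction_on with
    | zero => simp
    | add x y hx hy => rw [LinearMap.map_add]; exact Submodule.add_mem _ hx hy
    | tmul u v => exact Submodule.apply_mem_map₂ _ ⟨u, rfl⟩ ⟨v, rfl⟩
  induction n with
  | zero =>
    intro c hc
    exact Submodule.mem_iSup_of_mem ⟨(0, 0), rfl⟩ (hM c hc)
  | succ n ih =>
    intro c hc
    rw [primFiltration] at hc
    induction hc using Submodule.mul_induction_on' with
    | add x _ y _ hx hy => rw [LinearMap.map_add]; exact Submodule.add_mem _ hx hy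
    | mem_mul_mem x hx m hm =>
    induction hx using Submodule.mul_induction_on' with
    | add x _ y _ hx hy => rw [add_mul, LinearMap.map_add]; exact Submodule.add_mem _ hx hy
    | mem_mul_mem x hx v hv =>
    obtain ⟨v, hv, rfl⟩ := hv
    rw [Bialgebra.comul_mul, Bialgebra.comul_mul]
    have h1 := ih x hx
    have h2 := hM m hm
    generalize Coalgebra.comul (R := k) x = X at h1
    induction h1 using Submodule.iSup_induction' with
    | zero => simp
    | add x y _ _ hx hy => rw [add_mul, add_mul]; exact Submodule.add_mem _ hx hy
    | mem p X hX =>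
    obtain ⟨⟨i, j⟩, hij⟩ := p
    simp only at hij hX
    have hV : ∀ v ∈ primitives k R, H.inR v ∈ (primitives k R).map H.inR.toLinearMap :=
      fun v hv => ⟨v, hv, rfl⟩
    rw [AlgHom.toLinearMap_apply, H.comul_inR_of_mem_primitives hv, mul_add, add_mul]
    refine Submodule.add_mem _ ?_ ?_
    · refine Submodule.mem_iSup_of_mem ⟨(i + 1, j), by simp; omega⟩ ?_
      refine Submodule.map₂_le_map₂ le_rfl (H.primFiltration_mul_inJ_le j)
        (map₂_mk_mul_map₂_mk_le _ _ _ _ (Submodule.mul_mem_mul ?_ h2))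
      rw [← mul_one (H.primFiltration j)]
      exact map₂_mk_mul_map₂_mk_le _ _ _ _ (Submodule.mul_mem_mul hX
        (Submodule.apply_mem_map₂ _ (hV v hv) (Submodule.one_le.1 le_rfl)))
    · refine Submodule.mem_iSup_of_mem ⟨(i, j + 1), by simp; omega⟩ ?_
      refine Submodule.map₂_le_map₂ (H.primFiltration_mul_inJ_le i) le_rfl
        (map₂_mk_mul_map₂_mk_le _ _ _ _ (Submodule.mul_mem_mul ?_ h2))
      refine Submodule.map₂_le_map₂ (H.primFiltration_mul_inJ_le i) le_rfl
        (map₂_mk_mul_map₂_mk_le _ _ _ _ (Submodule.mul_mem_mul hX ?_))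
      obtain ⟨Y, hY⟩ := H.coact_mem_primitives v hv
      rw [← hY]
      clear hY
      induction Y using TensorProduct.induction_on with
      | zero => simp
      | add x y hx hy =>
        rw [LinearMap.map_add, LinearMap.map_add]
        exact Submodule.add_mem _ hx hy
      | tmul u v => exact Submodule.apply_mem_map₂ _ ⟨u, rfl⟩ (hV v v.2)

lemma iSup_primFiltration (hgen : Algebra.adjoin k (primitives k R : Set R) = ⊤) :
    ⨆ n, H.primFiltration n = ⊤ := by
  set T := ⨆ n, H.primFiltration n
  have hT : ∀ P : Submodule k H.Bosonization, (∀ n, H.primFiltration n * P ≤ T) → T * P ≤ T := by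
    intro P hP
    rw [Submodule.iSup_mul]
    exact iSup_le hP
  have h1 : ∀ r : R, ∀ b ∈ T, b * H.inR r ∈ T := by
    intro r
    have hr : r ∈ Algebra.adjoin k (primitives k R : Set R) := hgen ▸ Algebra.mem_top
    induction hr using Algebra.adjoin_induction with
    | mem v hv =>
      intro b hb
      exact hT _ (fun n => (H.primFiltration_mul_primitives_le n).trans (le_iSup _ _))
        (Submodule.mul_mem_mul hb ⟨v, hv, rfl⟩)
    | algebraMap c =>
      intro b hb
      rw [AlgHom.commutes, ← Algebra.commutes, ← Algebra.smul_def]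
      exact T.smul_mem _ hb
    | add x y _ _ hx hy =>
      intro b hb
      rw [alg_add, mul_add]
      exact T.add_mem (hx b hb) (hy b hb)
    | mul x y _ _ hx hy =>
      intro b hb
      rw [map_mul, ← mul_assoc]
      exact hy _ (hx b hb)
  rw [eq_top_iff]
  rintro b -
  induction b using H.induction_tmul with
  | h0 => exact T.zero_mem
  | hadd x y hx hy => exact T.add_mem hx hy
  | hmul r a =>
    refine hT _ (fun n => (H.primFiltration_mul_inJ_le n).trans (le_iSup _ _))
      (Submodule.mul_mem_mul ?_ ⟨a, rfl⟩)
    rw [← one_mul (H.inR r)]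
    exact h1 r 1 (Submodule.mem_iSup_of_mem 0 H.one_mem_range_inJ)

open WithConv in
/-- If `R` is generated by primitive elements and the antipode of `J` is bijective, then so is
the antipode of `R # J`. -/
theorem exists_antipodeInv_bosonization
    (hJ : Function.Bijective (HopfAlgebra.antipode k : J →ₗ[k] J))
    (hgen : Algebra.adjoin k (primitives k R : Set R) = ⊤) :
    ∃ T : H.Bosonization →ₗ[k] H.Bosonization,
      T ∘ₗ HopfAlgebra.antipode k = LinearMap.id ∧ HopfAlgebra.antipode k ∘ₗ T = LinearMap.id := by
  obtain ⟨TJ, hTJ, hTJ'⟩ := exists_antipodeInv hJ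
  -- On the bottom step `J` of the filtration the inverse is that of the antipode of `J`.
  let g : H.Bosonization →ₗ[k] H.Bosonization := H.inJ.toLinearMap ∘ₗ TJ ∘ₗ H.projJ.toLinearMap
  have hop : opConv k H.Bosonization =
    toConv ((MulOpposite.opLinearEquiv k).toLinearMap ∘ₗ LinearMap.id) := rfl
  obtain ⟨h, h1, h2⟩ := exists_conv_inverse H.comul_mem_of_mem_primFiltration
    (H.iSup_primFiltration hgen) (opConv k H.Bosonization)
    (toConv ((MulOpposite.opLinearEquiv k).toLinearMap ∘ₗ g)) (by
      rintro _ ⟨a, rfl⟩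
      apply MulOpposite.unop_injective
      rw [hop, convMul_op_apply, AlgHom.toLinearMap_apply, H.comul_inJ_eq_map, H.counit_inJ,
        MulOpposite.algebraMap_apply, MulOpposite.unop_op, ← H.inJ.commutes,
        ← antipodeInv_mul_comul hTJ hTJ']
      induction (Coalgebra.comul a : J ⊗[k] J) using TensorProduct.induction_on with
      | zero => simp
      | add x y hx hy => simp only [LinearMap.map_add, LinearEquiv.map_add, alg_add, hx, hy]
      | tmul u v => simp [g, H.projJ_inJ]) (by
      rintro _ ⟨a, rfl⟩
      apply MulOpposite.unop_injective
      rw [hop, convMul_op_apply, AlgHom.toLinearMap_apply, H.comul_inJ_eq_map, H.counit_inJ,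
        MulOpposite.algebraMap_apply, MulOpposite.unop_op, ← H.inJ.commutes,
        ← mul_antipodeInv hTJ hTJ']
      induction (Coalgebra.comul a : J ⊗[k] J) using TensorProduct.induction_on with
      | zero => simp
      | add x y hx hy => simp only [LinearMap.map_add, LinearEquiv.map_add, alg_add, hx, hy]
      | tmul u v => simp [g, H.projJ_inJ])
  exact exists_antipodeInv_of_conv h1 h2

end BraidedHopfAlgebra

/-! ### Powers of the space of primitive elements -/

lemma range_lTensor_subtype {k M N : Type*} [Field k] [AddCommGroup M] [Module k M]
    [AddCommGroup N] [Module k N] (P : Submodule k N) :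
    LinearMap.range (P.subtype.lTensor M) = Submodule.map₂ (TensorProduct.mk k M N) ⊤ P := by
  apply le_antisymm
  · rintro _ ⟨Y, rfl⟩
    induction Y using TensorProduct.induction_on with
    | zero => simp
    | add x y hx hy => rw [LinearMap.map_add]; exact Submodule.add_mem _ hx hy
    | tmul u v => exact Submodule.apply_mem_map₂ _ trivial v.2
  · rw [Submodule.map₂_le]
    exact fun u _ v hv => ⟨u ⊗ₜ ⟨v, hv⟩, rfl⟩

lemma iSup_pow_eq_top {k A : Type*} [Field k] [Ring A] [Algebra k A] {P : Submodule k A}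
    (hP : Algebra.adjoin k (P : Set A) = ⊤) : ⨆ n : ℕ, P ^ n = ⊤ := by
  rw [eq_top_iff]
  rintro a -
  have ha : a ∈ Algebra.adjoin k (P : Set A) := hP ▸ Algebra.mem_top
  induction ha using Algebra.adjoin_induction with
  | mem v hv => exact Submodule.mem_iSup_of_mem 1 (by simpa using hv)
  | algebraMap c =>
    exact Submodule.mem_iSup_of_mem 0 (by rw [pow_zero]; exact Submodule.algebraMap_mem c)
  | add x y _ _ hx hy => exact Submodule.add_mem _ hx hy
  | mul x y _ _ hx hy =>
    refine Submodule.mul_le.1 (?_ : (⨆ n : ℕ, P ^ n) * (⨆ n : ℕ, P ^ n) ≤ _) x hx y hy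
    rw [Submodule.iSup_mul]
    refine iSup_le fun i => ?_
    rw [Submodule.mul_iSup]
    refine iSup_le fun j => ?_
    rw [← pow_add]
    exact le_iSup (fun n : ℕ => P ^ n) (i + j)

namespace BraidedHopfAlgebra

variable {k J R : Type*} [Field k] [Ring J] [HopfAlgebra k J] [Ring R] [Algebra k R]
  [Coalgebra k R] (H : BraidedHopfAlgebra k J R)

lemma coact_mem_of_mem_primitives_pow (n : ℕ) (r : R) (hr : r ∈ primitives k R ^ n) :
    H.coact r ∈ LinearMap.range ((primitives k R ^ n).subtype.lTensor J) := by
  rw [range_lTensor_subtype]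
  induction n generalizing r with
  | zero =>
    rw [pow_zero] at hr ⊢
    obtain ⟨c, rfl⟩ := Submodule.mem_one.1 hr
    rw [Algebra.algebraMap_eq_smul_one, LinearMap.map_smul, H.coact_one]
    exact Submodule.smul_mem _ _ (Submodule.apply_mem_map₂ _ trivial (Submodule.one_le.1 le_rfl))
  | succ n ih =>
    rw [pow_succ] at hr ⊢
    induction hr using Submodule.mul_induction_on' with
    | add x _ y _ hx hy => rw [LinearMap.map_add]; exact Submodule.add_mem _ hx hy
    | mem_mul_mem x hx v hv =>
      rw [H.coact_mul]
      have hv' := H.coact_mem_primitives v hv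
      rw [range_lTensor_subtype] at hv'
      exact Submodule.map₂_le_map₂ le_top le_rfl
        (map₂_mk_mul_map₂_mk_le _ _ _ _ (Submodule.mul_mem_mul (ih x hx) hv'))

include H in
/-- The coproduct of `R` is graded with respect to the powers of the space of primitives. -/
lemma comul_mem_of_mem_primitives_pow (n : ℕ) (r : R) (hr : r ∈ primitives k R ^ n) :
    Coalgebra.comul (R := k) r ∈ ⨆ p : {p : ℕ × ℕ // p.1 + p.2 = n},
      Submodule.map₂ (TensorProduct.mk k R R) (primitives k R ^ p.1.1) (primitives k R ^ p.1.2) := by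
  induction n generalizing r with
  | zero =>
    refine Submodule.mem_iSup_of_mem ⟨(0, 0), rfl⟩ ?_
    rw [pow_zero] at hr ⊢
    obtain ⟨c, rfl⟩ := Submodule.mem_one.1 hr
    rw [Algebra.algebraMap_eq_smul_one, LinearMap.map_smul, H.comul_one]
    exact Submodule.smul_mem _ _ (Submodule.apply_mem_map₂ _ (Submodule.one_le.1 le_rfl)
      (Submodule.one_le.1 le_rfl))
  | succ n ih =>
    rw [pow_succ] at hr
    induction hr using Submodule.mul_induction_on' with
    | add x _ y _ hx hy => rw [LinearMap.map_add]; exact Submodule.add_mem _ hx hy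
    | mem_mul_mem x hx v hv =>
    rw [H.comul_mul, mem_primitives.1 hv]
    have h1 := ih x hx
    generalize Coalgebra.comul (R := k) x = X at h1
    induction h1 using Submodule.iSup_induction' with
    | zero => simp
    | add x y _ _ hx hy => rw [add_tmul, LinearMap.map_add]; exact Submodule.add_mem _ hx hy
    | mem p X hX =>
    obtain ⟨⟨i, j⟩, hij⟩ := p
    simp only at hij hX
    rw [Submodule.map₂_eq_span_image2] at hX
    induction hX using Submodule.span_induction with
    | zero => simp
    | add x y _ _ hx hy => rw [add_tmul, LinearMap.map_add]; exact Submodule.add_mem _ hx hy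
    | smul c x _ hx =>
      rw [← TensorProduct.smul_tmul', LinearMap.map_smul]; exact Submodule.smul_mem _ _ hx
    | mem X hX =>
    obtain ⟨x, hx, y, hy, rfl⟩ := hX
    rw [TensorProduct.tmul_add, LinearMap.map_add]
    have h2 : ∀ z t : R, twistMul (braid H.act.toLinearMap H.coact)
        ((TensorProduct.mk k R R x y) ⊗ₜ (z ⊗ₜ t)) = H.braidedSquare.T x z t (H.coact y) :=
      fun z t => TwistedTensor.mulMap_tmul H.braidedSquare x z y t
    obtain ⟨Y, hY⟩ := H.coact_mem_of_mem_primitives_pow j y hy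
    rw [h2, h2, ← hY]
    refine Submodule.add_mem _ (Submodule.mem_iSup_of_mem ⟨(i + 1, j), by simp; omega⟩ ?_)
      (Submodule.mem_iSup_of_mem ⟨(i, j + 1), by simp; omega⟩ ?_)
    · clear hY
      induction Y using TensorProduct.induction_on with
      | zero => simp
      | add x y hx hy => rw [LinearMap.map_add, LinearMap.map_add]; exact Submodule.add_mem _ hx hy
      | tmul a u =>
        rw [LinearMap.lTensor_tmul, SmashData.T_tmul, mul_one]
        refine Submodule.apply_mem_map₂ _ ?_ u.2
        rw [pow_succ]
        exact Submodule.mul_mem_mul hx (H.act_mem_primitives a v hv)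
    · clear hY
      induction Y using TensorProduct.induction_on with
      | zero => simp
      | add x y hx hy => rw [LinearMap.map_add, LinearMap.map_add]; exact Submodule.add_mem _ hx hy
      | tmul a u =>
        rw [LinearMap.lTensor_tmul, SmashData.T_tmul]
        refine Submodule.apply_mem_map₂ _ ?_ ?_
        · have : H.braidedSquare.act a 1 = algebraMap k R (Coalgebra.counit a) := H.act_one a
          rw [this, ← Algebra.commutes, ← Algebra.smul_def]
          exact Submodule.smul_mem _ _ hx
        · rw [pow_succ]
          exact Submodule.mul_mem_mul u.2 hv

include H in
lemma counit_eq_zero_of_mem_primitives_pow (n : ℕ) (r : R) (hr : r ∈ primitives k R ^ (n + 1)) :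
    Coalgebra.counit (R := k) r = 0 := by
  rw [pow_succ] at hr
  induction hr using Submodule.mul_induction_on' with
  | add x _ y _ hx hy => rw [LinearMap.map_add, hx, hy, add_zero]
  | mem_mul_mem x hx v hv =>
    rw [H.counit_mul, H.counit_eq_zero_of_mem_primitives hv, mul_zero]

end BraidedHopfAlgebra

namespace IsSkewPairing

variable {k J K R S : Type*} [Field k] [Ring J] [HopfAlgebra k J] [Ring K]
  [HopfAlgebra k K] [Ring R] [Algebra k R] [Coalgebra k R] [Ring S] [Algebra k S] [Coalgebra k S]
  {𝓡 : BraidedHopfAlgebra k J R} {𝓢 : BraidedHopfAlgebra k K S}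
  {τ : 𝓡.Bosonization →ₗ[k] 𝓢.Bosonization →ₗ[k] k} (hτ : IsSkewPairing τ)

include hτ in
/-- It suffices to check the triviality on `J ⊗ S` and `R ⊗ K` on primitive generators. -/
lemma isMixedTrivial_of_adjoin (hR : Algebra.adjoin k (primitives k R : Set R) = ⊤)
    (hS : Algebra.adjoin k (primitives k S : Set S) = ⊤)
    (h1 : ∀ (a : J), ∀ w ∈ primitives k S, τ (𝓡.inJ a) (𝓢.inR w) = 0)
    (h2 : ∀ v ∈ primitives k R, ∀ (x : K), τ (𝓡.inR v) (𝓢.inJ x) = 0) : IsMixedTrivial τ where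
  inJ_inR a s := by
    have hs : s ∈ Algebra.adjoin k (primitives k S : Set S) := hS ▸ Algebra.mem_top
    induction hs using Algebra.adjoin_induction generalizing a with
    | mem w hw => rw [h1 a w hw, 𝓢.counit_eq_zero_of_mem_primitives hw, mul_zero]
    | algebraMap c =>
      rw [Algebra.algebraMap_eq_smul_one, map_smul 𝓢.inR, LinearMap.map_smul, map_one, hτ.one_right]
      simp [𝓡.counit_inJ, 𝓢.counit_one, mul_comm]
    | add x y _ _ hx hy => simp only [alg_add, LinearMap.map_add, hx, hy, mul_add]
    | mul x y _ _ hx hy =>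
      rw [map_mul, hτ.mul_right, 𝓡.comul_inJ_eq_map, 𝓢.counit_mul]
      have h3 : ∀ X : J ⊗[k] J, LinearMap.mul' k k (TensorProduct.map (τ.flip (𝓢.inR y))
          (τ.flip (𝓢.inR x)) (TensorProduct.map 𝓡.inJ.toLinearMap 𝓡.inJ.toLinearMap X)) =
          Coalgebra.counit (R := k) (TensorProduct.lid k J (Coalgebra.counit.rTensor J X)) *
            (Coalgebra.counit (R := k) x * Coalgebra.counit (R := k) y) := by
        intro X
        induction X using TensorProduct.induction_on with
        | zero => simp
        | add x y hx hy => simp only [LinearMap.map_add, LinearEquiv.map_add, add_mul, hx, hy]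
        | tmul u v => simp [hx, hy]; ring
      rw [h3]
      simp
  inR_inJ r x := by
    have hr : r ∈ Algebra.adjoin k (primitives k R : Set R) := hR ▸ Algebra.mem_top
    induction hr using Algebra.adjoin_induction generalizing x with
    | mem v hv => rw [h2 v hv x, 𝓡.counit_eq_zero_of_mem_primitives hv, zero_mul]
    | algebraMap c =>
      rw [Algebra.algebraMap_eq_smul_one, map_smul 𝓡.inR, LinearMap.map_smul, map_one,
        LinearMap.smul_apply, hτ.one_left]
      simp [𝓢.counit_inJ, 𝓡.counit_one]
    | add x y _ _ hx hy =>
      simp only [alg_add, LinearMap.map_add, LinearMap.add_apply, hx, hy, add_mul]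
    | mul r r' _ _ hx hy =>
      rw [map_mul, hτ.mul_left, 𝓢.comul_inJ_eq_map, 𝓡.counit_mul]
      have h3 : ∀ X : K ⊗[k] K, LinearMap.mul' k k (TensorProduct.map (τ (𝓡.inR r))
          (τ (𝓡.inR r')) (TensorProduct.map 𝓢.inJ.toLinearMap 𝓢.inJ.toLinearMap X)) =
          (Coalgebra.counit (R := k) r * Coalgebra.counit (R := k) r') *
          Coalgebra.counit (R := k) (TensorProduct.lid k K (Coalgebra.counit.rTensor K X)) := by
        intro X
        induction X using TensorProduct.induction_on with
        | zero => simp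
        | add x y hx hy => simp only [LinearMap.map_add, LinearEquiv.map_add, mul_add, hx, hy]
        | tmul u v => simp [hx, hy]; ring
      rw [h3]
      simp

variable (h : IsMixedTrivial τ)
include hτ h

/-- Primitive elements of `S` act on `R` as `ε`-derivations. -/
lemma mul_primitive (r r' : R) {w : S} (hw : w ∈ primitives k S) :
    restrictRS τ (r * r') w = restrictRS τ r w * Coalgebra.counit (R := k) r' +
      Coalgebra.counit (R := k) r * restrictRS τ r' w := by
  have h0 := hτ.inR_mul_inR h r r' w
  have h1 : ∀ (Y : S ⊗[k] S) (_ : Y = w ⊗ₜ 1 + 1 ⊗ₜ w) (X : J ⊗[k] R), LinearMap.mul' k k (TensorProduct.map₂ (restrictRS τ)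
      (restrictRS τ ∘ₗ 𝓡.act.toLinearMap.flip r') (TensorProduct.comm k J R X) Y) =
      restrictRS τ (TensorProduct.lid k R (Coalgebra.counit.rTensor R X)) w *
        Coalgebra.counit (R := k) r' +
      restrictRS τ (𝓡.act (TensorProduct.rid k J (Coalgebra.counit.lTensor J X)) r') w := by
    intro Y hY X
    induction X using TensorProduct.induction_on with
    | zero => simp
    | add x y hx hy =>
      simp only [LinearMap.map_add, LinearEquiv.map_add, alg_add, LinearMap.add_apply, hx, hy]
      ring
    | tmul a t =>
      subst hY
      simp [TensorProduct.map₂_apply_tmul, hτ.one_right, 𝓡.counit_inR, 𝓡.counit_act]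
      ring
  rw [LinearMap.compl₁₂_apply]
  refine h0.trans ?_
  rw [h1 _ (mem_primitives.1 hw), 𝓡.counit_coact, 𝓡.coact_counit, Algebra.algebraMap_eq_smul_one]
  simp

/-- The powers of the spaces of primitive elements are orthogonal in different degrees. -/
lemma restrictRS_eq_zero_of_ne (m n : ℕ) (hmn : n ≠ m) (r : R) (hr : r ∈ primitives k R ^ n)
    (s : S) (hs : s ∈ primitives k S ^ m) : restrictRS τ r s = 0 := by
  -- The case `m = 1`, where `w` acts as an `ε`-derivation.
  have hw : ∀ n ≠ 1, ∀ r ∈ primitives k R ^ n, ∀ w ∈ primitives k S, restrictRS τ r w = 0 := by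
    intro n hn r hr w hw
    match n, hn with
    | 0, _ =>
      rw [pow_zero] at hr
      obtain ⟨c, rfl⟩ := Submodule.mem_one.1 hr
      rw [Algebra.algebraMap_eq_smul_one, LinearMap.map_smul, LinearMap.smul_apply,
        LinearMap.compl₁₂_apply, AlgHom.toLinearMap_apply, map_one, hτ.one_left,
        AlgHom.toLinearMap_apply, 𝓢.counit_inR, 𝓢.counit_eq_zero_of_mem_primitives hw, smul_zero]
    | n + 2, _ =>
      rw [pow_succ] at hr
      induction hr using Submodule.mul_induction_on' with
      | add x _ y _ hx hy => rw [LinearMap.map_add, LinearMap.add_apply, hx, hy, add_zero]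
      | mem_mul_mem x hx v hv =>
        rw [hτ.mul_primitive h x v hw, 𝓡.counit_eq_zero_of_mem_primitives hv,
          𝓡.counit_eq_zero_of_mem_primitives_pow n x hx]
        simp
  induction m generalizing n r s with
  | zero =>
    obtain ⟨n, rfl⟩ := Nat.exists_eq_succ_of_ne_zero hmn
    rw [pow_zero] at hs
    obtain ⟨c, rfl⟩ := Submodule.mem_one.1 hs
    rw [Algebra.algebraMap_eq_smul_one, LinearMap.map_smul, LinearMap.compl₁₂_apply,
      AlgHom.toLinearMap_apply, AlgHom.toLinearMap_apply, map_one, hτ.one_right, 𝓡.counit_inR,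
      𝓡.counit_eq_zero_of_mem_primitives_pow n r hr, smul_zero]
  | succ m ih =>
    rw [pow_succ] at hs
    induction hs using Submodule.mul_induction_on' with
    | add x _ y _ hx hy => rw [LinearMap.map_add, hx, hy, add_zero]
    | mem_mul_mem s hs w hws =>
    rw [LinearMap.compl₁₂_apply]
    refine (hτ.inR_inR_mul h r s w).trans ?_
    have h1 := 𝓡.comul_mem_of_mem_primitives_pow n r hr
    generalize Coalgebra.comul (R := k) r = X at h1
    induction h1 using Submodule.iSup_induction' with
    | zero => simp
    | add x y _ _ hx hy => simp only [LinearMap.map_add, hx, hy, add_zero]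
    | mem p X hX =>
    obtain ⟨⟨i, j⟩, hij⟩ := p
    simp only at hij hX
    rw [Submodule.map₂_eq_span_image2] at hX
    induction hX using Submodule.span_induction with
    | zero => simp
    | add x y _ _ hx hy => simp only [LinearMap.map_add, hx, hy, add_zero]
    | smul c x _ hx => simp only [LinearMap.map_smul, hx, smul_zero]
    | mem X hX =>
    obtain ⟨x, hx, y, hy, rfl⟩ := hX
    beta_reduce
    rw [TensorProduct.mk_apply, TensorProduct.map_tmul, LinearMap.mul'_apply]
    by_cases hi : i = 1
    · exact mul_eq_zero_of_right _ (ih j (by omega) y hy s hs)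
    · exact mul_eq_zero_of_left (hw i hi x hx w hws) _

end IsSkewPairing

/-! ### The canonical map from the tensor algebra of the primitive elements -/

namespace BraidedHopfAlgebra

variable {k J R : Type*} [Field k] [Ring J] [HopfAlgebra k J] [Ring R] [Algebra k R]
  [Coalgebra k R] (H : BraidedHopfAlgebra k J R)

variable (k R) in
/-- The algebra map `T(V) → R` extending the inclusion of `V = P(R)`. -/
noncomputable def ofTensorAlgebra : TensorAlgebra k (primitives k R) →ₐ[k] R :=
  TensorAlgebra.lift k (primitives k R).subtype

lemma ofTensorAlgebra_ι (v : primitives k R) :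
    ofTensorAlgebra k R (TensorAlgebra.ι k v) = v := by
  rw [ofTensorAlgebra, TensorAlgebra.lift_ι_apply]; rfl

lemma ofTensorAlgebra_surjective (hgen : Algebra.adjoin k (primitives k R : Set R) = ⊤) :
    Function.Surjective (ofTensorAlgebra k R) := by
  rw [← AlgHom.range_eq_top, eq_top_iff, ← hgen, Algebra.adjoin_le_iff]
  exact fun v hv => ⟨TensorAlgebra.ι k ⟨v, hv⟩, ofTensorAlgebra_ι _⟩

lemma ofTensorAlgebra_mem_pow (n : ℕ) (t : TensorAlgebra k (primitives k R))
    (ht : t ∈ LinearMap.range (TensorAlgebra.ι k : primitives k R →ₗ[k] _) ^ n) :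
    ofTensorAlgebra k R t ∈ primitives k R ^ n := by
  have h1 := Submodule.mem_map_of_mem (f := (ofTensorAlgebra k R).toLinearMap) ht
  rw [Submodule.map_pow, ← LinearMap.range_comp] at h1
  have h2 : (ofTensorAlgebra k R).toLinearMap ∘ₗ TensorAlgebra.ι k = (primitives k R).subtype :=
    LinearMap.ext ofTensorAlgebra_ι
  rwa [h2, Submodule.range_subtype] at h1

lemma ofTensorAlgebra_tensorAct (a : J) (t : TensorAlgebra k (primitives k R)) :
    ofTensorAlgebra k R (H.ydPrimitives.tensorAct a t) = H.act a (ofTensorAlgebra k R t) := by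
  induction t using TensorAlgebra.induction generalizing a with
  | algebraMap c =>
    have h1 := H.ydPrimitives.tensorActLin_one a
    change H.ydPrimitives.tensorAct a 1 = _ at h1
    rw [AlgHom.commutes, Algebra.algebraMap_eq_smul_one, Algebra.algebraMap_eq_smul_one,
      LinearMap.map_smul, h1, LinearMap.map_smul, H.act_one, map_smul, AlgHom.commutes]
  | ι v =>
    rw [YDModule.tensorAct_ι, ofTensorAlgebra_ι, ofTensorAlgebra_ι]
    rfl
  | add x y hx hy => simp only [LinearMap.map_add, alg_add, hx, hy]
  | mul x y hx hy =>
    have h1 := H.ydPrimitives.tensorActLin_mul a x y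
    change H.ydPrimitives.tensorAct a (x * y) = _ at h1
    rw [h1, map_mul, H.act_mul]
    induction (Coalgebra.comul a : J ⊗[k] J) using TensorProduct.induction_on with
    | zero => simp
    | add x y hx hy => simp only [LinearMap.map_add, LinearMap.add_apply, alg_add, hx, hy]
    | tmul u v =>
      simp only [TensorProduct.map₂_apply_tmul, TensorProduct.map_tmul, LinearMap.mul'_apply,
        map_mul]
      exact congrArg₂ _ (hx u) (hy v)

lemma coact_ofTensorAlgebra (t : TensorAlgebra k (primitives k R)) :
    H.coact (ofTensorAlgebra k R t) =
      (ofTensorAlgebra k R).toLinearMap.lTensor J (H.ydPrimitives.tensorCoact t) := by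
  have h1 : H.coactAlgHom.comp (ofTensorAlgebra k R) =
      (Algebra.TensorProduct.map (AlgHom.id k J) (ofTensorAlgebra k R)).comp
        H.ydPrimitives.tensorCoact := by
    apply TensorAlgebra.hom_ext
    ext v
    change H.coact (ofTensorAlgebra k R (TensorAlgebra.ι k v)) =
      (ofTensorAlgebra k R).toLinearMap.lTensor J
        (H.ydPrimitives.tensorCoact (TensorAlgebra.ι k v))
    have h2 : (ofTensorAlgebra k R).toLinearMap ∘ₗ TensorAlgebra.ι k =
        (primitives k R).subtype := LinearMap.ext ofTensorAlgebra_ι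
    rw [YDModule.tensorCoact_ι, ofTensorAlgebra_ι, ← LinearMap.comp_apply,
      ← LinearMap.lTensor_comp, h2]
    exact (H.toYDModule.restrict_coact _ H.act_mem_primitives H.coact_mem_primitives v).symm
  exact AlgHom.congr_fun h1 t

lemma comul_ofTensorAlgebra (t : TensorAlgebra k (primitives k R)) :
    Coalgebra.comul (R := k) (ofTensorAlgebra k R t) =
      TensorProduct.map (ofTensorAlgebra k R).toLinearMap (ofTensorAlgebra k R).toLinearMap
        (H.ydPrimitives.tensorComulLin t) := by
  let p := ofTensorAlgebra k R
  let M := H.ydPrimitives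
  let Φ : TwistedTensor M.tensorSquare →ₐ[k] TwistedTensor H.braidedSquare :=
    TwistedTensor.lift _ ((TwistedTensor.inl _).comp p) ((TwistedTensor.inr _).comp p) (by
      intro x y
      have hc := H.coact_ofTensorAlgebra y
      rw [AlgHom.comp_apply, AlgHom.comp_apply, TwistedTensor.inr_mul_inl,
        TwistedTensor.braid_eq_T, TwistedTensor.braid_eq_T]
      have h1 : H.braidedSquare.coact (p y) =
        p.toLinearMap.lTensor J (M.tensorSquare.coact y) := hc
      change TwistedTensor.ofTensor _ (H.braidedSquare.T 1 (p x) 1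
        (H.braidedSquare.coact (p y))) = _
      rw [h1]
      change _ = LinearMap.mul' k _ (TensorProduct.map _ _
        (M.tensorSquare.T 1 x 1 (M.tensorSquare.coact y)))
      induction M.tensorSquare.coact y using TensorProduct.induction_on with
      | zero => simp
      | add x y hx hy => simp only [LinearMap.map_add, LinearEquiv.map_add, hx, hy]
      | tmul a z =>
        have h2 : p (M.tensorSquare.act a x) = H.braidedSquare.act a (p x) :=
          H.ofTensorAlgebra_tensorAct a x
        simp [SmashData.T_tmul, TwistedTensor.inl_mul_inr, h2])
  have h1 : H.comulAlgHom.comp p = Φ.comp M.tensorComul := by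
    apply TensorAlgebra.hom_ext
    ext v
    have h2 : M.tensorComul (TensorAlgebra.ι k v) =
        TwistedTensor.inl _ (TensorAlgebra.ι k v) + TwistedTensor.inr _ (TensorAlgebra.ι k v) := by
      rw [YDModule.tensorComul, TensorAlgebra.lift_ι_apply]; rfl
    change TwistedTensor.ofTensor H.braidedSquare
      (Coalgebra.comul (R := k) (p (TensorAlgebra.ι k v))) =
      Φ (M.tensorComul (TensorAlgebra.ι k v))
    rw [h2, alg_add, TwistedTensor.lift_inl, TwistedTensor.lift_inr, AlgHom.comp_apply,
      AlgHom.comp_apply, ofTensorAlgebra_ι, mem_primitives.1 v.2]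
    rfl
  have h2 : ∀ X : TensorAlgebra k (primitives k R) ⊗[k] TensorAlgebra k (primitives k R),
      Φ (TwistedTensor.ofTensor _ X) = TwistedTensor.ofTensor H.braidedSquare
        (TensorProduct.map p.toLinearMap p.toLinearMap X) := by
    intro X
    induction X using TensorProduct.induction_on with
    | zero => simp
    | add x y hx hy => simp only [LinearMap.map_add, LinearEquiv.map_add, alg_add, hx, hy]
    | tmul u v =>
      rw [TwistedTensor.lift_ofTensor, AlgHom.comp_apply, AlgHom.comp_apply,
        TwistedTensor.inl_mul_inr]
      rfl
  apply (TwistedTensor.ofTensor H.braidedSquare).injective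
  rw [← h2]
  exact AlgHom.congr_fun h1 t

include H in
lemma counit_ofTensorAlgebra (t : TensorAlgebra k (primitives k R)) :
    Coalgebra.counit (R := k) (ofTensorAlgebra k R t) = TensorAlgebra.algebraMapInv t := by
  have h1 : H.counitR.comp (ofTensorAlgebra k R) = TensorAlgebra.algebraMapInv := by
    apply TensorAlgebra.hom_ext
    ext v
    change Coalgebra.counit (R := k) (ofTensorAlgebra k R (TensorAlgebra.ι k v)) =
      TensorAlgebra.algebraMapInv (TensorAlgebra.ι k v)
    rw [ofTensorAlgebra_ι, H.counit_eq_zero_of_mem_primitives v.2, TensorAlgebra.algebraMapInv,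
      TensorAlgebra.lift_ι_apply]
    rfl
  exact AlgHom.congr_fun h1 t

/-- If `R` is generated by `V = P(R)`, then `R` is a Nichols algebra if and only if the kernel of
`T(V) → R` is the ideal defining `𝔅(V)`. -/
lemma isNichols_iff_mem_nicholsIdeal
    (hgen : Algebra.adjoin k (primitives k R : Set R) = ⊤) :
    H.IsNichols ↔ ∀ t, t ∈ H.ydPrimitives.nicholsIdeal ↔ ofTensorAlgebra k R t = 0 := by
  let M := H.ydPrimitives
  have hmk : ∀ t, t ∈ M.nicholsIdeal ↔ M.nicholsMk t = 0 := fun t => by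
    rw [TwoSidedIdeal.mem_iff]
    exact (RingCon.eq M.nicholsIdeal.ringCon).symm
  constructor
  · rintro ⟨e, he, -⟩ t
    have h1 : e.toAlgHom.comp M.nicholsMk = ofTensorAlgebra k R := by
      apply TensorAlgebra.hom_ext
      ext v
      exact (he v).trans (ofTensorAlgebra_ι v).symm
    have h2 : e (M.nicholsMk t) = ofTensorAlgebra k R t := AlgHom.congr_fun h1 t
    rw [hmk, ← h2]
    exact (map_eq_zero_iff e e.injective).symm
  · intro hI
    let f : M.NicholsAlgebra →ₐ[k] R := M.nicholsIdeal.ringCon.liftₐ (ofTensorAlgebra k R) (by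
      intro x y hxy
      have h1 : x - y ∈ M.nicholsIdeal := (TwoSidedIdeal.rel_iff _ _ _).1 hxy
      have h2 := (hI _).1 h1
      rw [map_sub, sub_eq_zero] at h2
      exact h2)
    have hf : ∀ t, f (M.nicholsMk t) = ofTensorAlgebra k R t := fun t => rfl
    have hbij : Function.Bijective f := by
      constructor
      · rw [injective_iff_map_eq_zero]
        intro x hx
        obtain ⟨t, rfl⟩ := M.nicholsIdeal.ringCon.mkₐ_surjective (α := k) x
        exact (hmk t).1 ((hI t).2 hx)
      · intro r
        obtain ⟨t, rfl⟩ := ofTensorAlgebra_surjective hgen r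
        exact ⟨_, hf t⟩
    let e := AlgEquiv.ofBijective f hbij
    have he : ∀ t, e (M.nicholsMk t) = ofTensorAlgebra k R t := hf
    have he' : e.toLinearMap ∘ₗ M.nicholsMk.toLinearMap = (ofTensorAlgebra k R).toLinearMap :=
      LinearMap.ext hf
    refine ⟨e, fun v => (he _).trans (ofTensorAlgebra_ι v), ?_, ?_, ?_, ?_, ?_⟩
    · intro g hg
      have h1 : g.comp M.nicholsMk = ofTensorAlgebra k R := by
        apply TensorAlgebra.hom_ext
        ext v
        exact (hg v).trans (ofTensorAlgebra_ι v).symm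
      refine AlgHom.ext fun x => ?_
      obtain ⟨t, rfl⟩ := M.nicholsIdeal.ringCon.mkₐ_surjective (α := k) x
      exact AlgHom.congr_fun h1 t
    · intro a t
      rw [he, he, ofTensorAlgebra_tensorAct]
    · intro t
      rw [he, he', coact_ofTensorAlgebra]
    · intro t
      rw [he, he', H.comul_ofTensorAlgebra]
    · intro t
      rw [he, H.counit_ofTensorAlgebra]

end BraidedHopfAlgebra

/-! ### Radicals of pairings and Nichols ideals -/

/-- A functional on `T(V)` that vanishes in all degrees but `n` only sees the component of
degree `n`. -/
lemma apply_decompose_eq {k V : Type*} [Field k] [AddCommGroup V] [Module k V]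
    (f : TensorAlgebra k V →ₗ[k] k) (n : ℕ)
    (hf : ∀ i ≠ n, ∀ t ∈ LinearMap.range (TensorAlgebra.ι k : V →ₗ[k] _) ^ i, f t = 0)
    (t : TensorAlgebra k V) :
    f (DirectSum.decompose
      (fun n : ℕ => LinearMap.range (TensorAlgebra.ι k : V →ₗ[k] TensorAlgebra k V) ^ n) t n) =
      f t := by
  classical
  let 𝒜 := fun n : ℕ => LinearMap.range (TensorAlgebra.ι k : V →ₗ[k] TensorAlgebra k V) ^ n
  have h1 := congrArg f (DirectSum.sum_support_decompose 𝒜 t)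
  rw [← h1, map_sum, Finset.sum_eq_single n]
  · exact fun i _ hi => hf i hi _ (DirectSum.decompose 𝒜 t i).2
  · intro hn
    rw [DFinsupp.notMem_support_iff.1 hn]
    simp

lemma YDModule.mem_idealSubmodule {k V : Type*} [Field k] [AddCommGroup V] [Module k V]
    {I : TwoSidedIdeal (TensorAlgebra k V)} {t : TensorAlgebra k V} :
    t ∈ idealSubmodule I ↔ t ∈ I := by
  rw [TwoSidedIdeal.mem_iff]
  exact RingCon.eq I.ringCon

namespace BraidedHopfAlgebra

variable {k J R Z Y : Type*} [Field k] [Ring J] [HopfAlgebra k J] [Ring R] [Algebra k R]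
  [Coalgebra k R] [AddCommGroup Z] [Module k Z] [AddCommGroup Y] [Module k Y]
  (H : BraidedHopfAlgebra k J R)

/-- The properties of a pairing `β : R ⊗ Y → k`, with a grading-like family `W` of subspaces of `Y`,
which make its radical in `R` a braided bi-ideal, homogeneous with respect to the degree in the
primitive elements. The pairing `α : J ⊗ Z → k` is used to detect elements of `J ⊗ rad β`. -/
structure HasHopfRadical (α : J →ₗ[k] Z →ₗ[k] k) (β : R →ₗ[k] Y →ₗ[k] k)
    (W : ℕ → Submodule k Y) : Prop where
  separatingLeft : α.SeparatingLeft
  iSup_eq_top : ⨆ n, W n = ⊤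
  orthogonal : ∀ m n, n ≠ m → ∀ r ∈ primitives k R ^ n, ∀ y ∈ W m, β r y = 0
  mul_left : ∀ r r', β r' = 0 → β (r * r') = 0
  mul_right : ∀ r r', β r = 0 → β (r * r') = 0
  act : ∀ a r, β r = 0 → β (H.act a r) = 0
  coact : ∀ r, β r = 0 → ∀ z y,
    LinearMap.mul' k k (TensorProduct.map (α.flip z) (β.flip y) (H.coact r)) = 0
  comul : ∀ r, β r = 0 → ∀ y y',
    LinearMap.mul' k k (TensorProduct.map (β.flip y) (β.flip y') (Coalgebra.comul r)) = 0
  counit : ∀ r, β r = 0 → Coalgebra.counit (R := k) r = 0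

namespace HasHopfRadical

variable {H} {α : J →ₗ[k] Z →ₗ[k] k} {β : R →ₗ[k] Y →ₗ[k] k} {W : ℕ → Submodule k Y}
  (hβ : H.HasHopfRadical α β W)

/-- The ideal of all `t ∈ T(V)` whose image in `R` lies in the radical. -/
noncomputable def ideal : TwoSidedIdeal (TensorAlgebra k (primitives k R)) :=
  TwoSidedIdeal.mk' {t | β (ofTensorAlgebra k R t) = 0} (by simp)
    (fun {x y} hx hy => by
      rw [Set.mem_ofPred_eq] at hx hy ⊢
      rw [alg_add, LinearMap.map_add, hx, hy, add_zero])
    (fun {x} hx => by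
      rw [Set.mem_ofPred_eq] at hx ⊢
      rw [map_neg, map_neg, hx, neg_zero])
    (fun {x y} hy => by
      rw [Set.mem_ofPred_eq] at hy ⊢
      rw [map_mul]
      exact hβ.mul_left _ _ hy)
    (fun {x y} hx => by
      rw [Set.mem_ofPred_eq] at hx ⊢
      rw [map_mul]
      exact hβ.mul_right _ _ hx)

lemma mem_ideal {t : TensorAlgebra k (primitives k R)} :
    t ∈ hβ.ideal ↔ β (ofTensorAlgebra k R t) = 0 :=
  TwoSidedIdeal.mem_mk' ..

lemma idealSubmodule_ideal : YDModule.idealSubmodule hβ.ideal =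
    LinearMap.ker (β ∘ₗ (ofTensorAlgebra k R).toLinearMap) := by
  ext t
  rw [YDModule.mem_idealSubmodule, mem_ideal]
  rfl

include hβ in
lemma apply_decompose_apply (t : TensorAlgebra k (primitives k R)) (n : ℕ) (y : Y) (hy : y ∈ W n) :
    β (ofTensorAlgebra k R (DirectSum.decompose
      (fun n : ℕ => LinearMap.range (TensorAlgebra.ι k :
        primitives k R →ₗ[k] TensorAlgebra k (primitives k R)) ^ n) t n)) y =
      β (ofTensorAlgebra k R t) y :=
  apply_decompose_eq (β.flip y ∘ₗ (ofTensorAlgebra k R).toLinearMap) n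
    (fun i hi t ht => hβ.orthogonal n i hi _ (ofTensorAlgebra_mem_pow i t ht) y hy) t

/-- If the radical contains no non-zero primitive element, its preimage in `T(V)` is one of the
ideals whose supremum defines the Nichols algebra. -/
lemma isNicholsIdeal (hinj : ∀ v ∈ primitives k R, β v = 0 → v = 0) :
    H.ydPrimitives.IsNicholsIdeal hβ.ideal where
  homogeneous t ht n := by
    rw [mem_ideal] at ht ⊢
    rw [← LinearMap.ker_eq_top, eq_top_iff, ← hβ.iSup_eq_top]
    refine iSup_le fun m y hy => LinearMap.mem_ker.2 ?_
    by_cases hmn : n = m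
    · subst hmn
      rw [hβ.apply_decompose_apply t n y hy, ht, LinearMap.zero_apply]
    · exact hβ.orthogonal m n hmn _
        (ofTensorAlgebra_mem_pow n _ (Subtype.property _)) y hy
  act_mem a t ht := by
    rw [mem_ideal] at ht ⊢
    rw [ofTensorAlgebra_tensorAct]
    exact hβ.act a _ ht
  coact_mem t ht := by
    rw [mem_ideal] at ht
    rw [idealSubmodule_ideal]
    refine mem_range_lTensor_of_forall_pairing_eq_zero hβ.separatingLeft _ _ fun z y => ?_
    have h1 := hβ.coact _ ht z y
    rw [coact_ofTensorAlgebra, LinearMap.lTensor, ← LinearMap.comp_apply (TensorProduct.map _ _),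
      ← TensorProduct.map_comp, LinearMap.comp_id] at h1
    exact h1
  comul_mem t ht := by
    rw [mem_ideal] at ht
    rw [idealSubmodule_ideal]
    refine mem_sup_of_forall_pairing_eq_zero _ _ _ fun y y' => ?_
    have h1 := hβ.comul _ ht y y'
    rw [H.comul_ofTensorAlgebra, ← LinearMap.comp_apply (TensorProduct.map _ _),
      ← TensorProduct.map_comp] at h1
    exact h1
  counit_eq_zero t ht := by
    rw [mem_ideal] at ht
    rw [← H.counit_ofTensorAlgebra]
    exact hβ.counit _ ht
  inter_eq_zero v hv := by
    rw [mem_ideal, ofTensorAlgebra_ι] at hv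
    exact Subtype.ext (hinj v v.2 hv)

include hβ in
/-- The components of degree `1` of elements of a Nichols ideal vanish, so the ideal is orthogonal
to all elements of degree `1`. -/
lemma apply_eq_zero_of_isNicholsIdeal {I : TwoSidedIdeal (TensorAlgebra k (primitives k R))}
    (hI : H.ydPrimitives.IsNicholsIdeal I) {t : TensorAlgebra k (primitives k R)} (ht : t ∈ I)
    {y : Y} (hy : y ∈ W 1) : β (ofTensorAlgebra k R t) y = 0 := by
  have h1 : ∀ u ∈ LinearMap.range (TensorAlgebra.ι k : primitives k R →ₗ[k] _) ^ 1, u ∈ I →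
      β (ofTensorAlgebra k R u) y = 0 := by
    intro u hu hu'
    rw [pow_one] at hu
    obtain ⟨v, rfl⟩ := hu
    rw [hI.inter_eq_zero v hu']
    simp
  rw [← hβ.apply_decompose_apply t 1 y hy]
  exact h1 _ (Subtype.property _) (hI.homogeneous t ht 1)

include hβ in
/-- If `R` is generated by primitive elements, no non-zero primitive element lies in the radical,
and the Nichols ideals map into the radical, then `R` is a Nichols algebra if and only if the
radical is zero. -/
theorem isNichols_iff (hgen : Algebra.adjoin k (primitives k R : Set R) = ⊤)
    (hinj : ∀ v ∈ primitives k R, β v = 0 → v = 0)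
    (hI : ∀ I, H.ydPrimitives.IsNicholsIdeal I → ∀ t ∈ I, β (ofTensorAlgebra k R t) = 0) :
    H.IsNichols ↔ ∀ r, β r = 0 → r = 0 := by
  have h1 : H.ydPrimitives.nicholsIdeal = hβ.ideal :=
    le_antisymm (sSup_le fun I hI' t ht => hβ.mem_ideal.2 (hI I hI' t ht))
      (le_sSup (hβ.isNicholsIdeal hinj))
  rw [H.isNichols_iff_mem_nicholsIdeal hgen, h1]
  simp only [mem_ideal]
  constructor
  · intro h r hr
    obtain ⟨t, rfl⟩ := ofTensorAlgebra_surjective hgen r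
    exact (h t).1 hr
  · exact fun h t => ⟨h _, fun ht => by rw [ht, LinearMap.map_zero]⟩

end HasHopfRadical
end BraidedHopfAlgebra

/-! ### Radicals of the pairing of `R` and `S` -/

namespace IsSkewPairing

variable {k J K R S : Type*} [Field k] [Ring J] [HopfAlgebra k J] [Ring K]
  [HopfAlgebra k K] [Ring R] [Algebra k R] [Coalgebra k R] [Ring S] [Algebra k S] [Coalgebra k S]
  {𝓡 : BraidedHopfAlgebra k J R} {𝓢 : BraidedHopfAlgebra k K S}
  {τ : 𝓡.Bosonization →ₗ[k] 𝓢.Bosonization →ₗ[k] k} (hτ : IsSkewPairing τ)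
  (h : IsMixedTrivial τ)

open BraidedHopfAlgebra

/-- The expression `∑ τ(r₀, s₍₁₎) τ(r₋₁ ▷ r', s₍₂₎)` for `τ(r r', s)` vanishes if `ker γ` is a
subcomodule containing `r` such that `∑ τ(u, s₍₁₎) τ(r'', s₍₂₎) = 0` for all `u` in it. -/
lemma mul'_map₂_comm_coact_eq_zero {N : Type*} [AddCommGroup N] [Module k N]
    (γ : R →ₗ[k] N) (r r' : R)
    (hr : 𝓡.coact r ∈ LinearMap.range ((LinearMap.ker γ).subtype.lTensor J))
    (Y : S ⊗[k] S) (hY : ∀ u r'', γ u = 0 → LinearMap.mul' k k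
      (TensorProduct.map (restrictRS τ u) (restrictRS τ r'') Y) = 0) :
    LinearMap.mul' k k (TensorProduct.map₂ (restrictRS τ)
      (restrictRS τ ∘ₗ 𝓡.act.toLinearMap.flip r') (TensorProduct.comm k J R (𝓡.coact r))
      Y) = 0 := by
  obtain ⟨X, hX⟩ := hr
  rw [← hX]
  clear hX
  induction X using TensorProduct.induction_on with
  | zero => simp
  | add x y hx hy =>
    simp only [LinearMap.map_add, LinearEquiv.map_add, LinearMap.add_apply, hx, hy, add_zero]
  | tmul a u =>
    rw [LinearMap.lTensor_tmul, TensorProduct.comm_tmul, TensorProduct.map₂_apply_tmul]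
    exact hY u _ u.2

include hτ h

/-- The left radical of the pairing of `R` and `S`. It is stable under the action by `act_left`,
and under the coaction by `act_right` and the bijectivity of the antipode of `K`. -/
lemma hasHopfRadical_left (hK : Function.Bijective (HopfAlgebra.antipode k : K →ₗ[k] K))
    (hJK : (τ.compl₁₂ 𝓡.inJ.toLinearMap 𝓢.inJ.toLinearMap).Nondegenerate)
    (hS : Algebra.adjoin k (primitives k S : Set S) = ⊤) :
    𝓡.HasHopfRadical (τ.compl₁₂ 𝓡.inJ.toLinearMap 𝓢.inJ.toLinearMap) (restrictRS τ)
      (fun n => primitives k S ^ n) := by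
  have hact : ∀ a r, restrictRS τ r = 0 → restrictRS τ (𝓡.act a r) = 0 := by
    intro a r hr
    ext s
    refine (hτ.act_left h a r s).trans ?_
    have : τ (𝓡.inR r) ∘ₗ 𝓢.inR.toLinearMap = 0 := hr
    rw [this, TensorProduct.map_zero_right]
    simp
  have hcoact : ∀ r, restrictRS τ r = 0 → ∀ z y, LinearMap.mul' k k (TensorProduct.map
      ((τ.compl₁₂ 𝓡.inJ.toLinearMap 𝓢.inJ.toLinearMap).flip z) ((restrictRS τ).flip y)
      (𝓡.coact r)) = 0 := by
    intro r hr z y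
    obtain ⟨x, rfl⟩ := hK.2 z
    exact (hτ.act_right h r x y).symm.trans (LinearMap.congr_fun hr (𝓢.act x y))
  refine ⟨hJK.1, iSup_pow_eq_top hS, fun m n hmn r hr s hs =>
    hτ.restrictRS_eq_zero_of_ne h m n hmn r hr s hs, ?_, ?_, hact, hcoact, ?_, ?_⟩
  · intro r r' hr'
    ext s
    refine (hτ.inR_mul_inR h r r' s).trans ?_
    have : restrictRS τ ∘ₗ 𝓡.act.toLinearMap.flip r' = 0 :=
      LinearMap.ext fun a => hact a r' hr'
    rw [this]
    generalize TensorProduct.comm k J R (𝓡.coact r) = X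
    generalize (Coalgebra.comul s : S ⊗[k] S) = Y
    induction X using TensorProduct.induction_on with
    | zero => simp
    | add x y hx hy =>
      simp only [LinearMap.map_add, LinearMap.add_apply, hx, hy, LinearMap.zero_apply, add_zero]
    | tmul u a => simp [TensorProduct.map₂_apply_tmul]
  · intro r r' hr
    ext s
    refine (hτ.inR_mul_inR h r r' s).trans (mul'_map₂_comm_coact_eq_zero (restrictRS τ) r r'
      (mem_range_lTensor_of_forall_pairing_eq_zero hJK.1 _ _ (hcoact r hr)) _
      fun u r'' hu => ?_)
    rw [hu, TensorProduct.map_zero_left]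
    simp
  · intro r hr s s'
    exact (hτ.inR_inR_mul h r s' s).symm.trans (LinearMap.congr_fun hr (s' * s))
  · intro r hr
    have := LinearMap.congr_fun hr 1
    simpa [hτ.one_right, 𝓡.counit_inR] using this

/-- The right radical of the pairing of `R` and `S`. That it is a coideal is `comul_right`, which
needs the inverse of the antipode of `J`. -/
lemma hasHopfRadical_right (hJ : Function.Bijective (HopfAlgebra.antipode k : J →ₗ[k] J))
    (hJK : (τ.compl₁₂ 𝓡.inJ.toLinearMap 𝓢.inJ.toLinearMap).Nondegenerate)
    (hR : Algebra.adjoin k (primitives k R : Set R) = ⊤) :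
    𝓢.HasHopfRadical (τ.compl₁₂ 𝓡.inJ.toLinearMap 𝓢.inJ.toLinearMap).flip (restrictRS τ).flip
      (fun n => primitives k R ^ n) := by
  obtain ⟨T, hT, hT'⟩ := exists_antipodeInv hJ
  refine ⟨LinearMap.flip_separatingLeft.2 hJK.2, iSup_pow_eq_top hR, fun m n hmn s hs r hr =>
    hτ.restrictRS_eq_zero_of_ne h n m hmn.symm r hr s hs, ?_, ?_, ?_, ?_, ?_, ?_⟩
  · intro s s' hs'
    ext r
    refine (hτ.inR_inR_mul h r s s').trans ?_
    have : τ.flip (𝓢.inR s') ∘ₗ 𝓡.inR.toLinearMap = 0 := hs'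
    rw [this, TensorProduct.map_zero_left]
    simp
  · intro s s' hs
    ext r
    refine (hτ.inR_inR_mul h r s s').trans ?_
    have : τ.flip (𝓢.inR s) ∘ₗ 𝓡.inR.toLinearMap = 0 := hs
    rw [this, TensorProduct.map_zero_right]
    simp
  · intro x s hs
    ext r
    refine (hτ.act_right h r x s).trans ?_
    have : τ.flip (𝓢.inR s) ∘ₗ 𝓡.inR.toLinearMap = 0 := hs
    rw [this, TensorProduct.map_zero_right]
    simp
  · intro s hs a r
    exact (hτ.act_left h a r s).symm.trans (LinearMap.congr_fun hs (𝓡.act a r))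
  · intro s hs r r'
    refine (hτ.comul_right h hT hT' r r' s).trans ?_
    have : τ.flip (𝓢.inR s) ∘ₗ 𝓡.inR.toLinearMap = 0 := hs
    have h0 : TensorProduct.lift ((LinearMap.mul k R).compr₂ (0 : R →ₗ[k] k)) = 0 := by
      ext; simp
    rw [this, h0, LinearMap.zero_apply]
  · intro s hs
    have := LinearMap.congr_fun hs 1
    simpa [hτ.one_left, 𝓢.counit_inR] using this

/-- Every ideal `I` as in the definition of the Nichols algebra maps into the left radical: the
elements of `S` orthogonal to the image of `I` form a subalgebra, because `I` is a coideal, and this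
subalgebra contains the generators of degree `1`. -/
lemma restrictRS_eq_zero_of_isNicholsIdeal
    (hrad : 𝓡.HasHopfRadical (τ.compl₁₂ 𝓡.inJ.toLinearMap 𝓢.inJ.toLinearMap) (restrictRS τ)
      (fun n => primitives k S ^ n))
    (hS : Algebra.adjoin k (primitives k S : Set S) = ⊤)
    (I : TwoSidedIdeal (TensorAlgebra k (primitives k R))) (hI : 𝓡.ydPrimitives.IsNicholsIdeal I)
    (t : TensorAlgebra k (primitives k R)) (ht : t ∈ I) :
    restrictRS τ (ofTensorAlgebra k R t) = 0 := by
  ext s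
  have hs : s ∈ Algebra.adjoin k (primitives k S : Set S) := hS ▸ Algebra.mem_top
  have h1 : ∀ t ∈ I, restrictRS τ (ofTensorAlgebra k R t) 1 = 0 := fun t ht => by
    rw [LinearMap.compl₁₂_apply, AlgHom.toLinearMap_apply, AlgHom.toLinearMap_apply, map_one,
      hτ.one_right, 𝓡.counit_inR, 𝓡.counit_ofTensorAlgebra, hI.counit_eq_zero t ht]
  induction hs using Algebra.adjoin_induction generalizing t with
  | mem w hw => exact hrad.apply_eq_zero_of_isNicholsIdeal hI ht (by simpa using hw)
  | algebraMap c =>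
    rw [Algebra.algebraMap_eq_smul_one, LinearMap.map_smul, h1 t ht]
    simp
  | add x y _ _ hx hy => rw [LinearMap.map_add, hx t ht, hy t ht]; simp
  | mul x y _ _ hx hy =>
    refine (hτ.inR_inR_mul h _ x y).trans ?_
    rw [𝓡.comul_ofTensorAlgebra]
    obtain ⟨A, ⟨A, rfl⟩, B, ⟨B, rfl⟩, hAB⟩ := Submodule.mem_sup.1 (hI.comul_mem t ht)
    rw [← hAB, LinearMap.map_add, LinearMap.map_add, LinearMap.map_add]
    have hA : ∀ A, LinearMap.mul' k k (TensorProduct.map (τ.flip (𝓢.inR y) ∘ₗ 𝓡.inR.toLinearMap)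
        (τ.flip (𝓢.inR x) ∘ₗ 𝓡.inR.toLinearMap) (TensorProduct.map
          (ofTensorAlgebra k R).toLinearMap (ofTensorAlgebra k R).toLinearMap
          ((YDModule.idealSubmodule I).subtype.rTensor _ A))) = 0 := by
      intro A
      induction A using TensorProduct.induction_on with
      | zero => simp
      | add x y hx hy => simp only [LinearMap.map_add, hx, hy, add_zero]
      | tmul u v =>
        have := hy u (YDModule.mem_idealSubmodule.1 u.2)
        exact mul_eq_zero_of_left this _
    have hB : ∀ A, LinearMap.mul' k k (TensorProduct.map (τ.flip (𝓢.inR y) ∘ₗ 𝓡.inR.toLinearMap)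
        (τ.flip (𝓢.inR x) ∘ₗ 𝓡.inR.toLinearMap) (TensorProduct.map
          (ofTensorAlgebra k R).toLinearMap (ofTensorAlgebra k R).toLinearMap
          ((YDModule.idealSubmodule I).subtype.lTensor _ A))) = 0 := by
      intro A
      induction A using TensorProduct.induction_on with
      | zero => simp
      | add x y hx hy => simp only [LinearMap.map_add, hx, hy, add_zero]
      | tmul u v =>
        have := hx v (YDModule.mem_idealSubmodule.1 v.2)
        exact mul_eq_zero_of_right _ this
    rw [hA, hB]
    simp

/-- The analogue of `restrictRS_eq_zero_of_isNicholsIdeal` for the right radical. The orthogonal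
complement `ker γ` of the image of `I` is a subalgebra of `R` because it is also a
Yetter-Drinfeld submodule. -/
lemma flip_restrictRS_eq_zero_of_isNicholsIdeal
    (hK : Function.Bijective (HopfAlgebra.antipode k : K →ₗ[k] K))
    (hJK : (τ.compl₁₂ 𝓡.inJ.toLinearMap 𝓢.inJ.toLinearMap).Nondegenerate)
    (hrad : 𝓢.HasHopfRadical (τ.compl₁₂ 𝓡.inJ.toLinearMap 𝓢.inJ.toLinearMap).flip
      (restrictRS τ).flip (fun n => primitives k R ^ n))
    (hR : Algebra.adjoin k (primitives k R : Set R) = ⊤)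
    (I : TwoSidedIdeal (TensorAlgebra k (primitives k S))) (hI : 𝓢.ydPrimitives.IsNicholsIdeal I)
    (t : TensorAlgebra k (primitives k S)) (ht : t ∈ I) :
    (restrictRS τ).flip (ofTensorAlgebra k S t) = 0 := by
  let q := ofTensorAlgebra k S
  let I' := YDModule.idealSubmodule I
  let γ : R →ₗ[k] I' →ₗ[k] k :=
    (restrictRS τ).compl₁₂ LinearMap.id (q.toLinearMap ∘ₗ I'.subtype)
  have hγ : ∀ r, γ r = 0 → ∀ t ∈ I, restrictRS τ r (q t) = 0 := fun r hr t ht =>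
    LinearMap.congr_fun hr ⟨t, YDModule.mem_idealSubmodule.2 ht⟩
  have hγ' : ∀ r, (∀ t ∈ I, restrictRS τ r (q t) = 0) → γ r = 0 := fun r hr =>
    LinearMap.ext fun t => hr t (YDModule.mem_idealSubmodule.1 t.2)
  have hact : ∀ a r, γ r = 0 → γ (𝓡.act a r) = 0 := by
    intro a r hr
    refine hγ' _ fun t ht => ?_
    refine (hτ.act_left h a r _).trans ?_
    obtain ⟨X, hX⟩ := hI.coact_mem t ht
    rw [𝓢.coact_ofTensorAlgebra, ← hX]
    clear hX
    induction X using TensorProduct.induction_on with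
    | zero => simp
    | add x y hx hy => simp only [LinearMap.map_add, hx, hy, add_zero]
    | tmul x u => exact mul_eq_zero_of_right _ (hγ r hr u (YDModule.mem_idealSubmodule.1 u.2))
  have hcoact : ∀ r, γ r = 0 → 𝓡.coact r ∈
      LinearMap.range ((LinearMap.ker γ).subtype.lTensor J) := by
    intro r hr
    refine mem_range_lTensor_of_forall_pairing_eq_zero hJK.1 _ _ fun z u => ?_
    obtain ⟨x, rfl⟩ := hK.2 z
    refine (hτ.act_right h r x (q u)).symm.trans ?_
    rw [← 𝓢.ofTensorAlgebra_tensorAct]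
    exact hγ r hr _ (hI.act_mem x u (YDModule.mem_idealSubmodule.1 u.2))
  suffices H : ∀ r, γ r = 0 from LinearMap.ext fun r => hγ r (H r) t ht
  intro r
  have hr : r ∈ Algebra.adjoin k (primitives k R : Set R) := hR ▸ Algebra.mem_top
  induction hr using Algebra.adjoin_induction with
  | mem v hv =>
    exact hγ' v fun t ht => hrad.apply_eq_zero_of_isNicholsIdeal hI ht (by simpa using hv)
  | algebraMap c =>
    rw [Algebra.algebraMap_eq_smul_one, LinearMap.map_smul, hγ' 1, smul_zero]
    intro t ht
    rw [LinearMap.compl₁₂_apply, AlgHom.toLinearMap_apply, AlgHom.toLinearMap_apply, map_one,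
      hτ.one_left, 𝓢.counit_inR, 𝓢.counit_ofTensorAlgebra, hI.counit_eq_zero t ht]
  | add x y _ _ hx hy => rw [LinearMap.map_add, hx, hy, add_zero]
  | mul r r' _ _ hr hr' =>
    refine hγ' _ fun t ht => ?_
    refine (hτ.inR_mul_inR h r r' _).trans ?_
    rw [𝓢.comul_ofTensorAlgebra]
    obtain ⟨A, ⟨A, rfl⟩, B, ⟨B, rfl⟩, hAB⟩ := Submodule.mem_sup.1 (hI.comul_mem t ht)
    rw [← hAB, LinearMap.map_add, LinearMap.map_add, LinearMap.map_add]
    have hA : ∀ u r'', γ u = 0 → LinearMap.mul' k k (TensorProduct.map (restrictRS τ u)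
        (restrictRS τ r'') (TensorProduct.map q.toLinearMap q.toLinearMap
          (I'.subtype.rTensor _ A))) = 0 := by
      intro u r'' hu
      clear hAB
      induction A using TensorProduct.induction_on with
      | zero => simp
      | add x y hx hy => simp only [LinearMap.map_add, hx, hy, add_zero]
      | tmul x y => exact mul_eq_zero_of_left (hγ u hu x (YDModule.mem_idealSubmodule.1 x.2)) _
    rw [mul'_map₂_comm_coact_eq_zero γ r r' (hcoact r hr) _ hA, zero_add]
    clear hAB
    generalize TensorProduct.comm k J R (𝓡.coact r) = X
    induction X using TensorProduct.induction_on with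
    | zero => simp
    | add x y hx hy => simp only [LinearMap.map_add, LinearMap.add_apply, hx, hy, add_zero]
    | tmul u a =>
      rw [TensorProduct.map₂_apply_tmul]
      induction B using TensorProduct.induction_on with
      | zero => simp
      | add x y hx hy => simp only [LinearMap.map_add, hx, hy, add_zero]
      | tmul x y =>
        exact mul_eq_zero_of_right _
          (hγ _ (hact a r' hr') y (YDModule.mem_idealSubmodule.1 y.2))

/-- The pairing of `R` and `S` is non-degenerate if and only if `R` and `S` are Nichols algebras
and the pairing of their spaces of primitive elements is non-degenerate. -/
theorem nondegenerate_restrictRS_iff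
    (hJ : Function.Bijective (HopfAlgebra.antipode k : J →ₗ[k] J))
    (hK : Function.Bijective (HopfAlgebra.antipode k : K →ₗ[k] K))
    (hJK : (τ.compl₁₂ 𝓡.inJ.toLinearMap 𝓢.inJ.toLinearMap).Nondegenerate)
    (hR : Algebra.adjoin k (primitives k R : Set R) = ⊤)
    (hS : Algebra.adjoin k (primitives k S : Set S) = ⊤) :
    (restrictRS τ).Nondegenerate ↔
      (τ.compl₁₂ (𝓡.inR.toLinearMap ∘ₗ (primitives k R).subtype)
        (𝓢.inR.toLinearMap ∘ₗ (primitives k S).subtype)).Nondegenerate ∧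
      𝓡.IsNichols ∧ 𝓢.IsNichols := by
  have hL := hτ.hasHopfRadical_left h hK hJK hS
  have hR' := hτ.hasHopfRadical_right h hJ hJK hR
  have hVL : (∀ v ∈ primitives k R, (∀ w ∈ primitives k S, restrictRS τ v w = 0) →
      restrictRS τ v = 0) := by
    intro v hv hvw
    rw [← LinearMap.ker_eq_top, eq_top_iff, ← hL.iSup_eq_top]
    refine iSup_le fun m s hs => LinearMap.mem_ker.2 ?_
    by_cases hm : 1 = m
    · subst hm
      exact hvw s (by simpa using hs)
    · exact hL.orthogonal m 1 hm v (by simpa using hv) s hs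
  have hVR : (∀ w ∈ primitives k S, (∀ v ∈ primitives k R, restrictRS τ v w = 0) →
      (restrictRS τ).flip w = 0) := by
    intro w hw hvw
    rw [← LinearMap.ker_eq_top, eq_top_iff, ← hR'.iSup_eq_top]
    refine iSup_le fun m s hs => LinearMap.mem_ker.2 ?_
    by_cases hm : 1 = m
    · subst hm
      exact hvw s (by simpa using hs)
    · exact hR'.orthogonal m 1 hm w (by simpa using hw) s hs
  have key : (∀ v ∈ primitives k R, restrictRS τ v = 0 → v = 0) →
      (∀ w ∈ primitives k S, (restrictRS τ).flip w = 0 → w = 0) →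
      ((restrictRS τ).Nondegenerate ↔ 𝓡.IsNichols ∧ 𝓢.IsNichols) := by
    intro h1 h2
    rw [hL.isNichols_iff hR h1 (hτ.restrictRS_eq_zero_of_isNicholsIdeal h hL hS),
      hR'.isNichols_iff hS h2 (hτ.flip_restrictRS_eq_zero_of_isNicholsIdeal h hK hJK hR' hR)]
    exact and_congr ⟨fun h r hr => h r fun s => LinearMap.congr_fun hr s,
        fun h r hr => h r (LinearMap.ext hr)⟩
      ⟨fun h s hs => h s fun r => LinearMap.congr_fun hs r,
        fun h s hs => h s (LinearMap.ext hs)⟩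
  constructor
  · intro hnd
    refine ⟨⟨?_, ?_⟩, (key ?_ ?_).1 hnd⟩
    · intro v hv
      refine Subtype.ext (hnd.1 _ fun s => LinearMap.congr_fun (hVL v v.2 fun w hw => ?_) s)
      exact hv ⟨w, hw⟩
    · intro w hw
      refine Subtype.ext (hnd.2 _ fun r => LinearMap.congr_fun (hVR w w.2 fun v hv => ?_) r)
      exact hw ⟨v, hv⟩
    · exact fun v _ hv => hnd.1 v fun s => LinearMap.congr_fun hv s
    · exact fun w _ hw => hnd.2 w fun r => LinearMap.congr_fun hw r
  · rintro ⟨hVW, hN⟩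
    refine (key ?_ ?_).2 hN
    · intro v hv hv0
      have := hVW.1 ⟨v, hv⟩ fun w => LinearMap.congr_fun hv0 w
      exact congrArg Subtype.val this
    · intro w hw hw0
      have := hVW.2 ⟨w, hw⟩ fun v => LinearMap.congr_fun hw0 v
      exact congrArg Subtype.val this

end IsSkewPairing

end YDHopf

theorem lemma7p5 {k J K R S : Type*} [Field k]
    [Ring J] [HopfAlgebra k J] [Ring K] [HopfAlgebra k K]
    (hJ : Function.Bijective (HopfAlgebra.antipode k : J →ₗ[k] J))
    (hK : Function.Bijective (HopfAlgebra.antipode k : K →ₗ[k] K))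
    [Ring R] [Algebra k R] [Coalgebra k R] [Ring S] [Algebra k S] [Coalgebra k S]
    (𝓡 : BraidedHopfAlgebra k J R) (𝓢 : BraidedHopfAlgebra k K S)
    (τ : 𝓡.Bosonization →ₗ[k] 𝓢.Bosonization →ₗ[k] k) (hτ : IsSkewPairing τ) :
    -- (1)
    ((∀ (a : J) (s : S), τ (𝓡.inJ a) (𝓢.inR s) =
        Coalgebra.counit (R := k) a * Coalgebra.counit (R := k) s) →
      (∀ (r : R) (x : K), τ (𝓡.inR r) (𝓢.inJ x) =
        Coalgebra.counit (R := k) r * Coalgebra.counit (R := k) x) →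
      (∀ (x : K), ∀ v ∈ primitives k R,
        conjugate ((GeneralizedDouble.inRight hτ).comp 𝓢.inJ) x
            (GeneralizedDouble.inLeft hτ (𝓡.inR v)) =
          GeneralizedDouble.inLeft hτ (𝓡.inR (TensorProduct.lid k R
            ((τ.flip (𝓢.inJ x) ∘ₗ 𝓡.inJ.toLinearMap).rTensor R (𝓡.coact v))))) ∧
      (∀ (x : K), ∀ v ∈ primitives k R,
        conjugate ((GeneralizedDouble.inRight hτ).comp 𝓢.inJ) x
            (GeneralizedDouble.inLeft hτ (𝓡.inR v)) ∈
          (primitives k R).map ((GeneralizedDouble.inLeft hτ).comp 𝓡.inR).toLinearMap) ∧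
      (∀ (a : J), ∀ w ∈ primitives k S,
        conjugate ((GeneralizedDouble.inLeft hτ).comp 𝓡.inJ) a
            (GeneralizedDouble.inRight hτ (𝓢.inR w)) =
          GeneralizedDouble.inRight hτ (𝓢.inR (TensorProduct.lid k S
            ((τ (𝓡.inJ (HopfAlgebra.antipode k a)) ∘ₗ 𝓢.inJ.toLinearMap).rTensor S
              (𝓢.coact w))))) ∧
      (∀ (a : J), ∀ w ∈ primitives k S,
        conjugate ((GeneralizedDouble.inLeft hτ).comp 𝓡.inJ) a
            (GeneralizedDouble.inRight hτ (𝓢.inR w)) ∈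
          (primitives k S).map ((GeneralizedDouble.inRight hτ).comp 𝓢.inR).toLinearMap)) ∧
    -- (2)
    ((∀ (a : J) (s : S), τ (𝓡.inJ a) (𝓢.inR s) =
        Coalgebra.counit (R := k) a * Coalgebra.counit (R := k) s) →
      (∀ (r : R) (x : K), τ (𝓡.inR r) (𝓢.inJ x) =
        Coalgebra.counit (R := k) r * Coalgebra.counit (R := k) x) →
      (∀ (r : R) (s s' : S), τ (𝓡.inR r) (𝓢.inR (s * s')) =
        LinearMap.mul' k k (TensorProduct.map
          (τ.flip (𝓢.inR s') ∘ₗ 𝓡.inR.toLinearMap) (τ.flip (𝓢.inR s) ∘ₗ 𝓡.inR.toLinearMap)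
          (Coalgebra.comul r))) ∧
      (∀ T : 𝓡.Bosonization →ₗ[k] 𝓡.Bosonization,
        T ∘ₗ HopfAlgebra.antipode k = LinearMap.id → HopfAlgebra.antipode k ∘ₗ T = LinearMap.id →
        (∀ (r r' : R) (s : S), τ (T (𝓡.inR r) * T (𝓡.inR r')) (𝓢.inR s) =
          LinearMap.mul' k k (TensorProduct.map
            (τ (T (𝓡.inR r)) ∘ₗ 𝓢.inR.toLinearMap) (τ (T (𝓡.inR r')) ∘ₗ 𝓢.inR.toLinearMap)
            (Coalgebra.comul s))) ∧
        (∀ (r : R) (a : J) (s : S) (x : K),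
          τ (T (𝓡.inR r) * 𝓡.inJ a) (𝓢.inR s * 𝓢.inJ x) =
            τ (T (𝓡.inR r)) (𝓢.inR s) * τ (𝓡.inJ a) (𝓢.inJ x))) ∧
      (τ.Nondegenerate ↔
        (τ.compl₁₂ 𝓡.inJ.toLinearMap 𝓢.inJ.toLinearMap).Nondegenerate ∧
        (τ.compl₁₂ 𝓡.inR.toLinearMap 𝓢.inR.toLinearMap).Nondegenerate)) ∧
    -- (3)
    (Algebra.adjoin k (primitives k R : Set R) = ⊤ →
      Algebra.adjoin k (primitives k S : Set S) = ⊤ →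
      (∀ (a : J), ∀ w ∈ primitives k S, τ (𝓡.inJ a) (𝓢.inR w) = 0) →
      (∀ v ∈ primitives k R, ∀ (x : K), τ (𝓡.inR v) (𝓢.inJ x) = 0) →
      (τ.compl₁₂ 𝓡.inJ.toLinearMap 𝓢.inJ.toLinearMap).Nondegenerate →
      ∃ T : 𝓡.Bosonization →ₗ[k] 𝓡.Bosonization,
        T ∘ₗ HopfAlgebra.antipode k = LinearMap.id ∧ HopfAlgebra.antipode k ∘ₗ T = LinearMap.id ∧
        List.TFAE [
          (τ.compl₁₂ 𝓡.inR.toLinearMap 𝓢.inR.toLinearMap).Nondegenerate,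
          (τ.compl₁₂ (𝓡.inR.toLinearMap ∘ₗ (primitives k R).subtype)
              (𝓢.inR.toLinearMap ∘ₗ (primitives k S).subtype)).Nondegenerate ∧
            𝓡.IsNichols ∧ 𝓢.IsNichols,
          (τ.compl₁₂ ((LinearMap.range 𝓡.inR.toLinearMap).map T).subtype
              𝓢.inR.toLinearMap).Nondegenerate,
          τ.Nondegenerate]) := by
  refine ⟨fun h1 h2 => ?_, fun h1 h2 => ?_, fun hR hS h1 h2 hJK => ?_⟩
  · have h : IsMixedTrivial τ := ⟨h1, h2⟩
    refine ⟨fun x v _ => ?_, fun x v hv => ?_, fun a w _ => hτ.conjugate_inJ h a w,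
      fun a w hw => ?_⟩
    · rw [hτ.conjugate_inR h, IsSkewPairing.coactOp_apply]
    · rw [hτ.conjugate_inR h, IsSkewPairing.coactOp_apply]
      exact ⟨_, lid_rTensor_mem _ _ (𝓡.coact_mem_primitives v hv), rfl⟩
    · rw [hτ.conjugate_inJ h]
      exact ⟨_, lid_rTensor_mem _ _ (𝓢.coact_mem_primitives w hw), rfl⟩
  · have h : IsMixedTrivial τ := ⟨h1, h2⟩
    obtain ⟨TJ, hTJ, -⟩ := exists_antipodeInv hJ
    exact ⟨hτ.inR_inR_mul h, fun T hT hT' =>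
      ⟨hτ.antipodeInv_mul_antipodeInv h hTJ hT hT', hτ.antipodeInv_mul_inJ_inR_mul_inJ h hTJ hT hT'⟩,
      hτ.nondegenerate_iff h hK⟩
  · have h : IsMixedTrivial τ := hτ.isMixedTrivial_of_adjoin hR hS h1 h2
    obtain ⟨TJ, hTJ, -⟩ := exists_antipodeInv hJ
    obtain ⟨T, hT, hT'⟩ := 𝓡.exists_antipodeInv_bosonization hJ hR
    refine ⟨T, hT, hT', ?_⟩
    have hab := hτ.nondegenerate_restrictRS_iff h hJ hK hJK hR hS
    have hae := hτ.nondegenerate_iff h hK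
    have hce := hτ.nondegenerate_iff_antipodeInv h hTJ hT hT' hJ
    rw [and_iff_left hJK] at hce
    rw [and_iff_right hJK] at hae
    tfae_have 1 ↔ 2 := hab
    tfae_have 4 ↔ 1 := hae
    tfae_have 4 ↔ 3 := hce
    tfae_finish
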